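/- **Setting.** A restricted Boltzmann machine (RBM) $R=(J,h,g)$ with $n$ visible and $m$ hidden nodes, $J\in\mathbb R^{n\times m}$, $h\in\mathbb R^n$, $g\in\mathbb R^m$, defines the distribution $P(x,y)\propto\exp(x^TJy+h^Tx+g^Ty)$ on $\{\pm1\}^n\times\{\pm1\}^m$; let $p(x)=\sum_yP(x,y)$ and $|\phi\rangle_R=\sum_x\sqrt{p(x)}\,|x\rangle$. $R$ is locally consistent if, for each hidden node $j$, either $J_{ij}\ge0$ for all $i$ or $J_{ij}\le 0$ for all $i$. It is $(\alpha,\beta)$-nondegenerate if $|J_{ij}|\ge\alpha$ whenever $J_{ij}\neq0$, $\sum_j|J_{ij}|+|h_i|\le\beta$ for all $i$, and $\sum_i|J_{ij}|+|g_j|\le\beta$ for all $j$. The two-hop neighbourhood $\mathcal N_2(i)$ is the set of visible nodes $v\ne i$ connected to $i$ via a hidden node, and the two-hop degree is $\max_i|\mathcal N_2(i)|$. $\mathcal C=\mathcal C(n,d_2,\alpha,\beta)$ is the set of states $|\phi\rangle_R$ with $R$ locally consistent, $(\alpha,\beta)$-nondegenerate and of two-hop degree $d_2$. For an $n$-qubit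 state $|\psi\rangle$ (a unit vector) put $\tilde p(x)=|\langle x|\psi\rangle|^2$. For real $p\ge1$, $|\psi\rangle\in\mathcal C(\epsilon_p)$ is associated with $|\phi\rangle_R\in\mathcal C$ if $\big(\sum_x|p(x)-\tilde p(x)|^p\big)^{1/p}\le\epsilon_p$. A state $|\psi\rangle\in\mathcal C(\varrho)$ is associated with $|\phi\rangle_R\in\mathcal C$ if, for some $r\in[0,1]$ with $r\le\varrho$, it is the normalization of $\sum_x\sqrt{p(x)}\bigotimes_{i=1}^n\big(\sqrt{1-r}\,|x_i\rangle+\sqrt r\,|{-x_i}\rangle\big)$. **Learner.** Given the sets $\mathcal N_2(u)$ and samples split into $k$ training and $N$ held-out samples, run Alphatron for each node $u$, with labels $x_u$, link function $\tanh$, learning rate $1$, feature map $\big(2^{-|\mathcal N_2(u)|/2}x_S\big)_{S\subseteq\mathcal N_2(u)}$ and its kernel $\mathcal K$: start from $a^0=0\in\mathbb R^k$, iterate $a_i^{t+1}=a_i^t+\frac1k\big(x^{(i)}_u-\tanh(\sum_ja^t_j\mathcal K(x^{(j)},x^{(i)}))\big)$ for $T$ steps, and return the iterate $t\le T$ for which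 $\tanh(\sum_ja^t_j\mathcal K(x^{(j)},\cdot))$ has the least squared error on the held-out samples (the latest one in case of a tie). The polynomial $\sum_ja^t_j\mathcal K(x^{(j)},\cdot)=:\tilde q_u^*$ estimates the partial potential at $u$. Let $\tilde q^*$ be the multilinear polynomial whose coefficient at $x_S$, $S\neq\emptyset$, is that of $x_{S\setminus\{u\}}$ in $\tilde q_u^*$, for an arbitrarily fixed $u=u(S)\in S$, and whose constant coefficient is $0$; put $\tilde p^*(x)=e^{\tilde q^*(x)}/\sum_ze^{\tilde q^*(z)}$. **Theorem (Quantum state learning).** Let $\sigma(x)=1/(1+e^{-x})$ and $\vartheta=\sigma(-2\beta)^{2d_2}(1-\tanh^2\beta)^3$. For all constants $c,C>0$ there are constants $K,L>0$, depending only on $c$ and $C$, such that the following holds for all $n,d_2$, $\beta\ge0$, $\epsilon_t>0$, $\delta\in(0,\tfrac12]$ and every number of copies $$M\ \ge\ C\,\frac{\beta^2\,2^{d_2}\,n^2\log(1/\delta)}{\vartheta\,(1-\tanh^2\beta)\,\epsilon_t^4}.$$ There are $T\le L\,\beta\,2^{d_2/2}\sqrt{M/\log(1/\delta)}$ and a split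 $M=k+N$, depending on $n,d_2,\beta,\epsilon_t,\delta,M$ only, such that for every $\alpha$, every $|\phi\rangle_R\in\mathcal C(n,d_2,\alpha,\beta)$ and every state $|\psi\rangle$ which is either 1. in $\mathcal C(\epsilon_p)$ and associated with $|\phi\rangle_R$, for some $p\ge1$ and $\displaystyle\epsilon_p\le c\,\frac{\vartheta\,\epsilon_t^2}{(\sqrt{n2^{d_2}}+n)^2\,2^{(n-1)(1-1/p)}}$, or 2. in $\mathcal C(\varrho)$ and associated with $|\phi\rangle_R$, for some $\displaystyle\varrho\le c\,\frac{\vartheta\,\epsilon_t^2}{n(\sqrt{n2^{d_2}}+n)^2}$, the learner, given the two-hop neighbourhoods of $R$ and the outcomes of measuring $M$ copies of $|\psi\rangle$ in the computational basis, achieves with probability at least $1-\delta$ $$\sum_{x\in\{\pm1\}^n}\big|\tilde p(x)-\tilde p^*(x)\big|\ \le\ K\,\epsilon_t .$$ -/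

import Mathlib

open MeasureTheory

/-- Configurations `x ∈ {±1}ⁿ`; `true` stands for `+1` and `false` for `-1`. -/
abbrev Cfg (n : ℕ) : Type := Fin n → Bool

/-- The value `±1` of a node. -/
def spin (b : Bool) : ℝ := if b then 1 else -1

/-- The monomial `x_S = ∏_{i ∈ S} x_i`. -/
def monomialAt {n : ℕ} (S : Finset (Fin n)) (x : Cfg n) : ℝ := ∏ i ∈ S, spin (x i)

/-! ### Restricted Boltzmann machines -/

/-- A restricted Boltzmann machine `(J, h, g)` with `n` visible and `m` hidden nodes. -/
structure RBM (n m : ℕ) where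
  J : Matrix (Fin n) (Fin m) ℝ
  h : Fin n → ℝ
  g : Fin m → ℝ

namespace RBM

variable {n m : ℕ} (R : RBM n m)

/-- The Boltzmann weight `exp (xᵀ J y + hᵀ x + gᵀ y)`. -/
noncomputable def weight (x : Cfg n) (y : Cfg m) : ℝ :=
  Real.exp ((∑ i, ∑ j, spin (x i) * R.J i j * spin (y j))
    + (∑ i, R.h i * spin (x i)) + ∑ j, R.g j * spin (y j))

/-- The partition function. -/
noncomputable def partition : ℝ := ∑ x, ∑ y, R.weight x y

/-- The joint distribution `P(X = x, Y = y)`. -/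
noncomputable def joint (x : Cfg n) (y : Cfg m) : ℝ := R.weight x y / R.partition

/-- The marginal distribution `p(x)` of the visible nodes. -/
noncomputable def marginal (x : Cfg n) : ℝ := ∑ y, R.joint x y

/-- Local consistency: the interactions of each hidden node have one sign. -/
def LocallyConsistent : Prop :=
  ∀ j, (∀ i, 0 ≤ R.J i j) ∨ (∀ i, R.J i j ≤ 0)

/-- `(α, β)`-nondegeneracy. -/
def Nondegenerate (α β : ℝ) : Prop :=
  (∀ i j, R.J i j ≠ 0 → α ≤ |R.J i j|) ∧
  (∀ i, (∑ j, |R.J i j|) + |R.h i| ≤ β) ∧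
  (∀ j, (∑ i, |R.J i j|) + |R.g j| ≤ β)

open Classical in
/-- The two-hop neighbourhood of `i`: the visible nodes other than `i` that are connected to `i`
via a hidden node. -/
noncomputable def twoHop (i : Fin n) : Finset (Fin n) :=
  Finset.univ.filter fun v => v ≠ i ∧ ∃ k, R.J i k ≠ 0 ∧ R.J v k ≠ 0

/-- The two-hop degree `max_i |N₂(i)|`. -/
noncomputable def twoHopDegree : ℕ := Finset.univ.sup fun i => (R.twoHop i).card

end RBM

/-! ### Quantum states -/

/-- The Hilbert space of `n` qubits, in coordinates with respect to the computational basis. -/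
abbrev QubitSpace (n : ℕ) : Type := EuclideanSpace ℂ (Cfg n)

/-- The neural network quantum state `|φ⟩_R = ∑ₓ √p(x) |x⟩`. -/
noncomputable def RBM.state {n m : ℕ} (R : RBM n m) : QubitSpace n :=
  WithLp.toLp 2 fun x => ((Real.sqrt (R.marginal x) : ℝ) : ℂ)

/-- The (in general unnormalised) vector
`∑ₓ √p(x) ⊗ᵢ (√(1-ρ) |xᵢ⟩ + √ρ |-xᵢ⟩)` of coherent bit flips, in coordinates. -/
noncomputable def RBM.flipVector {n m : ℕ} (R : RBM n m) (ρ : ℝ) : QubitSpace n :=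
  WithLp.toLp 2 fun z =>
    ((∑ x, Real.sqrt (R.marginal x) *
      ∏ i, (if z i = x i then Real.sqrt (1 - ρ) else Real.sqrt ρ) : ℝ) : ℂ)

/-- The `L_p` distance of the magnitudes of two states. -/
noncomputable def magnitudeDist {n : ℕ} (p : ℝ) (ψ φ : QubitSpace n) : ℝ :=
  (∑ x, |‖φ x‖ ^ 2 - ‖ψ x‖ ^ 2| ^ p) ^ (1 / p)

/-- The RBMs on which the class `C(n, d₂, α, β)` of states is based. -/
def RBM.IsAdmissible {n m : ℕ} (R : RBM n m) (d₂ : ℕ) (α β : ℝ) : Prop :=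
  R.LocallyConsistent ∧ R.Nondegenerate α β ∧ R.twoHopDegree = d₂

/-- `ψ` is a state of the class `C(ε_p)`, associated with the state of `R`. -/
def LpAssociated {n m : ℕ} (p ε : ℝ) (ψ : QubitSpace n) (R : RBM n m) : Prop :=
  ‖ψ‖ = 1 ∧ magnitudeDist p ψ R.state ≤ ε

/-- `ψ` is a state of the class `C(ρ)`, associated with the state of `R`: the normalised result of
coherent bit flips of probability at most `ρ`. -/
def FlipAssociated {n m : ℕ} (ρ : ℝ) (ψ : QubitSpace n) (R : RBM n m) : Prop :=
  ∃ r : ℝ, 0 ≤ r ∧ r ≤ 1 ∧ r ≤ ρ ∧ ψ = ((‖R.flipVector r‖⁻¹ : ℝ) : ℂ) • R.flipVector r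

/-- The law of a measurement of `ψ` in the computational basis. -/
noncomputable def bornMeasure {n : ℕ} (ψ : QubitSpace n) : Measure (Cfg n) :=
  ∑ x, ENNReal.ofReal (‖ψ x‖ ^ 2) • Measure.dirac x

/-! ### Alphatron -/

/-- The coefficients `αᵗ` of Alphatron with kernel `K`, link function `u` and learning rate `lam`
on the training data `(xᵢ, yᵢ)`:
`α⁰ = 0`, `αᵢᵗ⁺¹ = αᵢᵗ + (lam / k) (yᵢ - u (∑ⱼ αⱼᵗ K(xⱼ, xᵢ)))`. -/
noncomputable def alphatronCoeff {X : Type*} {k : ℕ} (K : X → X → ℝ) (u : ℝ → ℝ) (lam : ℝ)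
    (x : Fin k → X) (y : Fin k → ℝ) : ℕ → Fin k → ℝ
  | 0 => fun _ => 0
  | t + 1 => fun i =>
      alphatronCoeff K u lam x y t i +
        lam / k * (y i - u (∑ j, alphatronCoeff K u lam x y t j * K (x j) (x i)))

/-- The squared error of the `t`-th hypothesis `z ↦ u (∑ⱼ αⱼᵗ K(xⱼ, z))` on the held-out data
`(aⱼ, bⱼ)`. -/
noncomputable def alphatronHeldOutError {X : Type*} {k N : ℕ} (K : X → X → ℝ) (u : ℝ → ℝ)
    (lam : ℝ) (x : Fin k → X) (y : Fin k → ℝ) (a : Fin N → X) (b : Fin N → ℝ) (t : ℕ) : ℝ :=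
  ∑ l, (u (∑ j, alphatronCoeff K u lam x y t j * K (x j) (a l)) - b l) ^ 2

open Classical in
/-- The iterate that Alphatron returns after `T` iterations: the one with the smallest held-out
error, the latest one in case of a tie (hence the last one if no data are held out). -/
noncomputable def alphatronIndex {X : Type*} {k N : ℕ} (K : X → X → ℝ) (u : ℝ → ℝ) (lam : ℝ)
    (T : ℕ) (x : Fin k → X) (y : Fin k → ℝ) (a : Fin N → X) (b : Fin N → ℝ) : ℕ :=
  ((Finset.range (T + 1)).filter fun t => ∀ s ∈ Finset.range (T + 1),
    alphatronHeldOutError K u lam x y a b t ≤ alphatronHeldOutError K u lam x y a b s).sup id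

/-! ### Learning the potential node by node -/

/-- The feature map of a node with neighbourhood `A`: all monomials `x_S`, `S ⊆ A`, scaled so that
the feature vector has Euclidean norm one. -/
noncomputable def nodeFeature {n : ℕ} (A : Finset (Fin n)) (x : Cfg n) (S : Finset (Fin n)) : ℝ :=
  if S ⊆ A then monomialAt S x / Real.sqrt (2 ^ A.card) else 0

/-- The kernel of the feature map. -/
noncomputable def nodeKernel {n : ℕ} (A : Finset (Fin n)) (x x' : Cfg n) : ℝ :=
  ∑ S, nodeFeature A x S * nodeFeature A x' S

/-- The coefficient of `x_S` in the partial potential of node `v` that Alphatron learns from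
training samples `x` and held-out samples `a`. The input is the neighbourhood `A` of `v`, the label
is `x_v`, the link function is `tanh` and the learning rate is `1`. The returned hypothesis
`z ↦ tanh (∑ⱼ αⱼ K(xⱼ, z))` is `tanh` of the polynomial with these coefficients. -/
noncomputable def nodePotential {n k N : ℕ} (T : ℕ) (A : Finset (Fin n)) (v : Fin n)
    (x : Fin k → Cfg n) (a : Fin N → Cfg n) (S : Finset (Fin n)) : ℝ :=
  (∑ j, alphatronCoeff (nodeKernel A) Real.tanh 1 x (fun i => spin (x i v))
      (alphatronIndex (nodeKernel A) Real.tanh 1 T x (fun i => spin (x i v))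
        a (fun i => spin (a i v))) j
    * nodeFeature A (x j) S) / Real.sqrt (2 ^ A.card)

/-- The learned potential: the coefficient of `x_S`, for `S` nonempty, is the one of `x_{S \ {v}}`
in the learned partial potential of a node `v = pick S` in `S`. -/
noncomputable def learnedPotential {n k N : ℕ} (T : ℕ) (nbhd : Fin n → Finset (Fin n))
    (pick : Finset (Fin n) → Fin n) (x : Fin k → Cfg n) (a : Fin N → Cfg n)
    (S : Finset (Fin n)) : ℝ :=
  if S.Nonempty then nodePotential T (nbhd (pick S)) (pick S) x a (S.erase (pick S)) else 0

/-- The value at `x` of the multilinear polynomial `∑_S q_S x_S`. -/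
noncomputable def potentialValue {n : ℕ} (q : Finset (Fin n) → ℝ) (x : Cfg n) : ℝ :=
  ∑ S, q S * monomialAt S x

/-- The Markov random field `exp (q(x)) / Z` with potential `q`. -/
noncomputable def mrf {n : ℕ} (q : Finset (Fin n) → ℝ) (x : Cfg n) : ℝ :=
  Real.exp (potentialValue q x) / ∑ z, Real.exp (potentialValue q z)

/-! ### Parameters -/

/-- `ϑ = σ(-2β)^(2 d₂) (1 - tanh² β)³` with the sigmoid `σ`. -/
noncomputable def learnTheta (d₂ : ℕ) (β : ℝ) : ℝ :=
  Real.sigmoid (-2 * β) ^ (2 * d₂) * (1 - Real.tanh β ^ 2) ^ 3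

/-! ### Elementary facts on `tanh` -/

/-! The marginal of the visible nodes is the Gibbs measure of `R.potential`, and under it the
conditional mean of the spin at `u` given the others is `tanh` of `siteDeriv u R.potential`. Summing
out the hidden nodes makes the potential a sum over hidden units, so this local field depends on the
two-hop neighbourhood only (`RBM.siteDeriv_potential_flipAt`). It is therefore a linear function of
the feature vector, with a weight vector `targetVec` of norm at most `β 2^(d/2)`, and Alphatron is
gradient descent for a well-specified logistic regression. The proof holds no samples out; the tie
rule then returns the last iterate.

Convergence is in parameter space. Conditional spin probabilities are at least `σ(-2β)`, which
bounds the second moments of the features below by `σ(-2β)^d` (`pow_card_mul_norm_sq_le`). Together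
with a lower bound on the slope of `tanh`, every step contracts the error at the rate `learnRate`
(`norm_sub_gradient_le`), up to the size of the empirical gradient at the target. That gradient has
a bias, caused by the noise in the state, and a fluctuation. The fluctuations of all nodes, together
with those of the second moments, are the coordinates of the mean of independent vectors of norm
`O(√n)`, so one vector-valued concentration bound (`sum_sampleWeight_deviation_le`) controls the sum
of their squares without a union bound over nodes.

Noise in `L_p` becomes `L_1` noise by Hölder's inequality. For coherent bit flips this would be too
crude: the measured distribution is again a Gibbs measure, and flips far from `u` hardly affect its
local field at `u`, so the bias is of order `d θ` although the distribution moves by `n θ`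
(`flipAssociated_bounds`).

The passage from coefficients to distributions interpolates between the two potentials: the
derivative of the Gibbs measure is a covariance, so the `L_1` distance is at most the largest
standard deviation of the potential error along the path (`sum_abs_gibbs_sub_le`). There are three
regimes. If `β 2^(d/2) ≥ ε`, the number of copies is large enough for the trivial bound by the
supremum norm. If `β 2^(d/2) < ε ≤ β √n`, the interactions are weak, and the Dobrushin-type
inequality `varianceOf_gibbs_le_of_weak_dependence` replaces a factor `√n` by `d + 1`. If both
quantities are below `ε`, the data may be useless, but the uniform distribution, returned after zero
iterations, is already accurate. -/

theorem hasDerivAt_real_tanh (x : ℝ) : HasDerivAt Real.tanh (1 - Real.tanh x ^ 2) x := by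
  have h := (Real.hasDerivAt_sinh x).div (Real.hasDerivAt_cosh x) (Real.cosh_pos x).ne'
  have h2 : (fun y => Real.sinh y / Real.cosh y) = Real.tanh := by
    funext y; rw [Real.tanh_eq_sinh_div_cosh]
  have h3 : (Real.sinh / Real.cosh : ℝ → ℝ) = Real.tanh := h2
  rw [h3] at h
  have e : 1 - Real.tanh x ^ 2
      = (Real.cosh x * Real.cosh x - Real.sinh x * Real.sinh x) / Real.cosh x ^ 2 := by
    rw [Real.tanh_eq_sinh_div_cosh]
    have := (Real.cosh_pos x).ne'
    field_simp
  rw [e]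
  exact h

theorem tanh_sq_le_one (x : ℝ) : Real.tanh x ^ 2 ≤ 1 := (Real.tanh_sq_lt_one x).le

theorem abs_tanh_le_one (x : ℝ) : |Real.tanh x| ≤ 1 := (Real.abs_tanh_lt_one x).le

theorem abs_tanh_sub_tanh_le (a b : ℝ) : |Real.tanh a - Real.tanh b| ≤ |a - b| := by
  have := Convex.norm_image_sub_le_of_norm_hasDerivWithin_le (f := Real.tanh)
    (f' := fun x => 1 - Real.tanh x ^ 2) (s := Set.univ) (C := 1) (x := b) (y := a)
    (fun x _ => (hasDerivAt_real_tanh x).hasDerivWithinAt)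
    (fun x _ => by
      rw [Real.norm_eq_abs, abs_le]
      constructor <;> nlinarith [tanh_sq_le_one x, sq_nonneg (Real.tanh x)])
    convex_univ (Set.mem_univ _) (Set.mem_univ _)
  simpa using this

theorem one_sub_tanh_sq (x : ℝ) : 1 - Real.tanh x ^ 2 = 1 / Real.cosh x ^ 2 := by
  rw [Real.tanh_eq_sinh_div_cosh]
  have h := (Real.cosh_pos x).ne'
  field_simp
  nlinarith [Real.cosh_sq x]

theorem tanh_mono {a b : ℝ} (h : a ≤ b) : Real.tanh a ≤ Real.tanh b := by
  have hm : Monotone Real.tanh := by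
    apply monotone_of_deriv_nonneg (fun x => (hasDerivAt_real_tanh x).differentiableAt)
    intro x
    rw [(hasDerivAt_real_tanh x).deriv]
    linarith [tanh_sq_le_one x]
  exact hm h

/-! ### Flips of single spins -/

theorem spin_mul_self (b : Bool) : spin b * spin b = 1 := by cases b <;> simp [spin]

theorem spin_not (b : Bool) : spin (!b) = -spin b := by cases b <;> simp [spin]

theorem abs_spin (b : Bool) : |spin b| = 1 := by cases b <;> simp [spin]

/-- The configuration `x` with the spin at `i` flipped. -/
def flipAt {n : ℕ} (i : Fin n) (x : Cfg n) : Cfg n := Function.update x i (!x i)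

section flips

variable {n : ℕ}

@[simp] theorem flipAt_same (i : Fin n) (x : Cfg n) : flipAt i x i = !x i := by simp [flipAt]

theorem flipAt_ne {i j : Fin n} (h : j ≠ i) (x : Cfg n) : flipAt i x j = x j := by
  simp [flipAt, h]

@[simp] theorem flipAt_flipAt (i : Fin n) (x : Cfg n) : flipAt i (flipAt i x) = x := by
  funext j
  by_cases h : j = i
  · subst h; simp
  · simp [flipAt_ne h]

theorem flipAt_comm (i j : Fin n) (x : Cfg n) :
    flipAt i (flipAt j x) = flipAt j (flipAt i x) := by
  by_cases hij : i = j
  · subst hij; rfl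
  funext l
  by_cases h : l = i
  · subst h; simp [flipAt_ne hij]
  · by_cases h' : l = j
    · subst h'; simp [flipAt_ne h]
    · simp [flipAt_ne h, flipAt_ne h']

theorem spin_flipAt_same (i : Fin n) (x : Cfg n) : spin (flipAt i x i) = -spin (x i) := by
  simp [spin_not]

theorem sum_flipAt {E : Type*} [AddCommMonoid E] (i : Fin n) (F : Cfg n → E) :
    ∑ x, F (flipAt i x) = ∑ x, F x :=
  Equiv.sum_comp (Function.Involutive.toPerm (flipAt i) (flipAt_flipAt i)) F

theorem sum_eq_zero_of_add_flipAt (i : Fin n) (F : Cfg n → ℝ)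
    (h : ∀ x, F x + F (flipAt i x) = 0) : ∑ x, F x = 0 := by
  have h1 : ∑ x, (F x + F (flipAt i x)) = 0 := Finset.sum_eq_zero fun x _ => h x
  rw [Finset.sum_add_distrib, sum_flipAt] at h1
  linarith

/-- A function with one-spin oscillations at most `d i` varies by at most `∑ i ∈ S, d i` between
configurations that differ on `S` only. -/
theorem abs_sub_le_sum_of_flipAt (g : Cfg n → ℝ) (d : Fin n → ℝ)
    (hd : ∀ i x, |g x - g (flipAt i x)| ≤ d i) (y : Cfg n) (S : Finset (Fin n)) :
    ∀ x : Cfg n, (∀ i, i ∉ S → x i = y i) → |g x - g y| ≤ ∑ i ∈ S, d i := by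
  have hd0 : ∀ i, 0 ≤ d i := fun i => (abs_nonneg _).trans (hd i y)
  induction S using Finset.induction_on with
  | empty =>
    intro x hx
    have : x = y := funext fun i => hx i (by simp)
    simp [this]
  | insert a S ha ih =>
    intro x hx
    rw [Finset.sum_insert ha]
    by_cases hxa : x a = y a
    · have := ih x (fun i hi => by
        by_cases h : i = a
        · rw [h, hxa]
        · exact hx i (by simp [h, hi]))
      linarith [hd0 a]
    · have h1 := ih (flipAt a x) (fun i hi => by
        by_cases h : i = a
        · subst h
          rw [flipAt_same]
          cases hx1 : x i <;> cases hy1 : y i <;> simp_all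
        · rw [flipAt_ne h]; exact hx i (by simp [h, hi]))
      have h2 := abs_sub_le (g x) (g (flipAt a x)) (g y)
      linarith [hd a x]

/-- The coefficient of `x_i` in `f`, as a function of the other spins. -/
noncomputable def siteDeriv (i : Fin n) (f : Cfg n → ℝ) (x : Cfg n) : ℝ :=
  spin (x i) * (f x - f (flipAt i x)) / 2

@[simp] theorem siteDeriv_flipAt (i : Fin n) (f : Cfg n → ℝ) (x : Cfg n) :
    siteDeriv i f (flipAt i x) = siteDeriv i f x := by
  simp only [siteDeriv, spin_flipAt_same, flipAt_flipAt]; ring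

theorem sub_flipAt_eq (i : Fin n) (f : Cfg n → ℝ) (x : Cfg n) :
    f x - f (flipAt i x) = 2 * (spin (x i) * siteDeriv i f x) := by
  have := spin_mul_self (x i)
  rw [siteDeriv]
  linear_combination (-(f x - f (flipAt i x))) * this

theorem abs_siteDeriv (i : Fin n) (f : Cfg n → ℝ) (x : Cfg n) :
    |siteDeriv i f x| = |f x - f (flipAt i x)| / 2 := by
  rw [siteDeriv, abs_div, abs_mul, abs_spin]; norm_num

theorem siteDeriv_add_mul (i : Fin n) (f g : Cfg n → ℝ) (t : ℝ) (x : Cfg n) :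
    siteDeriv i (fun y => f y + t * g y) x = siteDeriv i f x + t * siteDeriv i g x := by
  simp only [siteDeriv]; ring

/-! ### Gibbs measures -/

/-- The probability vector proportional to `exp f`. -/
noncomputable def gibbs (f : Cfg n → ℝ) (x : Cfg n) : ℝ :=
  Real.exp (f x) / ∑ z, Real.exp (f z)

theorem sum_exp_pos (f : Cfg n → ℝ) : 0 < ∑ z, Real.exp (f z) :=
  Finset.sum_pos (fun _ _ => Real.exp_pos _) Finset.univ_nonempty

theorem gibbs_pos (f : Cfg n → ℝ) (x : Cfg n) : 0 < gibbs f x :=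
  div_pos (Real.exp_pos _) (sum_exp_pos f)

theorem sum_gibbs (f : Cfg n → ℝ) : ∑ x, gibbs f x = 1 := by
  simp only [gibbs, ← Finset.sum_div]
  exact div_self (sum_exp_pos f).ne'

theorem gibbs_add_const (f : Cfg n → ℝ) (a : ℝ) : gibbs (fun x => f x + a) = gibbs f := by
  funext x
  simp only [gibbs, Real.exp_add, ← Finset.sum_mul]
  exact mul_div_mul_right _ _ (Real.exp_pos a).ne'

/-- The two-point computation behind the conditional mean: with weights proportional to `exp (±D)`,
a sign has mean `tanh D`. -/
theorem exp_mul_sub_tanh (s D m : ℝ) (hs : s * s = 1) :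
    Real.exp (m + s * D) * (s - Real.tanh D) + Real.exp (m - s * D) * (-s - Real.tanh D) = 0 := by
  have hs' : s = 1 ∨ s = -1 := by
    rcases mul_self_eq_one_iff.1 hs with h | h <;> simp [h]
  have hc := (add_pos (Real.exp_pos D) (Real.exp_pos (-D))).ne'
  rw [sub_eq_add_neg m, Real.exp_add, Real.exp_add, Real.tanh_eq]
  rcases hs' with rfl | rfl
  · simp only [one_mul]; field_simp; ring
  · simp only [neg_mul, one_mul, neg_neg]; field_simp; ring

/-- The conditional mean of the spin at `i` under a Gibbs measure. -/
theorem sum_gibbs_spin_sub_tanh (f : Cfg n → ℝ) (i : Fin n) (h : Cfg n → ℝ)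
    (hh : ∀ x, h (flipAt i x) = h x) :
    ∑ x, gibbs f x * ((spin (x i) - Real.tanh (siteDeriv i f x)) * h x) = 0 := by
  apply sum_eq_zero_of_add_flipAt i
  intro x
  rw [siteDeriv_flipAt, spin_flipAt_same, hh]
  have e1 : f x = (f x + f (flipAt i x)) / 2 + spin (x i) * siteDeriv i f x := by
    linarith [sub_flipAt_eq i f x]
  have e2 : f (flipAt i x) = (f x + f (flipAt i x)) / 2 - spin (x i) * siteDeriv i f x := by
    linarith [sub_flipAt_eq i f x]
  have key := exp_mul_sub_tanh (spin (x i)) (siteDeriv i f x) ((f x + f (flipAt i x)) / 2)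
    (spin_mul_self _)
  rw [← e1, ← e2] at key
  rw [gibbs, gibbs]
  linear_combination (h x / ∑ z, Real.exp (f z)) * key

/-- The variance of `g` under the probability vector `P`. -/
noncomputable def varianceOf (P g : Cfg n → ℝ) : ℝ :=
  ∑ x, P x * g x ^ 2 - (∑ x, P x * g x) ^ 2

theorem sum_mul_sq_sub (P g : Cfg n → ℝ) (a : ℝ) :
    ∑ x, P x * (g x - a) ^ 2
      = ∑ x, P x * g x ^ 2 - 2 * a * (∑ x, P x * g x) + a ^ 2 * ∑ x, P x := by
  rw [Finset.mul_sum, Finset.mul_sum, ← Finset.sum_sub_distrib, ← Finset.sum_add_distrib]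
  exact Finset.sum_congr rfl fun x _ => by ring

theorem varianceOf_le_sum_sq_sub (P g : Cfg n → ℝ) (hP1 : ∑ x, P x = 1) (a : ℝ) :
    varianceOf P g ≤ ∑ x, P x * (g x - a) ^ 2 := by
  rw [sum_mul_sq_sub, hP1, varianceOf]
  nlinarith [sq_nonneg (∑ x, P x * g x - a)]

theorem sum_mul_le_of_le (P g : Cfg n → ℝ) (hP : ∀ x, 0 ≤ P x) (hP1 : ∑ x, P x = 1) (a : ℝ)
    (h : ∀ x, g x ≤ a) : ∑ x, P x * g x ≤ a := by
  calc ∑ x, P x * g x ≤ ∑ x, P x * a :=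
        Finset.sum_le_sum fun x _ => mul_le_mul_of_nonneg_left (h x) (hP x)
    _ = a := by rw [← Finset.sum_mul, hP1, one_mul]

theorem varianceOf_le_sq_of_abs_le (P g : Cfg n → ℝ) (hP : ∀ x, 0 ≤ P x) (hP1 : ∑ x, P x = 1)
    (a : ℝ) (h : ∀ x, |g x| ≤ a) : varianceOf P g ≤ a ^ 2 := by
  refine (varianceOf_le_sum_sq_sub P g hP1 0).trans (sum_mul_le_of_le P _ hP hP1 _ fun x => ?_)
  rw [sub_zero, ← sq_abs]
  exact pow_le_pow_left₀ (abs_nonneg _) (h x) 2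

/-! ### Variance under weak dependence -/

/-- The conditional expectation of `g` given all spins but the one at `i`, under `gibbs f`. -/
noncomputable def heatBath (f : Cfg n → ℝ) (i : Fin n) (g : Cfg n → ℝ) (x : Cfg n) : ℝ :=
  (g x + g (flipAt i x)) / 2 + Real.tanh (siteDeriv i f x) * siteDeriv i g x

theorem heatBath_flipAt (f : Cfg n → ℝ) (i : Fin n) (g : Cfg n → ℝ) (x : Cfg n) :
    heatBath f i g (flipAt i x) = heatBath f i g x := by
  simp only [heatBath, siteDeriv_flipAt, flipAt_flipAt]; ring

theorem eq_half_add_spin_mul (i : Fin n) (g : Cfg n → ℝ) (x : Cfg n) :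
    g x = (g x + g (flipAt i x)) / 2 + spin (x i) * siteDeriv i g x := by
  linarith [sub_flipAt_eq i g x]

/-- The law of total variance for conditioning on all spins but one. The conditional variance is `(1
- τ²) D²`, where `D` is half the signed oscillation at `i`, hence at most `d² / 4`; the cross terms
vanish by `sum_gibbs_spin_sub_tanh`. -/
theorem varianceOf_le_heatBath (f : Cfg n → ℝ) (i : Fin n) (g : Cfg n → ℝ) (d : ℝ)
    (hd : ∀ x, |g x - g (flipAt i x)| ≤ d) :
    varianceOf (gibbs f) g ≤ d ^ 2 / 4 + varianceOf (gibbs f) (heatBath f i g) := by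
  set τ : Cfg n → ℝ := fun x => Real.tanh (siteDeriv i f x) with hτ
  set A : Cfg n → ℝ := fun x => (g x + g (flipAt i x)) / 2 with hA
  set D : Cfg n → ℝ := fun x => siteDeriv i g x with hD
  have h1 := sum_gibbs_spin_sub_tanh f i D (fun x => by simp [hD])
  have h2 := sum_gibbs_spin_sub_tanh f i (fun x => A x * D x) (fun x => by
    simp only [hD, hA, siteDeriv_flipAt, flipAt_flipAt]; ring)
  have hg : ∀ x, g x = A x + spin (x i) * D x := fun x => eq_half_add_spin_mul i g x
  have hb : ∀ x, heatBath f i g x = A x + τ x * D x := fun x => rfl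
  have m : ∑ x, gibbs f x * g x = ∑ x, gibbs f x * heatBath f i g x := by
    rw [← sub_eq_zero, ← Finset.sum_sub_distrib, ← h1]
    refine Finset.sum_congr rfl fun x _ => ?_
    rw [hb, hg x]; simp only [hτ]; ring
  have v : ∑ x, gibbs f x * g x ^ 2
      = ∑ x, gibbs f x * heatBath f i g x ^ 2
        + ∑ x, gibbs f x * ((1 - τ x ^ 2) * D x ^ 2)
        + 2 * ∑ x, gibbs f x * ((spin (x i) - Real.tanh (siteDeriv i f x)) * (A x * D x)) := by
    rw [Finset.mul_sum, ← Finset.sum_add_distrib, ← Finset.sum_add_distrib]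
    refine Finset.sum_congr rfl fun x _ => ?_
    rw [hb, hg x]
    have hs := spin_mul_self (x i)
    simp only [hτ]
    linear_combination (gibbs f x * D x ^ 2) * hs
  have hle : ∑ x, gibbs f x * ((1 - τ x ^ 2) * D x ^ 2) ≤ d ^ 2 / 4 := by
    refine sum_mul_le_of_le _ _ (fun x => (gibbs_pos f x).le) (sum_gibbs f) _ fun x => ?_
    have hDx : |D x| ≤ d / 2 := by
      simp only [hD, abs_siteDeriv]; linarith [hd x]
    have hD2 : D x ^ 2 ≤ (d / 2) ^ 2 := by
      rw [← sq_abs (D x)]; exact pow_le_pow_left₀ (abs_nonneg _) hDx 2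
    nlinarith [sq_nonneg (D x), sq_nonneg (τ x), mul_nonneg (sq_nonneg (τ x)) (sq_nonneg (D x))]
  rw [varianceOf, varianceOf, m, v, h2]
  linarith

/-- The conditional expectation is a convex combination of `g` at `x` and at `flipAt i x`. A flip at
`j` moves each of the two values by at most `dj`, and moving the weights costs at most `2c` times
half the oscillation at `i`. -/
theorem abs_heatBath_sub_le (f : Cfg n → ℝ) (i j : Fin n) (hij : i ≠ j) (g : Cfg n → ℝ)
    (di dj c : ℝ) (hdi : ∀ x, |g x - g (flipAt i x)| ≤ di)
    (hdj : ∀ x, |g x - g (flipAt j x)| ≤ dj)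
    (hc : ∀ x, |siteDeriv i f x - siteDeriv i f (flipAt j x)| ≤ 2 * c) (x : Cfg n) :
    |heatBath f i g x - heatBath f i g (flipAt j x)| ≤ dj + c * di := by
  set τ := Real.tanh (siteDeriv i f x)
  set τ' := Real.tanh (siteDeriv i f (flipAt j x))
  have hτ : |τ| ≤ 1 := abs_tanh_le_one _
  have hττ' : |τ - τ'| ≤ 2 * c := (abs_tanh_sub_tanh_le _ _).trans (hc x)
  set y := flipAt j x with hy
  have hsp : spin (y i) = spin (x i) := by rw [hy, flipAt_ne hij]
  have h1 := hdj x
  have h2 := hdj (flipAt i x)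
  rw [flipAt_comm, ← hy] at h2
  have h3 : |siteDeriv i g y| ≤ di / 2 := by rw [abs_siteDeriv]; linarith [hdi y]
  have e : heatBath f i g x - heatBath f i g y
      = ((1 + τ * spin (x i)) / 2 * (g x - g y)
        + (1 - τ * spin (x i)) / 2 * (g (flipAt i x) - g (flipAt i y)))
        + (τ - τ') * siteDeriv i g y := by
    have e1 : siteDeriv i g x = spin (x i) * (g x - g (flipAt i x)) / 2 := rfl
    have e2 : siteDeriv i g y = spin (x i) * (g y - g (flipAt i y)) / 2 := by
      rw [siteDeriv, hsp]
    have e3 : heatBath f i g x = (g x + g (flipAt i x)) / 2 + τ * siteDeriv i g x := rfl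
    have e4 : heatBath f i g y = (g y + g (flipAt i y)) / 2 + τ' * siteDeriv i g y := rfl
    rw [e3, e4, e1, e2]
    ring
  have hts : |τ * spin (x i)| ≤ 1 := by rw [abs_mul, abs_spin, mul_one]; exact hτ
  obtain ⟨hl, hr⟩ := abs_le.1 hts
  rw [e]
  have t1 : |(1 + τ * spin (x i)) / 2 * (g x - g y)| ≤ (1 + τ * spin (x i)) / 2 * dj := by
    rw [abs_mul, abs_of_nonneg (by linarith)]
    exact mul_le_mul_of_nonneg_left h1 (by linarith)
  have t2 : |(1 - τ * spin (x i)) / 2 * (g (flipAt i x) - g (flipAt i y))|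
      ≤ (1 - τ * spin (x i)) / 2 * dj := by
    rw [abs_mul, abs_of_nonneg (by linarith)]
    exact mul_le_mul_of_nonneg_left h2 (by linarith)
  have t3 : |(τ - τ') * siteDeriv i g y| ≤ c * di := by
    rw [abs_mul]
    calc |τ - τ'| * |siteDeriv i g y| ≤ 2 * c * (di / 2) :=
          mul_le_mul hττ' h3 (abs_nonneg _) ((abs_nonneg _).trans hττ')
      _ = c * di := by ring
  calc _ ≤ |(1 + τ * spin (x i)) / 2 * (g x - g y)
        + (1 - τ * spin (x i)) / 2 * (g (flipAt i x) - g (flipAt i y))|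
        + |(τ - τ') * siteDeriv i g y| := abs_add_le _ _
    _ ≤ (|(1 + τ * spin (x i)) / 2 * (g x - g y)|
        + |(1 - τ * spin (x i)) / 2 * (g (flipAt i x) - g (flipAt i y))|) + c * di := by
        gcongr; exact abs_add_le _ _
    _ ≤ _ := by linarith

/-- Averaging over the updated site shrinks the squared oscillations. The vanishing diagonal removes
`1` from the factor `n`; the cross terms give back `1/4 + 1/4` by the arithmetic-geometric mean
inequality and symmetry, and the squares `1/16`. This leaves a gain of `7/16`, of which `3/8` is
kept. -/
theorem sum_sq_influence_le (Cm : Fin n → Fin n → ℝ) (hC0 : ∀ i j, 0 ≤ Cm i j)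
    (hsymm : ∀ i j, Cm i j = Cm j i) (hrow : ∀ i, ∑ j, Cm i j ≤ 1 / 4) (d : Fin n → ℝ) :
    ∑ i, ∑ j, (if j = i then 0 else d j + Cm i j * d i) ^ 2
      ≤ ((n : ℝ) - 3 / 8) * ∑ i, d i ^ 2 := by
  have hterm : ∀ i j, (if j = i then 0 else d j + Cm i j * d i) ^ 2
      ≤ (d j ^ 2 - if j = i then d i ^ 2 else 0) + Cm i j * d i ^ 2 + Cm i j * d j ^ 2
        + Cm i j * (1 / 4) * d i ^ 2 := by
    intro i j
    have hc := hC0 i j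
    have hc4 : Cm i j ≤ 1 / 4 :=
      (Finset.single_le_sum (fun j _ => hC0 i j) (Finset.mem_univ j)).trans (hrow i)
    split_ifs with h
    · subst h
      nlinarith [mul_nonneg hc (sq_nonneg (d j))]
    · have h1 : Cm i j ^ 2 * d i ^ 2 ≤ Cm i j * (1 / 4) * d i ^ 2 := by
        apply mul_le_mul_of_nonneg_right _ (sq_nonneg _)
        nlinarith
      nlinarith [mul_nonneg hc (sq_nonneg (d i - d j))]
  calc _ ≤ ∑ i, ∑ j, ((d j ^ 2 - if j = i then d i ^ 2 else 0) + Cm i j * d i ^ 2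
        + Cm i j * d j ^ 2 + Cm i j * (1 / 4) * d i ^ 2) :=
        Finset.sum_le_sum fun i _ => Finset.sum_le_sum fun j _ => hterm i j
    _ = (n : ℝ) * ∑ i, d i ^ 2 - ∑ i, d i ^ 2 + ∑ i, (∑ j, Cm i j) * d i ^ 2
        + ∑ i, ∑ j, Cm i j * d j ^ 2 + ∑ i, (∑ j, Cm i j) * (1 / 4) * d i ^ 2 := by
        simp only [Finset.sum_add_distrib, Finset.sum_sub_distrib, Finset.sum_ite_eq',
          Finset.mem_univ, if_true, Finset.sum_const, Finset.card_univ, Fintype.card_fin,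
          nsmul_eq_mul, Finset.sum_mul]
    _ = (n : ℝ) * ∑ i, d i ^ 2 - ∑ i, d i ^ 2 + ∑ i, (∑ j, Cm i j) * d i ^ 2
        + ∑ i, (∑ j, Cm i j) * d i ^ 2 + ∑ i, (∑ j, Cm i j) * (1 / 4) * d i ^ 2 := by
        congr 2
        rw [Finset.sum_comm]
        refine Finset.sum_congr rfl fun i _ => ?_
        rw [Finset.sum_mul]
        exact Finset.sum_congr rfl fun j _ => by rw [hsymm]
    _ ≤ (n : ℝ) * ∑ i, d i ^ 2 - ∑ i, d i ^ 2 + ∑ i, (1 / 4) * d i ^ 2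
        + ∑ i, (1 / 4) * d i ^ 2 + ∑ i, (1 / 4) * (1 / 4) * d i ^ 2 := by
        gcongr with i _ i _ i _ <;> exact hrow i
    _ ≤ _ := by
        simp only [← Finset.mul_sum]
        nlinarith [Finset.sum_nonneg fun i (_ : i ∈ Finset.univ) => sq_nonneg (d i)]

/-- A Poincaré-type inequality for Gibbs measures with weak dependence (in the sense of
Dobrushin), in terms of the one-spin oscillations of the function. -/
theorem varianceOf_gibbs_le_of_weak_dependence (f : Cfg n → ℝ) (Cm : Fin n → Fin n → ℝ)
    (hC0 : ∀ i j, 0 ≤ Cm i j) (hsymm : ∀ i j, Cm i j = Cm j i) (hrow : ∀ i, ∑ j, Cm i j ≤ 1 / 4)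
    (hinf : ∀ i j, i ≠ j → ∀ x, |siteDeriv i f x - siteDeriv i f (flipAt j x)| ≤ 2 * Cm i j)
    (g : Cfg n → ℝ) (d : Fin n → ℝ) (hd : ∀ i x, |g x - g (flipAt i x)| ≤ d i) :
    varianceOf (gibbs f) g ≤ ∑ i, d i ^ 2 := by
  rcases Nat.eq_zero_or_pos n with rfl | hn
  · have : varianceOf (gibbs f) g = 0 := by
      have h1 := sum_gibbs f
      rw [Fintype.sum_unique] at h1
      simp only [varianceOf, Fintype.sum_unique, h1]; ring
    simp [this]
  have hnR : (1 : ℝ) ≤ n := by exact_mod_cast hn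
  set ρ : ℝ := 1 - 3 / (8 * n) with hρ
  have hρ0 : 0 ≤ ρ := by
    rw [hρ, sub_nonneg, div_le_one (by positivity)]; linarith
  have hρ1 : ρ < 1 := by
    rw [hρ]; have : 0 < 3 / (8 * (n : ℝ)) := by positivity
    linarith
  -- A crude bound with the factor `1 + n` is bootstrapped: a heat bath update, averaged over the
  -- sites, replaces `1 + n ρ^t` by `1 + n ρ^(t+1)`. As `n ρ = n - 3/8`, the slack `n - n ρ` covers
  -- the conditional variance `d²/4` lost in the update. The limit `t → ∞` gives the factor `1`.
  have step : ∀ t : ℕ, ∀ (g : Cfg n → ℝ) (d : Fin n → ℝ),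
      (∀ i x, |g x - g (flipAt i x)| ≤ d i) →
      varianceOf (gibbs f) g ≤ (1 + n * ρ ^ t) * ∑ i, d i ^ 2 := by
    intro t
    induction t with
    | zero =>
      intro g d hd
      have hd0 : ∀ i, 0 ≤ d i := fun i => (abs_nonneg _).trans (hd i (fun _ => true))
      have hS : 0 ≤ ∑ i, d i ^ 2 := Finset.sum_nonneg fun i _ => sq_nonneg _
      have h1 : varianceOf (gibbs f) g ≤ (∑ i, d i) ^ 2 := by
        refine (varianceOf_le_sum_sq_sub _ g (sum_gibbs f) (g fun _ => true)).trans ?_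
        refine sum_mul_le_of_le _ _ (fun x => (gibbs_pos f x).le) (sum_gibbs f) _ fun x => ?_
        rw [← sq_abs]
        exact pow_le_pow_left₀ (abs_nonneg _) (abs_sub_le_sum_of_flipAt g d hd _ Finset.univ x (by simp)) 2
      have h2 : (∑ i, d i) ^ 2 ≤ n * ∑ i, d i ^ 2 := by
        simpa using sq_sum_le_card_mul_sum_sq (s := Finset.univ) (f := d)
      rw [pow_zero, mul_one]
      nlinarith
    | succ t ih =>
      intro g d hd
      have hS : 0 ≤ ∑ i, d i ^ 2 := Finset.sum_nonneg fun i _ => sq_nonneg _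
      have hA : 0 ≤ 1 + n * ρ ^ t := by positivity
      have h1 : ∀ i, varianceOf (gibbs f) g ≤ d i ^ 2 / 4
          + (1 + n * ρ ^ t) * ∑ j, (if j = i then 0 else d j + Cm i j * d i) ^ 2 := by
        intro i
        refine (varianceOf_le_heatBath f i g (d i) (hd i)).trans ?_
        refine add_le_add le_rfl (ih _ _ fun j x => ?_)
        split_ifs with h
        · subst h; rw [heatBath_flipAt]; simp
        · exact abs_heatBath_sub_le f i j (Ne.symm h) g _ _ _ (hd i) (hd j)
            (hinf i j (Ne.symm h)) x
      have h2 := Finset.sum_le_sum fun i (_ : i ∈ Finset.univ) => h1 i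
      rw [Finset.sum_const, Finset.card_univ, Fintype.card_fin, nsmul_eq_mul,
        Finset.sum_add_distrib, ← Finset.sum_div, ← Finset.mul_sum] at h2
      have h3 := mul_le_mul_of_nonneg_left (sum_sq_influence_le Cm hC0 hsymm hrow d) hA
      have h4 : (n : ℝ) * varianceOf (gibbs f) g
          ≤ n * ((1 + n * ρ ^ (t + 1)) * ∑ i, d i ^ 2) := by
        have e : (n : ℝ) - 3 / 8 = n * ρ := by rw [hρ]; field_simp
        rw [e] at h3
        have e2 : (n : ℝ) * ρ = n - 3 / 8 := e.symm
        have : (n : ℝ) * ((1 + n * ρ ^ (t + 1)) * ∑ i, d i ^ 2)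
            = (1 + n * ρ ^ t) * (n * ρ * ∑ i, d i ^ 2)
              + (n - n * ρ) * ∑ i, d i ^ 2 := by rw [pow_succ]; ring
        rw [this, e2]
        rw [e2] at h3
        nlinarith
      exact le_of_mul_le_mul_left h4 (by linarith)
  have hlim : Filter.Tendsto (fun t : ℕ => (1 + n * ρ ^ t) * ∑ i, d i ^ 2) Filter.atTop
      (nhds ((1 + n * 0) * ∑ i, d i ^ 2)) :=
    (((tendsto_pow_atTop_nhds_zero_of_lt_one hρ0 hρ1).const_mul _).const_add _).mul_const _
  have := ge_of_tendsto' hlim fun t => step t g d hd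
  simpa using this

/-! ### Comparison of Gibbs measures -/

theorem sum_mul_sub_le_sqrt_variance (P g h : Cfg n → ℝ) (hP : ∀ x, 0 ≤ P x)
    (hP1 : ∑ x, P x = 1) (hh : ∀ x, |h x| ≤ 1) (V : ℝ) (hV : 0 ≤ V)
    (hg : varianceOf P g ≤ V ^ 2) :
    |∑ x, P x * (h x * (g x - ∑ z, P z * g z))| ≤ V := by
  set m := ∑ z, P z * g z with hm
  have e : ∑ x, P x * (g x - m) ^ 2 = varianceOf P g := by
    rw [sum_mul_sq_sub, hP1, varianceOf, ← hm]; ring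
  have h1 : (∑ x, P x * |g x - m|) ^ 2 ≤ V ^ 2 := by
    have := Finset.sum_mul_sq_le_sq_mul_sq Finset.univ (fun x => Real.sqrt (P x))
      (fun x => Real.sqrt (P x) * |g x - m|)
    have e1 : ∀ x, Real.sqrt (P x) * (Real.sqrt (P x) * |g x - m|) = P x * |g x - m| := by
      intro x; rw [← mul_assoc, Real.mul_self_sqrt (hP x)]
    have e2 : ∀ x, (Real.sqrt (P x) * |g x - m|) ^ 2 = P x * (g x - m) ^ 2 := by
      intro x; rw [mul_pow, Real.sq_sqrt (hP x), sq_abs]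
    simp only [e1, e2, Real.sq_sqrt (hP _), hP1, one_mul, e] at this
    exact this.trans hg
  have h2 := abs_le_of_sq_le_sq h1 hV
  calc _ ≤ ∑ x, |P x * (h x * (g x - m))| := Finset.abs_sum_le_sum_abs _ _
    _ ≤ ∑ x, P x * |g x - m| := by
        refine Finset.sum_le_sum fun x _ => ?_
        rw [abs_mul, abs_mul, abs_of_nonneg (hP x)]
        refine mul_le_mul_of_nonneg_left ?_ (hP x)
        nlinarith [hh x, abs_nonneg (g x - m)]
    _ ≤ V := (le_abs_self _).trans h2

theorem hasDerivAt_gibbs (f g : Cfg n → ℝ) (x : Cfg n) (t : ℝ) :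
    HasDerivAt (fun t => gibbs (fun y => f y + t * g y) x)
      (gibbs (fun y => f y + t * g y) x
        * (g x - ∑ z, gibbs (fun y => f y + t * g y) z * g z)) t := by
  have h1 : ∀ z, HasDerivAt (fun t => Real.exp (f z + t * g z))
      (Real.exp (f z + t * g z) * g z) t := by
    intro z
    have : HasDerivAt (fun t => f z + t * g z) (g z) t := by
      simpa using ((hasDerivAt_id t).mul_const (g z)).const_add (f z)
    exact this.exp
  have h2 : HasDerivAt (fun t => ∑ z, Real.exp (f z + t * g z))
      (∑ z, Real.exp (f z + t * g z) * g z) t := HasDerivAt.fun_sum fun z _ => h1 z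
  have hpos := sum_exp_pos fun z => f z + t * g z
  have h3 := (h1 x).div h2 hpos.ne'
  have hm : ∑ z, gibbs (fun y => f y + t * g y) z * g z
      = (∑ z, Real.exp (f z + t * g z) * g z) / ∑ z, Real.exp (f z + t * g z) := by
    rw [Finset.sum_div]
    exact Finset.sum_congr rfl fun z _ => by rw [gibbs]; ring
  refine HasDerivAt.congr_deriv (f := fun t => gibbs (fun y => f y + t * g y) x) h3 ?_
  rw [hm, gibbs]
  have := hpos.ne'
  field_simp

/-- If the variance of `g` stays below `V²` along the path `exp (f + t g)`, then its endpoints are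
at most `V` apart. -/
theorem sum_abs_gibbs_sub_le (f g : Cfg n → ℝ) (V : ℝ) (hV : 0 ≤ V)
    (h : ∀ t ∈ Set.Icc (0 : ℝ) 1, varianceOf (gibbs fun y => f y + t * g y) g ≤ V ^ 2) :
    ∑ x, |gibbs (fun y => f y + g y) x - gibbs f x| ≤ V := by
  -- Testing against the sign pattern of the final difference makes the `L_1` distance an increment
  -- of the single differentiable function `F`.
  set s : Cfg n → ℝ := fun x =>
    if 0 ≤ gibbs (fun y => f y + g y) x - gibbs f x then 1 else -1 with hs
  have hs1 : ∀ x, |s x| ≤ 1 := by intro x; simp only [hs]; split_ifs <;> simp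
  set F : ℝ → ℝ := fun t => ∑ x, s x * gibbs (fun y => f y + t * g y) x with hF
  have hder : ∀ t, HasDerivAt F (∑ x, s x * (gibbs (fun y => f y + t * g y) x
        * (g x - ∑ z, gibbs (fun y => f y + t * g y) z * g z))) t := fun t =>
    HasDerivAt.fun_sum fun x _ => (hasDerivAt_gibbs f g x t).const_mul (s x)
  have key := Convex.norm_image_sub_le_of_norm_hasDerivWithin_le (f := F) (s := Set.Icc 0 1)
    (C := V) (x := 0) (y := 1) (fun t _ => (hder t).hasDerivWithinAt)
    (fun t ht => by
      have := sum_mul_sub_le_sqrt_variance (gibbs fun y => f y + t * g y) g s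
        (fun x => (gibbs_pos _ x).le) (sum_gibbs _) hs1 V hV (h t ht)
      rw [Real.norm_eq_abs]
      convert this using 3
      ring)
    (convex_Icc 0 1) (by simp) (by simp)
  have e : ∑ x, |gibbs (fun y => f y + g y) x - gibbs f x| = F 1 - F 0 := by
    simp only [hF, one_mul, zero_mul, add_zero, ← Finset.sum_sub_distrib]
    refine Finset.sum_congr rfl fun x _ => ?_
    simp only [hs]
    split_ifs with h0
    · rw [abs_of_nonneg h0]; ring
    · rw [abs_of_neg (not_le.1 h0)]; ring
  rw [e]
  simpa using (le_abs_self _).trans key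

end flips

/-! ### Concentration of independent samples from a finite set -/

section concentration

variable {α : Type*}

/-- The probability of a sequence of independent samples. -/
noncomputable def sampleWeight (P : α → ℝ) {k : ℕ} (s : Fin k → α) : ℝ := ∏ i, P (s i)

theorem sampleWeight_nonneg {P : α → ℝ} (hP : ∀ x, 0 ≤ P x) {k : ℕ} (s : Fin k → α) :
    0 ≤ sampleWeight P s := Finset.prod_nonneg fun _ _ => hP _

theorem sampleWeight_cons (P : α → ℝ) {k : ℕ} (x : α) (s : Fin k → α) :
    sampleWeight P (Fin.cons x s : Fin (k + 1) → α) = P x * sampleWeight P s := by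
  simp [sampleWeight, Fin.prod_univ_succ]

variable [Fintype α]

theorem sum_fin_cons {E : Type*} [AddCommMonoid E] {k : ℕ} (F : (Fin (k + 1) → α) → E) :
    ∑ s, F s = ∑ s : Fin k → α, ∑ x, F (Fin.cons x s) := by
  rw [Finset.sum_comm, ← Fintype.sum_prod_type']
  exact ((Fin.consEquiv fun _ : Fin (k + 1) => α).sum_comp F).symm

theorem sum_sampleWeight (P : α → ℝ) (hP1 : ∑ x, P x = 1) (k : ℕ) :
    ∑ s : Fin k → α, sampleWeight P s = 1 := by
  induction k with
  | zero => simp [sampleWeight]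
  | succ k ih =>
    rw [sum_fin_cons]
    simp only [sampleWeight_cons, ← Finset.sum_mul, hP1, one_mul, ih]

/-- Hoeffding's lemma by symmetrisation: Jensen's inequality allows multiplying by the moment of an
independent copy, after which only `cosh (f x - f y) ≤ exp (c² / 2)` is needed. The constant is not
the optimal `1/8`. -/
theorem sum_mul_exp_le (P : α → ℝ) (hP : ∀ x, 0 ≤ P x) (hP1 : ∑ x, P x = 1) (f : α → ℝ) (c : ℝ)
    (hf : ∀ x y, |f x - f y| ≤ c) :
    ∑ x, P x * Real.exp (f x) ≤ Real.exp (∑ x, P x * f x + c ^ 2 / 2) := by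
  set m := ∑ x, P x * f x with hm
  have h1 : 1 ≤ ∑ y, P y * Real.exp (m - f y) := by
    calc (1 : ℝ) = ∑ y, P y * (m - f y + 1) := by
          simp only [mul_add, mul_sub, Finset.sum_add_distrib, Finset.sum_sub_distrib,
            ← Finset.sum_mul, hP1, mul_one, ← hm]
          ring
      _ ≤ _ := Finset.sum_le_sum fun y _ =>
          mul_le_mul_of_nonneg_left (Real.add_one_le_exp _) (hP y)
  have h2 : (∑ x, P x * Real.exp (f x)) * ∑ y, P y * Real.exp (m - f y)
      = Real.exp m * ∑ x, ∑ y, P x * P y * Real.cosh (f x - f y) := by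
    have e : (∑ x, P x * Real.exp (f x)) * ∑ y, P y * Real.exp (m - f y)
        = Real.exp m * ∑ x, ∑ y, P x * P y * Real.exp (f x - f y) := by
      rw [Finset.sum_mul_sum, Finset.mul_sum]
      refine Finset.sum_congr rfl fun x _ => ?_
      rw [Finset.mul_sum]
      refine Finset.sum_congr rfl fun y _ => ?_
      rw [Real.exp_sub, Real.exp_sub]
      field_simp
    have e' : ∑ x, ∑ y, P x * P y * Real.exp (f x - f y)
        = ∑ x, ∑ y, P x * P y * Real.exp (-(f x - f y)) := by
      rw [Finset.sum_comm]
      refine Finset.sum_congr rfl fun x _ => Finset.sum_congr rfl fun y _ => ?_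
      rw [neg_sub, mul_comm (P x)]
    rw [e]
    congr 1
    simp only [Real.cosh_eq, mul_div_assoc', mul_add, ← Finset.sum_div, Finset.sum_add_distrib]
    rw [← e']; ring
  have h3 : ∑ x, ∑ y, P x * P y * Real.cosh (f x - f y) ≤ Real.exp (c ^ 2 / 2) := by
    calc _ ≤ ∑ x, ∑ y, P x * P y * Real.exp (c ^ 2 / 2) := by
          refine Finset.sum_le_sum fun x _ => Finset.sum_le_sum fun y _ => ?_
          refine mul_le_mul_of_nonneg_left ?_ (mul_nonneg (hP x) (hP y))
          refine (Real.cosh_le_exp_half_sq _).trans (Real.exp_le_exp.2 ?_)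
          rw [← sq_abs]
          have := pow_le_pow_left₀ (abs_nonneg _) (hf x y) 2
          linarith
      _ = _ := by
          simp only [← Finset.sum_mul, ← Finset.mul_sum, hP1, mul_one, one_mul]
  have h0 : 0 ≤ ∑ x, P x * Real.exp (f x) :=
    Finset.sum_nonneg fun x _ => mul_nonneg (hP x) (Real.exp_pos _).le
  calc ∑ x, P x * Real.exp (f x)
      ≤ (∑ x, P x * Real.exp (f x)) * ∑ y, P y * Real.exp (m - f y) :=
        le_mul_of_one_le_right h0 h1
    _ = Real.exp m * ∑ x, ∑ y, P x * P y * Real.cosh (f x - f y) := h2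
    _ ≤ Real.exp m * Real.exp (c ^ 2 / 2) := by gcongr
    _ = _ := by rw [Real.exp_add]

/-- The exponential-moment form of the bounded differences inequality. -/
theorem sum_sampleWeight_mul_exp_le (P : α → ℝ) (hP : ∀ x, 0 ≤ P x) (hP1 : ∑ x, P x = 1) (c : ℝ)
    (k : ℕ) : ∀ f : (Fin k → α) → ℝ, (∀ s i a, |f s - f (Function.update s i a)| ≤ c) →
    ∑ s, sampleWeight P s * Real.exp (f s)
      ≤ Real.exp (∑ s, sampleWeight P s * f s + k * (c ^ 2 / 2)) := by
  induction k with
  | zero => intro f _; simp [sampleWeight]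
  | succ k ih =>
    intro f hf
    -- Averaging over the first sample preserves bounded differences, so the induction hypothesis
    -- applies to the average, and the one-variable bound to the first sample.
    set g : (Fin k → α) → ℝ := fun s => ∑ x, P x * f (Fin.cons x s) with hg
    have hgd : ∀ s i a, |g s - g (Function.update s i a)| ≤ c := by
      intro s i a
      simp only [hg, ← Finset.sum_sub_distrib, ← mul_sub]
      calc _ ≤ ∑ x, |P x * (f (Fin.cons x s) - f (Fin.cons x (Function.update s i a)))| :=
            Finset.abs_sum_le_sum_abs _ _
        _ ≤ ∑ x, P x * c := by
            refine Finset.sum_le_sum fun x _ => ?_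
            rw [abs_mul, abs_of_nonneg (hP x), Fin.cons_update]
            exact mul_le_mul_of_nonneg_left (hf _ _ _) (hP x)
        _ = c := by rw [← Finset.sum_mul, hP1, one_mul]
    have h1 : ∀ s : Fin k → α, ∑ x, P x * Real.exp (f (Fin.cons x s))
        ≤ Real.exp (g s + c ^ 2 / 2) := by
      intro s
      refine sum_mul_exp_le P hP hP1 _ c fun x y => ?_
      have := hf (Fin.cons x s) 0 y
      rwa [Fin.update_cons_zero] at this
    have hmean : ∑ s, sampleWeight P s * f s = ∑ s, sampleWeight P s * g s := by
      rw [sum_fin_cons]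
      refine Finset.sum_congr rfl fun s _ => ?_
      simp only [hg, sampleWeight_cons, Finset.mul_sum]
      exact Finset.sum_congr rfl fun x _ => by ring
    calc ∑ s, sampleWeight P s * Real.exp (f s)
        = ∑ s : Fin k → α, sampleWeight P s * ∑ x, P x * Real.exp (f (Fin.cons x s)) := by
          rw [sum_fin_cons]
          refine Finset.sum_congr rfl fun s _ => ?_
          simp only [sampleWeight_cons, Finset.mul_sum]
          exact Finset.sum_congr rfl fun x _ => by ring
      _ ≤ ∑ s : Fin k → α, sampleWeight P s * Real.exp (g s + c ^ 2 / 2) :=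
          Finset.sum_le_sum fun s _ =>
            mul_le_mul_of_nonneg_left (h1 s) (sampleWeight_nonneg hP s)
      _ = (∑ s : Fin k → α, sampleWeight P s * Real.exp (g s)) * Real.exp (c ^ 2 / 2) := by
          rw [Finset.sum_mul]
          exact Finset.sum_congr rfl fun s _ => by rw [Real.exp_add]; ring
      _ ≤ Real.exp (∑ s, sampleWeight P s * g s + k * (c ^ 2 / 2)) * Real.exp (c ^ 2 / 2) := by
          gcongr; exact ih g hgd
      _ = _ := by rw [← Real.exp_add, hmean]; push_cast; ring_nf

variable {V : Type*} [NormedAddCommGroup V] [InnerProductSpace ℝ V]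

/-- Independent centred vectors are orthogonal on average, so the squared norms add up. The shift
`a` carries the partial sums through the induction. -/
theorem sum_sampleWeight_mul_norm_sq_le (P : α → ℝ) (hP : ∀ x, 0 ≤ P x) (hP1 : ∑ x, P x = 1)
    (X : α → V) (b : ℝ) (hX : ∀ x, ‖X x‖ ≤ b) (hm : ∑ x, P x • X x = 0) (k : ℕ) :
    ∀ a : V, ∑ s : Fin k → α, sampleWeight P s * ‖a + ∑ i, X (s i)‖ ^ 2
      ≤ ‖a‖ ^ 2 + k * b ^ 2 := by
  induction k with
  | zero => intro a; simp [sampleWeight]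
  | succ k ih =>
    intro a
    have h1 : ∀ v : V, ∑ x, P x * ‖v + X x‖ ^ 2 ≤ ‖v‖ ^ 2 + b ^ 2 := by
      intro v
      have e : ∑ x, P x * ‖v + X x‖ ^ 2
          = ‖v‖ ^ 2 * ∑ x, P x + 2 * inner ℝ v (∑ x, P x • X x)
            + ∑ x, P x * ‖X x‖ ^ 2 := by
        rw [inner_sum, Finset.mul_sum, Finset.mul_sum, ← Finset.sum_add_distrib,
          ← Finset.sum_add_distrib]
        refine Finset.sum_congr rfl fun x _ => ?_
        rw [norm_add_sq_real, real_inner_smul_right]; ring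
      rw [e, hP1, hm, inner_zero_right]
      have : ∑ x, P x * ‖X x‖ ^ 2 ≤ b ^ 2 := by
        calc _ ≤ ∑ x, P x * b ^ 2 := Finset.sum_le_sum fun x _ =>
              mul_le_mul_of_nonneg_left (pow_le_pow_left₀ (norm_nonneg _) (hX x) 2) (hP x)
          _ = b ^ 2 := by rw [← Finset.sum_mul, hP1, one_mul]
      linarith
    calc _ = ∑ s : Fin k → α, sampleWeight P s * ∑ x, P x * ‖(a + ∑ i, X (s i)) + X x‖ ^ 2 := by
          rw [sum_fin_cons]
          refine Finset.sum_congr rfl fun s _ => ?_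
          simp only [sampleWeight_cons, Finset.mul_sum]
          refine Finset.sum_congr rfl fun x _ => ?_
          rw [Fin.sum_univ_succ]
          simp only [Fin.cons_zero, Fin.cons_succ]
          rw [add_comm (X x), ← add_assoc]
          ring
      _ ≤ ∑ s : Fin k → α, sampleWeight P s * (‖a + ∑ i, X (s i)‖ ^ 2 + b ^ 2) :=
          Finset.sum_le_sum fun s _ =>
            mul_le_mul_of_nonneg_left (h1 _) (sampleWeight_nonneg hP s)
      _ ≤ (‖a‖ ^ 2 + k * b ^ 2) + b ^ 2 := by
          simp only [mul_add, Finset.sum_add_distrib, ← Finset.sum_mul,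
            sum_sampleWeight P hP1 k, one_mul]
          linarith [ih a]
      _ = _ := by push_cast; ring

theorem sum_sampleWeight_mul_norm_le (P : α → ℝ) (hP : ∀ x, 0 ≤ P x) (hP1 : ∑ x, P x = 1)
    (X : α → V) (b : ℝ) (hb : 0 ≤ b) (hX : ∀ x, ‖X x‖ ≤ b) (hm : ∑ x, P x • X x = 0) (k : ℕ) :
    ∑ s : Fin k → α, sampleWeight P s * ‖∑ i, X (s i)‖ ≤ b * Real.sqrt k := by
  have h := sum_sampleWeight_mul_norm_sq_le P hP hP1 X b hX hm k 0
  simp only [zero_add, norm_zero, ne_eq, OfNat.ofNat_ne_zero, not_false_eq_true, zero_pow] at h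
  have hcs : (∑ s : Fin k → α, sampleWeight P s * ‖∑ i, X (s i)‖) ^ 2
      ≤ ∑ s : Fin k → α, sampleWeight P s * ‖∑ i, X (s i)‖ ^ 2 := by
    have := Finset.sum_mul_sq_le_sq_mul_sq Finset.univ
      (fun s : Fin k → α => Real.sqrt (sampleWeight P s))
      (fun s => Real.sqrt (sampleWeight P s) * ‖∑ i, X (s i)‖)
    have e1 : ∀ s : Fin k → α, Real.sqrt (sampleWeight P s)
        * (Real.sqrt (sampleWeight P s) * ‖∑ i, X (s i)‖)
        = sampleWeight P s * ‖∑ i, X (s i)‖ := by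
      intro s; rw [← mul_assoc, Real.mul_self_sqrt (sampleWeight_nonneg hP s)]
    simp only [e1, mul_pow, Real.sq_sqrt (sampleWeight_nonneg hP _), sum_sampleWeight P hP1 k,
      one_mul] at this
    exact this
  refine abs_le_of_sq_le_sq' ?_ (by positivity) |>.2
  rw [mul_pow, Real.sq_sqrt (by positivity)]
  linarith

/-- Concentration of the mean of independent bounded vectors in an inner product space. -/
theorem sum_sampleWeight_deviation_le (P : α → ℝ) (hP : ∀ x, 0 ≤ P x) (hP1 : ∑ x, P x = 1)
    (X : α → V) (b : ℝ) (hb : 0 < b) (hX : ∀ x, ‖X x‖ ≤ b) (k : ℕ) (hk : 0 < k) (δ : ℝ)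
    (hδ : 0 < δ) (hδ2 : δ ≤ 1 / 2) (bad : (Fin k → α) → Prop) [DecidablePred bad]
    (hbad : ∀ s, bad s → 6 * b * Real.sqrt (Real.log (1 / δ) / k)
      < ‖(k : ℝ)⁻¹ • ∑ i, X (s i) - ∑ x, P x • X x‖) :
    ∑ s, sampleWeight P s * (if bad s then 1 else 0) ≤ δ := by
  set m := ∑ x, P x • X x with hm
  set Lg := Real.log (1 / δ) with hLg
  have hkR : (0 : ℝ) < k := by exact_mod_cast hk
  -- This is where `δ ≤ 1/2` enters; the value `4/9` is what the last estimate `2 √Lg - 4 Lg ≤ -Lg`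
  -- requires.
  have hLge : (4 / 9 : ℝ) ≤ Lg := by
    have h2 : (2 : ℝ) ≤ 1 / δ := by rw [le_div_iff₀ hδ]; linarith
    have := Real.log_le_log (by norm_num) h2
    linarith [Real.log_two_gt_d9]
  have hL0 : 0 ≤ Lg := by linarith
  have hsL : (2 / 3 : ℝ) ≤ Real.sqrt Lg := by
    apply Real.le_sqrt_of_sq_le; norm_num; linarith
  have hmb : ‖m‖ ≤ b := by
    calc ‖m‖ ≤ ∑ x, ‖P x • X x‖ := norm_sum_le _ _
      _ ≤ ∑ x, P x * b := by
          refine Finset.sum_le_sum fun x _ => ?_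
          rw [norm_smul, Real.norm_eq_abs, abs_of_nonneg (hP x)]
          exact mul_le_mul_of_nonneg_left (hX x) (hP x)
      _ = b := by rw [← Finset.sum_mul, hP1, one_mul]
  set Y : α → V := fun x => X x - m with hY
  have hYb : ∀ x, ‖Y x‖ ≤ 2 * b := fun x => by
    calc ‖Y x‖ ≤ ‖X x‖ + ‖m‖ := norm_sub_le _ _
      _ ≤ 2 * b := by linarith [hX x]
  have hYm : ∑ x, P x • Y x = 0 := by
    simp only [hY, smul_sub, Finset.sum_sub_distrib, ← Finset.sum_smul, hP1, one_smul, ← hm,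
      sub_self]
  have hEf := sum_sampleWeight_mul_norm_le P hP hP1 Y (2 * b) (by linarith) hYb hYm k
  -- With this exponent the expected norm contributes `2 √Lg`, the bounded differences contribute `2
  -- Lg`, and the threshold `6 b √(Lg / k)` contributes `-6 Lg`.
  set lam := Real.sqrt Lg / (b * Real.sqrt k) with hlam
  have hsk : 0 < Real.sqrt k := Real.sqrt_pos.2 hkR
  have hlam0 : 0 ≤ lam := by positivity
  have hmgf := sum_sampleWeight_mul_exp_le P hP hP1 (lam * (2 * b)) k
    (fun s => lam * ‖∑ i, Y (s i)‖) (by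
      intro s i a
      rw [← mul_sub, abs_mul, abs_of_nonneg hlam0]
      refine mul_le_mul_of_nonneg_left ?_ hlam0
      refine (abs_norm_sub_norm_le _ _).trans ?_
      rw [← Finset.sum_sub_distrib, Finset.sum_eq_single i]
      · simp only [Function.update_self, hY, sub_sub_sub_cancel_right]
        exact (norm_sub_le _ _).trans (by linarith [hX (s i), hX a])
      · intro j _ hj; simp [hj]
      · simp)
  have hbad' : ∀ s, (if bad s then (1 : ℝ) else 0)
      ≤ Real.exp (lam * ‖∑ i, Y (s i)‖) * Real.exp (-(6 * Lg)) := by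
    intro s
    split_ifs with h
    · rw [← Real.exp_add]
      apply Real.one_le_exp
      have h1 := hbad s h
      have e : ∑ i, Y (s i) = (k : ℝ) • ((k : ℝ)⁻¹ • ∑ i, X (s i) - m) := by
        rw [smul_sub, smul_smul, mul_inv_cancel₀ hkR.ne', one_smul]
        simp only [hY, Finset.sum_sub_distrib, Finset.sum_const, Finset.card_univ,
          Fintype.card_fin]
        rw [Nat.cast_smul_eq_nsmul]
      have h2 : 6 * b * Real.sqrt k * Real.sqrt Lg ≤ ‖∑ i, Y (s i)‖ := by
        rw [e, norm_smul, Real.norm_eq_abs, abs_of_pos hkR]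
        rw [Real.sqrt_div hL0] at h1
        have h3 := mul_le_mul_of_nonneg_left h1.le hkR.le
        refine le_trans (le_of_eq ?_) h3
        have : (k : ℝ) = Real.sqrt k * Real.sqrt k := (Real.mul_self_sqrt hkR.le).symm
        field_simp
        rw [Real.sq_sqrt hkR.le]
      have h3 := mul_le_mul_of_nonneg_left h2 hlam0
      have e2 : lam * (6 * b * Real.sqrt k * Real.sqrt Lg) = 6 * Lg := by
        rw [hlam]; field_simp
        rw [Real.sq_sqrt hL0]
      linarith
    · positivity
  calc ∑ s, sampleWeight P s * (if bad s then 1 else 0)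
      ≤ ∑ s, sampleWeight P s
          * (Real.exp (lam * ‖∑ i, Y (s i)‖) * Real.exp (-(6 * Lg))) :=
        Finset.sum_le_sum fun s _ =>
          mul_le_mul_of_nonneg_left (hbad' s) (sampleWeight_nonneg hP s)
    _ = (∑ s, sampleWeight P s * Real.exp (lam * ‖∑ i, Y (s i)‖)) * Real.exp (-(6 * Lg)) := by
        rw [Finset.sum_mul]; exact Finset.sum_congr rfl fun s _ => by ring
    _ ≤ Real.exp (2 * Real.sqrt Lg + 2 * Lg) * Real.exp (-(6 * Lg)) := by
        gcongr
        refine hmgf.trans (Real.exp_le_exp.2 ?_)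
        have e1 : ∑ s : Fin k → α, sampleWeight P s * (lam * ‖∑ i, Y (s i)‖)
            = lam * ∑ s : Fin k → α, sampleWeight P s * ‖∑ i, Y (s i)‖ := by
          rw [Finset.mul_sum]; exact Finset.sum_congr rfl fun s _ => by ring
        rw [e1]
        have h1 := mul_le_mul_of_nonneg_left hEf hlam0
        have e2 : lam * (2 * b * Real.sqrt k) = 2 * Real.sqrt Lg := by
          rw [hlam]; field_simp
        have e3 : k * ((lam * (2 * b)) ^ 2 / 2) = 2 * Lg := by
          rw [hlam]
          have : (k : ℝ) = Real.sqrt k ^ 2 := (Real.sq_sqrt hkR.le).symm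
          field_simp
          rw [Real.sq_sqrt hL0, Real.sq_sqrt hkR.le]
        linarith
    _ = Real.exp (2 * Real.sqrt Lg - 4 * Lg) := by rw [← Real.exp_add]; ring_nf
    _ ≤ Real.exp (-Lg) := by
        apply Real.exp_le_exp.2
        nlinarith [Real.sq_sqrt hL0]
    _ = δ := by rw [hLg, one_div, Real.log_inv, neg_neg, Real.exp_log hδ]

end concentration

/-! ### Measurement outcomes -/

section born

variable {n : ℕ}

theorem sum_norm_sq_eq_one (ψ : QubitSpace n) (hψ : ‖ψ‖ = 1) : ∑ x, ‖ψ x‖ ^ 2 = 1 := by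
  rw [← EuclideanSpace.norm_sq_eq, hψ, one_pow]

theorem bornMeasure_singleton (ψ : QubitSpace n) (x : Cfg n) :
    bornMeasure ψ {x} = ENNReal.ofReal (‖ψ x‖ ^ 2) := by
  classical
  rw [bornMeasure, Measure.finsetSum_apply]
  simp only [Measure.smul_apply, smul_eq_mul, Measure.dirac_apply, Set.indicator_apply,
    Set.mem_singleton_iff, Pi.one_apply, mul_ite, mul_one, mul_zero, Finset.sum_ite_eq',
    Finset.mem_univ, if_true]

instance isFiniteMeasure_bornMeasure (ψ : QubitSpace n) : IsFiniteMeasure (bornMeasure ψ) := by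
  refine ⟨?_⟩
  rw [bornMeasure, Measure.finsetSum_apply]
  simp [ENNReal.sum_lt_top]

theorem pi_bornMeasure_eq (ψ : QubitSpace n) (k : ℕ) (S : Finset (Fin k → Cfg n)) :
    Measure.pi (fun _ : Fin k => bornMeasure ψ) (S : Set (Fin k → Cfg n))
      = ENNReal.ofReal (∑ s ∈ S, sampleWeight (fun x => ‖ψ x‖ ^ 2) s) := by
  rw [← sum_measure_singleton, ENNReal.ofReal_sum_of_nonneg]
  · refine Finset.sum_congr rfl fun s _ => ?_
    rw [Measure.pi_singleton, sampleWeight, ENNReal.ofReal_prod_of_nonneg]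
    · exact Finset.prod_congr rfl fun i _ => bornMeasure_singleton ψ _
    · intro i _; positivity
  · intro s _; exact sampleWeight_nonneg (fun x => by positivity) s

theorem ofReal_le_pi_bornMeasure (ψ : QubitSpace n) (hψ : ‖ψ‖ = 1) (k : ℕ)
    (A : Set (Fin k → Cfg n)) (δ : ℝ) (bad : (Fin k → Cfg n) → Prop) [DecidablePred bad]
    (hA : ∀ s, ¬ bad s → s ∈ A)
    (h : ∑ s, sampleWeight (fun x => ‖ψ x‖ ^ 2) s * (if bad s then 1 else 0) ≤ δ) :
    ENNReal.ofReal (1 - δ) ≤ Measure.pi (fun _ : Fin k => bornMeasure ψ) A := by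
  have h1 := sum_sampleWeight (fun x => ‖ψ x‖ ^ 2) (sum_norm_sq_eq_one ψ hψ) k
  have hsub : ((Finset.univ.filter fun s => ¬ bad s : Finset (Fin k → Cfg n))
      : Set (Fin k → Cfg n)) ⊆ A := by
    intro s hs
    exact hA s (by simpa using hs)
  refine le_trans ?_ (measure_mono hsub)
  rw [pi_bornMeasure_eq]
  apply ENNReal.ofReal_le_ofReal
  rw [Finset.sum_filter]
  have : ∑ s, sampleWeight (fun x => ‖ψ x‖ ^ 2) s * (if bad s then 1 else 0)
      + ∑ s, (if ¬ bad s then sampleWeight (fun x => ‖ψ x‖ ^ 2) s else 0) = 1 := by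
    rw [← Finset.sum_add_distrib]
    refine Eq.trans ?_ h1
    refine Finset.sum_congr rfl fun s _ => ?_
    by_cases hb : bad s <;> simp [hb]
  linarith

end born

/-! ### Convergence of Alphatron with link function `tanh` -/

/-- Only the target `b` is bounded, while `a` comes from an iterate and can be large, so the bound
has to saturate. It follows from `tanh a - tanh b = sinh d / (cosh a cosh b)`, from `cosh a ≤ cosh b
exp d`, and from `sinh d / exp d = (1 - exp (-2d)) / 2`. -/
theorem tanh_sub_tanh_ge_of_le {a b β : ℝ} (hb : |b| ≤ β) (hab : b ≤ a) :
    (1 - Real.tanh β ^ 2) * ((a - b) / (1 + 2 * (a - b))) ≤ Real.tanh a - Real.tanh b := by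
  set d := a - b with hd
  have hd0 : 0 ≤ d := sub_nonneg.2 hab
  have ha : a = b + d := by rw [hd]; ring
  have hca := Real.cosh_pos a
  have hcb := Real.cosh_pos b
  have hcβ : Real.cosh b ≤ Real.cosh β := by
    rw [Real.cosh_le_cosh]; exact hb.trans (le_abs_self β)
  have hκ : 1 - Real.tanh β ^ 2 ≤ 1 / Real.cosh b ^ 2 := by
    rw [one_sub_tanh_sq]
    exact one_div_le_one_div_of_le (by positivity) (pow_le_pow_left₀ hcb.le hcβ 2)
  have hcosh : Real.cosh a ≤ Real.cosh b * Real.exp d := by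
    rw [ha, Real.cosh_add, ← Real.cosh_add_sinh d, mul_add]
    have h1 : 0 ≤ Real.sinh d := Real.sinh_nonneg_iff.2 hd0
    have h2 := mul_le_mul_of_nonneg_right (Real.sinh_lt_cosh b).le h1
    linarith
  have hdiff : Real.tanh a - Real.tanh b = Real.sinh d / (Real.cosh a * Real.cosh b) := by
    rw [Real.tanh_eq_sinh_div_cosh, Real.tanh_eq_sinh_div_cosh, hd, Real.sinh_sub]
    field_simp
  have hs0 : 0 ≤ Real.sinh d := Real.sinh_nonneg_iff.2 hd0
  have hfrac : d / (1 + 2 * d) ≤ Real.sinh d / Real.exp d := by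
    have h1 : 1 + 2 * d ≤ Real.exp d * Real.exp d := by
      rw [← Real.exp_add]
      have := Real.add_one_le_exp (d + d)
      linarith
    have hE := Real.exp_pos d
    have h3 : Real.sinh d / Real.exp d = (1 - 1 / (Real.exp d * Real.exp d)) / 2 := by
      rw [Real.sinh_eq, Real.exp_neg]; field_simp
    have h4 : 1 / (Real.exp d * Real.exp d) ≤ 1 / (1 + 2 * d) :=
      one_div_le_one_div_of_le (by positivity) h1
    have h5 : d / (1 + 2 * d) = (1 - 1 / (1 + 2 * d)) / 2 := by
      have : 1 + 2 * d ≠ 0 := by positivity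
      field_simp; ring
    rw [h3, h5]; linarith
  calc (1 - Real.tanh β ^ 2) * (d / (1 + 2 * d))
      ≤ 1 / Real.cosh b ^ 2 * (Real.sinh d / Real.exp d) := by
        apply mul_le_mul hκ hfrac (by positivity) (by positivity)
    _ = Real.sinh d / (Real.cosh b * Real.exp d * Real.cosh b) := by
        have := (Real.exp_pos d).ne'
        field_simp
    _ ≤ Real.sinh d / (Real.cosh a * Real.cosh b) := by gcongr
    _ = _ := hdiff.symm

theorem mul_tanh_sub_tanh_ge {a b β : ℝ} (hb : |b| ≤ β) :
    (1 - Real.tanh β ^ 2) * ((a - b) ^ 2 / (1 + 2 * |a - b|))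
      ≤ (Real.tanh a - Real.tanh b) * (a - b) := by
  rcases le_total b a with h | h
  · have h0 : 0 ≤ a - b := sub_nonneg.2 h
    have := mul_le_mul_of_nonneg_right (tanh_sub_tanh_ge_of_le hb h) h0
    rw [abs_of_nonneg h0]
    refine le_trans (le_of_eq ?_) this
    ring
  · have h0 : 0 ≤ b - a := sub_nonneg.2 h
    have h1 := tanh_sub_tanh_ge_of_le (a := -a) (b := -b) (β := β) (by rwa [abs_neg])
      (by linarith)
    rw [Real.tanh_neg, Real.tanh_neg, show -a - -b = b - a by ring] at h1
    have := mul_le_mul_of_nonneg_right h1 h0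
    rw [abs_sub_comm, abs_of_nonneg h0]
    refine le_trans (le_of_eq ?_) (this.trans (le_of_eq ?_))
    · ring
    · ring

/-- Cocoercivity: `tanh` is increasing and 1-Lipschitz. This is what makes the learning rate `1`
admissible. -/
theorem sq_tanh_sub_tanh_le (a b : ℝ) :
    (Real.tanh a - Real.tanh b) ^ 2 ≤ (Real.tanh a - Real.tanh b) * (a - b) := by
  have h := abs_tanh_sub_tanh_le a b
  rcases le_total b a with hab | hab
  · have h1 := tanh_mono hab
    rw [abs_of_nonneg (by linarith), abs_of_nonneg (by linarith)] at h
    nlinarith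
  · have h1 := tanh_mono hab
    rw [abs_of_nonpos (by linarith), abs_of_nonpos (by linarith)] at h
    nlinarith

section contraction

variable {V : Type*} [NormedAddCommGroup V] [InnerProductSpace ℝ V]

/-- One noiseless gradient step of the logistic regression contracts the error. -/
theorem norm_sub_gradient_le {k : ℕ} (φ : Fin k → V) (hφ : ∀ i, ‖φ i‖ ≤ 1) (v w : V) (β lam : ℝ)
    (hv : ∀ i, |inner ℝ v (φ i)| ≤ β) (hlam0 : 0 ≤ lam) (hlam1 : lam ≤ 1)
    (hcov : lam * ‖w‖ ^ 2 ≤ (k : ℝ)⁻¹ * ∑ i, inner ℝ w (φ i) ^ 2) :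
    ‖w - (k : ℝ)⁻¹ • ∑ i, (Real.tanh (inner ℝ (v + w) (φ i))
        - Real.tanh (inner ℝ v (φ i))) • φ i‖
      ≤ ‖w‖ - (1 - Real.tanh β ^ 2) * lam / 6 * min 1 ‖w‖ := by
  set κ := 1 - Real.tanh β ^ 2 with hκ
  have hκ0 : 0 ≤ κ := by linarith [tanh_sq_le_one β]
  have hκ1 : κ ≤ 1 := by linarith [sq_nonneg (Real.tanh β)]
  set r : Fin k → ℝ := fun i => Real.tanh (inner ℝ (v + w) (φ i)) - Real.tanh (inner ℝ v (φ i))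
    with hr
  set g := (k : ℝ)⁻¹ • ∑ i, r i • φ i with hg
  have hki : 0 ≤ (k : ℝ)⁻¹ := by positivity
  have hdiff : ∀ i, inner ℝ (v + w) (φ i) - inner ℝ v (φ i) = inner ℝ w (φ i) := fun i => by
    rw [inner_add_left]; ring
  have hwg : inner ℝ w g = (k : ℝ)⁻¹ * ∑ i, r i * inner ℝ w (φ i) := by
    rw [hg, real_inner_smul_right, inner_sum]
    congr 1
    exact Finset.sum_congr rfl fun i _ => real_inner_smul_right _ _ _
  -- Cocoercivity passes to the averaged gradient because the features have norm at most one. It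
  -- leaves `‖w - g‖² ≤ ‖w‖² - ⟪w, g⟫`.
  have hgg : ‖g‖ ^ 2 ≤ inner ℝ w g := by
    have h1 : ‖g‖ ≤ (k : ℝ)⁻¹ * ∑ i, |r i| := by
      rw [hg, norm_smul, Real.norm_eq_abs, abs_of_nonneg hki]
      refine mul_le_mul_of_nonneg_left ((norm_sum_le _ _).trans ?_) hki
      refine Finset.sum_le_sum fun i _ => ?_
      rw [norm_smul, Real.norm_eq_abs]
      exact mul_le_of_le_one_right (abs_nonneg _) (hφ i)
    have h2 : (∑ i, |r i|) ^ 2 ≤ k * ∑ i, r i ^ 2 := by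
      simpa using sq_sum_le_card_mul_sum_sq (s := Finset.univ) (f := fun i => |r i|)
    have h3 : ∑ i, r i ^ 2 ≤ ∑ i, r i * inner ℝ w (φ i) := by
      refine Finset.sum_le_sum fun i _ => ?_
      rw [← hdiff i]
      exact sq_tanh_sub_tanh_le _ _
    rw [hwg]
    calc ‖g‖ ^ 2 ≤ ((k : ℝ)⁻¹ * ∑ i, |r i|) ^ 2 := pow_le_pow_left₀ (norm_nonneg _) h1 2
      _ = (k : ℝ)⁻¹ * ((k : ℝ)⁻¹ * (∑ i, |r i|) ^ 2) := by ring
      _ ≤ (k : ℝ)⁻¹ * ((k : ℝ)⁻¹ * (k * ∑ i, r i ^ 2)) := by gcongr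
      _ = ((k : ℝ)⁻¹ * k) * ((k : ℝ)⁻¹ * ∑ i, r i ^ 2) := by ring
      _ ≤ 1 * ((k : ℝ)⁻¹ * ∑ i, r i ^ 2) := by
          refine mul_le_mul_of_nonneg_right inv_mul_le_one ?_
          exact mul_nonneg hki (Finset.sum_nonneg fun i _ => sq_nonneg _)
      _ ≤ _ := by rw [one_mul]; gcongr
  have ha0 : 0 ≤ ‖w‖ := norm_nonneg w
  have hlow : κ * lam * (‖w‖ ^ 2 / (1 + 2 * ‖w‖)) ≤ inner ℝ w g := by
    rw [hwg]
    have h1 : ∀ i, κ * (inner ℝ w (φ i) ^ 2 / (1 + 2 * ‖w‖)) ≤ r i * inner ℝ w (φ i) := by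
      intro i
      have h := mul_tanh_sub_tanh_ge (a := inner ℝ (v + w) (φ i)) (hv i)
      rw [hdiff] at h
      refine le_trans ?_ h
      refine mul_le_mul_of_nonneg_left ?_ hκ0
      have h2 : |inner ℝ w (φ i)| ≤ ‖w‖ := (abs_real_inner_le_norm _ _).trans
        (mul_le_of_le_one_right ha0 (hφ i))
      gcongr
    calc κ * lam * (‖w‖ ^ 2 / (1 + 2 * ‖w‖)) = κ / (1 + 2 * ‖w‖) * (lam * ‖w‖ ^ 2) := by ring
      _ ≤ κ / (1 + 2 * ‖w‖) * ((k : ℝ)⁻¹ * ∑ i, inner ℝ w (φ i) ^ 2) := by gcongr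
      _ = (k : ℝ)⁻¹ * ∑ i, κ * (inner ℝ w (φ i) ^ 2 / (1 + 2 * ‖w‖)) := by
          rw [← Finset.mul_sum, ← Finset.sum_div]; ring
      _ ≤ _ := mul_le_mul_of_nonneg_left (Finset.sum_le_sum fun i _ => h1 i) hki
  set m := min 1 ‖w‖ with hm
  have hm0 : 0 ≤ m := le_min zero_le_one ha0
  have hmw : m ≤ ‖w‖ := min_le_right _ _
  -- The gain is quadratic for small and linear for large errors; `m = min 1 ‖w‖` covers both.
  -- Completing the square then turns `1/3` into `1/6`.
  have hfr : m * ‖w‖ / 3 ≤ ‖w‖ ^ 2 / (1 + 2 * ‖w‖) := by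
    rw [div_le_div_iff₀ (by norm_num) (by positivity)]
    have hm1 : m ≤ 1 := min_le_left _ _
    have : m * (1 + 2 * ‖w‖) ≤ 3 * ‖w‖ := by nlinarith
    nlinarith
  have hc0 : 0 ≤ κ * lam := mul_nonneg hκ0 hlam0
  have hc1 : κ * lam ≤ 1 := mul_le_one₀ hκ1 hlam0 hlam1
  have hsq : ‖w - g‖ ^ 2 ≤ (‖w‖ - κ * lam / 6 * m) ^ 2 := by
    rw [norm_sub_sq_real]
    have h1 := mul_le_mul_of_nonneg_left hfr hc0
    nlinarith [sq_nonneg (κ * lam / 6 * m)]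
  refine (abs_le_of_sq_le_sq' hsq ?_).2
  nlinarith

end contraction

/-- There are two phases. Above `1` the error drops by at least `μ - e ≥ μ / 2` per step, so `t₁`
steps reach the interval below `1`. That interval is never left, and inside it the error contracts
geometrically towards the fixed point `e / μ`. -/
theorem error_recursion_le (a : ℕ → ℝ) (ha0 : ∀ t, 0 ≤ a t) (μ e B : ℝ) (hμ0 : 0 < μ)
    (hμ1 : μ ≤ 1) (he0 : 0 ≤ e) (he : e ≤ μ / 2) (hB : a 0 ≤ B)
    (hrec : ∀ t, a (t + 1) ≤ a t - μ * min 1 (a t) + e) (t₁ t₂ : ℕ) (ht₁ : 2 * B ≤ μ * t₁) :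
    a (t₁ + t₂) ≤ B * (1 - μ) ^ t₂ + e / μ := by
  have hq0 : 0 ≤ 1 - μ := by linarith
  have hle1 : ∀ t, a t ≤ 1 → a (t + 1) ≤ (1 - μ) * a t + e := by
    intro t ht
    have := hrec t
    rw [min_eq_right ht] at this
    linarith
  have hstay : ∀ t, a t ≤ 1 → ∀ j, a (t + j) ≤ 1 ∧ a (t + j) ≤ (1 - μ) ^ j * a t + e / μ := by
    intro t ht j
    induction j with
    | zero => exact ⟨ht, by simp; positivity⟩
    | succ j ih =>
      have h1 := hle1 _ ih.1
      refine ⟨?_, ?_⟩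
      · rw [← add_assoc]
        have := mul_le_mul_of_nonneg_left ih.1 hq0
        linarith
      · rw [← add_assoc]
        have h2 := mul_le_mul_of_nonneg_left ih.2 hq0
        have h3 : (1 - μ) * (e / μ) + e = e / μ := by field_simp; ring
        rw [pow_succ]
        nlinarith
  have hB0 : 0 ≤ B := (ha0 0).trans hB
  -- For `B ≤ 1` the first phase is empty, and all `t₁ + t₂` steps contract.
  rcases le_total B 1 with hB1 | hB1
  · have h := (hstay 0 (hB.trans hB1) (t₁ + t₂)).2
    rw [zero_add] at h
    have h1 : (1 - μ) ^ (t₁ + t₂) * a 0 ≤ B * (1 - μ) ^ t₂ := by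
      rw [mul_comm]
      refine mul_le_mul hB ?_ (by positivity) hB0
      exact pow_le_pow_of_le_one hq0 (by linarith) (by omega)
    linarith
  · have hmax : ∀ t : ℕ, a t ≤ max 1 (B - μ / 2 * t) := by
      intro t
      induction t with
      | zero => simp [hB]
      | succ t ih =>
        rcases le_total (a t) 1 with h | h
        · have := hle1 t h
          have h2 := mul_le_mul_of_nonneg_left h hq0
          exact le_max_of_le_left (by linarith)
        · have h1 := hrec t
          rw [min_eq_left h] at h1
          rcases le_max_iff.1 ih with h2 | h2
          · exact le_max_of_le_left (by linarith)
          · apply le_max_of_le_right; push_cast; linarith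
    have h1 : a t₁ ≤ 1 := by
      have := hmax t₁
      rwa [max_eq_left (by linarith)] at this
    have h := (hstay t₁ h1 t₂).2
    have h2 : (1 - μ) ^ t₂ * a t₁ ≤ B * (1 - μ) ^ t₂ := by
      rw [mul_comm]
      exact mul_le_mul_of_nonneg_right (h1.trans hB1) (by positivity)
    linarith

/-- Only the polynomial decay `(1 - μ)^t ≤ 1 / (μ t)` is used. The final error has the denominator
`μ` anyway, so `B / s` steps suffice, independently of `μ`. -/
theorem mul_pow_le_div {B μ s : ℝ} (hB : 0 ≤ B) (hs : 0 < s) (hμ0 : 0 < μ) (hμ1 : μ ≤ 1)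
    (t : ℕ) (ht : B / s ≤ t) : B * (1 - μ) ^ t ≤ s / μ := by
  rcases hB.eq_or_lt with rfl | hB
  · rw [zero_mul]; positivity
  have ht0 : (0 : ℝ) < t := lt_of_lt_of_le (by positivity) ht
  have h1 : (1 - μ) ^ t ≤ 1 / (μ * t) := by
    calc (1 - μ) ^ t ≤ Real.exp (-μ) ^ t :=
          pow_le_pow_left₀ (by linarith) (Real.one_sub_le_exp_neg μ) t
      _ = 1 / Real.exp (μ * t) := by
          rw [← Real.exp_nat_mul, one_div, ← Real.exp_neg]; ring_nf
      _ ≤ 1 / (μ * t) := by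
          apply one_div_le_one_div_of_le (by positivity)
          linarith [Real.add_one_le_exp (μ * t)]
  calc B * (1 - μ) ^ t ≤ B * (1 / (μ * t)) := by gcongr
    _ ≤ B * (1 / (μ * (B / s))) := by gcongr
    _ = s / μ := by field_simp

/-! ### Alphatron in feature space -/

section feature

variable {n : ℕ}

/-- The feature vector of a node as an element of Euclidean space. -/
noncomputable def featureVec (A : Finset (Fin n)) (x : Cfg n) :
    EuclideanSpace ℝ (Finset (Fin n)) := WithLp.toLp 2 (nodeFeature A x)

@[simp] theorem featureVec_apply (A : Finset (Fin n)) (x : Cfg n) (S : Finset (Fin n)) :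
    featureVec A x S = nodeFeature A x S := rfl

theorem nodeKernel_eq_inner (A : Finset (Fin n)) (x x' : Cfg n) :
    nodeKernel A x x' = inner ℝ (featureVec A x) (featureVec A x') := by
  rw [PiLp.inner_apply, nodeKernel]
  refine Finset.sum_congr rfl fun S _ => ?_
  simp [mul_comm]

theorem abs_monomialAt (S : Finset (Fin n)) (x : Cfg n) : |monomialAt S x| = 1 := by
  rw [monomialAt, Finset.abs_prod]
  exact Finset.prod_eq_one fun i _ => abs_spin _

theorem norm_featureVec (A : Finset (Fin n)) (x : Cfg n) : ‖featureVec A x‖ = 1 := by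
  have h : ‖featureVec A x‖ ^ 2 = 1 := by
    rw [EuclideanSpace.norm_sq_eq]
    have : ∀ S, ‖featureVec A x S‖ ^ 2 = if S ∈ A.powerset then 1 / 2 ^ A.card else 0 := by
      intro S
      rw [featureVec_apply, nodeFeature]
      simp only [Finset.mem_powerset]
      split_ifs
      · rw [norm_div, div_pow, Real.norm_eq_abs, abs_monomialAt, Real.norm_eq_abs, sq_abs,
          Real.sq_sqrt (by positivity), one_pow]
      · simp
    simp only [this, Finset.sum_ite_mem, Finset.univ_inter, Finset.sum_const, Finset.card_powerset,
      nsmul_eq_mul]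
    push_cast
    field_simp
  nlinarith [norm_nonneg (featureVec A x)]

/-- The weight vector of the `t`-th hypothesis of Alphatron for the spin at `v`. -/
noncomputable def alphatronVec {k : ℕ} (A : Finset (Fin n)) (v : Fin n) (x : Fin k → Cfg n)
    (t : ℕ) : EuclideanSpace ℝ (Finset (Fin n)) :=
  ∑ j, alphatronCoeff (nodeKernel A) Real.tanh 1 x (fun i => spin (x i v)) t j
    • featureVec A (x j)

theorem alphatronVec_zero {k : ℕ} (A : Finset (Fin n)) (v : Fin n) (x : Fin k → Cfg n) :
    alphatronVec A v x 0 = 0 := by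
  simp [alphatronVec, alphatronCoeff]

/-- The kernel trick: in feature space, the update of the dual coefficients is a gradient step for
the logistic regression of the spin at `v`. -/
theorem alphatronVec_succ {k : ℕ} (A : Finset (Fin n)) (v : Fin n) (x : Fin k → Cfg n) (t : ℕ) :
    alphatronVec A v x (t + 1) = alphatronVec A v x t + (k : ℝ)⁻¹ • ∑ i,
      (spin (x i v) - Real.tanh (inner ℝ (alphatronVec A v x t) (featureVec A (x i))))
        • featureVec A (x i) := by
  have h : ∀ i, ∑ j, alphatronCoeff (nodeKernel A) Real.tanh 1 x (fun i => spin (x i v)) t j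
      * nodeKernel A (x j) (x i) = inner ℝ (alphatronVec A v x t) (featureVec A (x i)) := by
    intro i
    rw [alphatronVec, sum_inner]
    refine Finset.sum_congr rfl fun j _ => ?_
    rw [real_inner_smul_left, nodeKernel_eq_inner]
  rw [alphatronVec]
  simp only [alphatronCoeff, h, add_smul, Finset.sum_add_distrib, Finset.smul_sum, smul_smul,
    one_div]
  rfl

/-- The second moments of the features are bounded below only on the subspace of vectors supported
on the subsets of `A`; the iterates never leave it. -/
theorem alphatronVec_apply_eq_zero {k : ℕ} (A : Finset (Fin n)) (v : Fin n) (x : Fin k → Cfg n)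
    (t : ℕ) (S : Finset (Fin n)) (hS : ¬ S ⊆ A) : alphatronVec A v x t S = 0 := by
  have : alphatronVec A v x t S = ∑ j, alphatronCoeff (nodeKernel A) Real.tanh 1 x
      (fun i => spin (x i v)) t j * nodeFeature A (x j) S := by
    rw [alphatronVec]
    simp
  rw [this]
  exact Finset.sum_eq_zero fun j _ => by rw [nodeFeature, if_neg hS, mul_zero]

/-- With no data held out, all errors are empty sums and every iterate ties, so the latest one wins.
Model selection is thus avoided. -/
theorem alphatronIndex_eq_of_no_heldOut {X : Type*} {k : ℕ} (K : X → X → ℝ) (u : ℝ → ℝ) (lam : ℝ)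
    (T : ℕ) (x : Fin k → X) (y : Fin k → ℝ) (a : Fin 0 → X) (b : Fin 0 → ℝ) :
    alphatronIndex K u lam T x y a b = T := by
  simp only [alphatronIndex, alphatronHeldOutError, Finset.univ_eq_empty, Finset.sum_empty,
    le_refl, implies_true, Finset.filter_true]
  apply le_antisymm
  · exact Finset.sup_le fun t ht => by simpa [Nat.lt_succ_iff] using ht
  · exact Finset.le_sup (f := id) (Finset.self_mem_range_succ T)

theorem nodePotential_eq {k : ℕ} (T : ℕ) (A : Finset (Fin n)) (v : Fin n) (x : Fin k → Cfg n)
    (a : Fin 0 → Cfg n) (S : Finset (Fin n)) :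
    nodePotential T A v x a S = alphatronVec A v x T S / Real.sqrt (2 ^ A.card) := by
  rw [nodePotential, alphatronIndex_eq_of_no_heldOut, alphatronVec]
  simp

/-- The error of Alphatron: `e` is the size of the gradient at the target `v`, and `lam` bounds the
empirical second moments of the features from below. -/
theorem norm_alphatronVec_sub_le {k : ℕ} (A : Finset (Fin n)) (u : Fin n) (x : Fin k → Cfg n)
    (v : EuclideanSpace ℝ (Finset (Fin n))) (hvA : ∀ S, ¬ S ⊆ A → v S = 0)
    (β lam e B s : ℝ) (hv : ∀ i, |inner ℝ v (featureVec A (x i))| ≤ β)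
    (hlam0 : 0 < lam) (hlam1 : lam ≤ 1)
    (hcov : ∀ w : EuclideanSpace ℝ (Finset (Fin n)), (∀ S, ¬ S ⊆ A → w S = 0) →
      lam * ‖w‖ ^ 2 ≤ (k : ℝ)⁻¹ * ∑ i, inner ℝ w (featureVec A (x i)) ^ 2)
    (he : ‖(k : ℝ)⁻¹ • ∑ i, (spin (x i u) - Real.tanh (inner ℝ v (featureVec A (x i))))
      • featureVec A (x i)‖ ≤ e)
    (heμ : e ≤ (1 - Real.tanh β ^ 2) * lam / 6 / 2) (hB : ‖v‖ ≤ B) (hs : 0 < s) (t₁ t₂ : ℕ)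
    (ht₁ : 2 * B ≤ (1 - Real.tanh β ^ 2) * lam / 6 * t₁) (ht₂ : B / s ≤ t₂) :
    ‖alphatronVec A u x (t₁ + t₂) - v‖ ≤ (s + e) / ((1 - Real.tanh β ^ 2) * lam / 6) := by
  have hκ0 : 0 < 1 - Real.tanh β ^ 2 := by linarith [Real.tanh_sq_lt_one β]
  have hκ1 : 1 - Real.tanh β ^ 2 ≤ 1 := by linarith [sq_nonneg (Real.tanh β)]
  set μ := (1 - Real.tanh β ^ 2) * lam / 6 with hμ
  have hμ0 : 0 < μ := by positivity
  have hμ1 : μ ≤ 1 := by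
    have := mul_le_one₀ hκ1 hlam0.le hlam1
    rw [hμ]; linarith
  have hB0 : 0 ≤ B := (norm_nonneg v).trans hB
  have hrec : ∀ t, ‖alphatronVec A u x (t + 1) - v‖
      ≤ ‖alphatronVec A u x t - v‖ - μ * min 1 ‖alphatronVec A u x t - v‖ + e := by
    intro t
    set w := alphatronVec A u x t - v with hw
    have hvw : v + w = alphatronVec A u x t := by rw [hw]; abel
    have h1 := norm_sub_gradient_le (fun i => featureVec A (x i))
      (fun i => (norm_featureVec A (x i)).le) v w β lam hv hlam0.le hlam1
      (hcov w fun S hS => by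
        rw [hw, PiLp.sub_apply, alphatronVec_apply_eq_zero A u x t S hS, hvA S hS, sub_zero])
    -- The step splits into a noiseless one, whose labels are the conditional means at the target,
    -- and the empirical gradient at the target, which does not depend on `t`.
    have e1 : alphatronVec A u x (t + 1) - v
        = (w - (k : ℝ)⁻¹ • ∑ i, (Real.tanh (inner ℝ (v + w) (featureVec A (x i)))
            - Real.tanh (inner ℝ v (featureVec A (x i)))) • featureVec A (x i))
          + (k : ℝ)⁻¹ • ∑ i, (spin (x i u) - Real.tanh (inner ℝ v (featureVec A (x i))))
            • featureVec A (x i) := by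
      have e0 : ∑ i, (spin (x i u) - Real.tanh (inner ℝ (v + w) (featureVec A (x i))))
            • featureVec A (x i)
          = ∑ i, (spin (x i u) - Real.tanh (inner ℝ v (featureVec A (x i))))
              • featureVec A (x i)
            - ∑ i, (Real.tanh (inner ℝ (v + w) (featureVec A (x i)))
              - Real.tanh (inner ℝ v (featureVec A (x i)))) • featureVec A (x i) := by
        rw [← Finset.sum_sub_distrib]
        refine Finset.sum_congr rfl fun i _ => ?_
        rw [← sub_smul]
        congr 1
        ring
      rw [alphatronVec_succ, ← hvw, e0, smul_sub]
      abel
    rw [e1]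
    refine (norm_add_le _ _).trans ?_
    exact add_le_add h1 he
  have he0 : 0 ≤ e := (norm_nonneg _).trans he
  have h := error_recursion_le (fun t => ‖alphatronVec A u x t - v‖) (fun t => norm_nonneg _) μ e B
    hμ0 hμ1 he0 heμ (by simp only [alphatronVec_zero, zero_sub, norm_neg]; exact hB) hrec t₁ t₂ ht₁
  have h2 := mul_pow_le_div hB0 hs hμ0 hμ1 t₂ ht₂
  rw [add_div]
  exact h.trans (by linarith)

end feature

/-! ### Multilinear expansion -/

section walsh

variable {n : ℕ}

/-- The coefficient of `x_S` in the multilinear expansion of `f`. -/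
noncomputable def walshCoeff (f : Cfg n → ℝ) (S : Finset (Fin n)) : ℝ :=
  (∑ x, f x * monomialAt S x) / 2 ^ n

theorem monomialAt_flipAt_of_mem {S : Finset (Fin n)} {i : Fin n} (h : i ∈ S) (x : Cfg n) :
    monomialAt S (flipAt i x) = -monomialAt S x := by
  rw [monomialAt, monomialAt, ← Finset.mul_prod_erase S _ h, ← Finset.mul_prod_erase S _ h,
    spin_flipAt_same, neg_mul]
  congr 2
  refine Finset.prod_congr rfl fun j hj => ?_
  rw [flipAt_ne (Finset.ne_of_mem_erase hj)]

theorem monomialAt_flipAt_of_notMem {S : Finset (Fin n)} {i : Fin n} (h : i ∉ S) (x : Cfg n) :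
    monomialAt S (flipAt i x) = monomialAt S x := by
  refine Finset.prod_congr rfl fun j hj => ?_
  rw [flipAt_ne (show j ≠ i from fun e => h (by rwa [← e]))]

theorem sum_monomialAt_mul (x y : Cfg n) :
    ∑ S, monomialAt S x * monomialAt S y = if x = y then 2 ^ n else 0 := by
  have h : ∑ S, monomialAt S x * monomialAt S y = ∏ i, (1 + spin (x i) * spin (y i)) := by
    rw [Finset.prod_one_add, Finset.powerset_univ]
    refine Finset.sum_congr rfl fun S _ => ?_
    rw [monomialAt, monomialAt, Finset.prod_mul_distrib]
  rw [h]
  split_ifs with hxy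
  · subst hxy
    simp only [spin_mul_self]
    rw [Finset.prod_const, Finset.card_univ, Fintype.card_fin]
    norm_num
  · obtain ⟨i, hi⟩ := Function.ne_iff.1 hxy
    apply Finset.prod_eq_zero (Finset.mem_univ i)
    cases hx : x i <;> cases hy : y i <;> simp_all [spin]

theorem potentialValue_walshCoeff (f : Cfg n → ℝ) : potentialValue (walshCoeff f) = f := by
  funext x
  simp only [potentialValue, walshCoeff]
  calc ∑ S, (∑ y, f y * monomialAt S y) / 2 ^ n * monomialAt S x
      = ∑ S, ∑ y, f y / 2 ^ n * (monomialAt S y * monomialAt S x) := by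
        refine Finset.sum_congr rfl fun S _ => ?_
        rw [Finset.sum_div, Finset.sum_mul]
        exact Finset.sum_congr rfl fun y _ => by ring
    _ = ∑ y, f y / 2 ^ n * ∑ S, monomialAt S y * monomialAt S x := by
        rw [Finset.sum_comm]
        exact Finset.sum_congr rfl fun y _ => by rw [Finset.mul_sum]
    _ = f x := by
        simp only [sum_monomialAt_mul, mul_ite, mul_zero, Finset.sum_ite_eq', Finset.mem_univ,
          if_true]
        field_simp

/-- The increment of `f` under a flip at `u` is invariant under a flip at `v`, hence orthogonal to
every monomial containing `v`. Its inner product with `x_S`, for `u ∈ S`, is twice that of `f`. -/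
theorem walshCoeff_eq_zero (f : Cfg n → ℝ) (u v : Fin n) (huv : v ≠ u)
    (h : ∀ x, siteDeriv u f (flipAt v x) = siteDeriv u f x) (S : Finset (Fin n)) (hu : u ∈ S)
    (hv : v ∈ S) : walshCoeff f S = 0 := by
  set d : Cfg n → ℝ := fun x => f x - f (flipAt u x) with hd
  have hdv : ∀ x, d (flipAt v x) = d x := by
    intro x
    simp only [hd, sub_flipAt_eq, h, flipAt_ne huv.symm]
  have h1 : ∑ x, f (flipAt u x) * monomialAt S x = -∑ x, f x * monomialAt S x := by
    rw [← sum_flipAt u, ← Finset.sum_neg_distrib]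
    exact Finset.sum_congr rfl fun x _ => by
      rw [flipAt_flipAt, monomialAt_flipAt_of_mem hu, mul_neg]
  have h2 : ∑ x, d x * monomialAt S x = -∑ x, d x * monomialAt S x := by
    conv_lhs => rw [← sum_flipAt v]
    rw [← Finset.sum_neg_distrib]
    exact Finset.sum_congr rfl fun x _ => by rw [hdv, monomialAt_flipAt_of_mem hv, mul_neg]
  have h3 : ∑ x, d x * monomialAt S x = 2 * ∑ x, f x * monomialAt S x := by
    simp only [hd, sub_mul, Finset.sum_sub_distrib, h1]; ring
  rw [walshCoeff, show ∑ x, f x * monomialAt S x = 0 by linarith, zero_div]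

theorem siteDeriv_potentialValue (c : Finset (Fin n) → ℝ) (u : Fin n) (x : Cfg n) :
    siteDeriv u (potentialValue c) x
      = ∑ S with u ∈ S, c S * monomialAt (S.erase u) x := by
  rw [siteDeriv, potentialValue, potentialValue, ← Finset.sum_sub_distrib, Finset.mul_sum,
    Finset.sum_div, Finset.sum_filter]
  refine Finset.sum_congr rfl fun S _ => ?_
  split_ifs with h
  · rw [monomialAt_flipAt_of_mem h]
    have e : monomialAt S x = spin (x u) * monomialAt (S.erase u) x := by
      rw [monomialAt, monomialAt, Finset.mul_prod_erase S (fun i => spin (x i)) h]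
    rw [e]
    linear_combination (c S * monomialAt (S.erase u) x) * spin_mul_self (x u)
  · rw [monomialAt_flipAt_of_notMem h]; ring

theorem siteDeriv_potentialValue_eq_sum_powerset (c : Finset (Fin n) → ℝ) (u : Fin n)
    (A : Finset (Fin n)) (huA : u ∉ A) (hc : ∀ S, u ∈ S → ¬ S.erase u ⊆ A → c S = 0)
    (x : Cfg n) :
    siteDeriv u (potentialValue c) x
      = ∑ S ∈ A.powerset, c (insert u S) * monomialAt S x := by
  rw [siteDeriv_potentialValue]
  symm
  refine Finset.sum_of_injOn (fun S => insert u S) ?_ ?_ ?_ ?_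
  · intro S hS T hT h
    have hS' : u ∉ S := fun e => huA (Finset.mem_powerset.1 hS e)
    have hT' : u ∉ T := fun e => huA (Finset.mem_powerset.1 hT e)
    rw [← Finset.erase_insert hS', ← Finset.erase_insert hT']
    exact congrArg (fun U => Finset.erase U u) h
  · intro S _; simp
  · intro S hS hS'
    have hu : u ∈ S := (Finset.mem_filter.1 hS).2
    rw [hc S hu, zero_mul]
    intro hSA
    exact hS' ⟨S.erase u, Finset.mem_coe.2 (Finset.mem_powerset.2 hSA), Finset.insert_erase hu⟩
  · intro S hS
    have hS' : u ∉ S := fun e => huA (Finset.mem_powerset.1 hS e)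
    simp only [Finset.erase_insert hS']

/-- If every configuration has at least the fraction `σ` of the weight of itself and any of its
neighbours, then second moments of polynomials are bounded below by their coefficients. -/
theorem sum_sq_coeff_le (P : Cfg n → ℝ) (hP1 : ∑ x, P x = 1) (σ : ℝ) (hσ : 0 ≤ σ)
    (hPσ : ∀ i x, σ * (P x + P (flipAt i x)) ≤ P x) (A : Finset (Fin n)) :
    ∀ c : Finset (Fin n) → ℝ, (2 * σ) ^ A.card * ∑ S ∈ A.powerset, c S ^ 2
      ≤ ∑ x, P x * (∑ S ∈ A.powerset, c S * monomialAt S x) ^ 2 := by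
  induction A using Finset.induction_on with
  | empty =>
    intro c
    simp [monomialAt, ← Finset.sum_mul, hP1]
  | insert a A ha ih =>
    intro c
    set g : Cfg n → ℝ := fun x => ∑ S ∈ A.powerset, c S * monomialAt S x with hg
    set h : Cfg n → ℝ := fun x => ∑ S ∈ A.powerset, c (insert a S) * monomialAt S x with hh
    have hmem : ∀ S ∈ A.powerset, a ∉ S := fun S hS e => ha (Finset.mem_powerset.1 hS e)
    have hsum : ∀ x, ∑ S ∈ (insert a A).powerset, c S * monomialAt S x
        = g x + spin (x a) * h x := by
      intro x
      rw [Finset.sum_powerset_insert ha, hg, hh]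
      simp only [Finset.mul_sum]
      congr 1
      refine Finset.sum_congr rfl fun S hS => ?_
      have : monomialAt (insert a S) x = spin (x a) * monomialAt S x := by
        rw [monomialAt, Finset.prod_insert (hmem S hS), monomialAt]
      rw [this]; ring
    have hgf : ∀ x, g (flipAt a x) = g x := fun x =>
      Finset.sum_congr rfl fun S hS => by rw [monomialAt_flipAt_of_notMem (hmem S hS)]
    have hhf : ∀ x, h (flipAt a x) = h x := fun x =>
      Finset.sum_congr rfl fun S hS => by rw [monomialAt_flipAt_of_notMem (hmem S hS)]
    -- The polynomial is `g + x_a h` with `g` and `h` free of `x_a`. Replacing `P` by the smaller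
    -- weight `σ (P + P ∘ flipAt a)`, which is symmetric in the spin at `a`, kills the cross term
    -- and leaves the factor `2σ`.
    have hlow : 2 * σ * ∑ x, P x * (g x ^ 2 + h x ^ 2)
        ≤ ∑ x, P x * (g x + spin (x a) * h x) ^ 2 := by
      have e : 2 * σ * ∑ x, P x * (g x ^ 2 + h x ^ 2)
          = ∑ x, σ * (P x + P (flipAt a x)) * (g x + spin (x a) * h x) ^ 2 := by
        have e1 : ∑ x, P (flipAt a x) * (g x + spin (x a) * h x) ^ 2
            = ∑ x, P x * (g x - spin (x a) * h x) ^ 2 := by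
          conv_rhs => rw [← sum_flipAt a]
          refine Finset.sum_congr rfl fun x _ => ?_
          rw [hgf, hhf, spin_flipAt_same]; ring
        have e2 : ∑ x, σ * (P x + P (flipAt a x)) * (g x + spin (x a) * h x) ^ 2
            = σ * (∑ x, P x * (g x + spin (x a) * h x) ^ 2
              + ∑ x, P (flipAt a x) * (g x + spin (x a) * h x) ^ 2) := by
          rw [← Finset.sum_add_distrib, Finset.mul_sum]
          exact Finset.sum_congr rfl fun x _ => by ring
        rw [e2, e1, ← Finset.sum_add_distrib, mul_comm 2 σ, mul_assoc, Finset.mul_sum]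
        congr 1
        refine Finset.sum_congr rfl fun x _ => ?_
        linear_combination (-2 * P x * h x ^ 2) * spin_mul_self (x a)
      rw [e]
      exact Finset.sum_le_sum fun x _ =>
        mul_le_mul_of_nonneg_right (hPσ a x) (sq_nonneg _)
    simp only [hsum]
    refine le_trans ?_ hlow
    have hd : ∑ x, P x * (g x ^ 2 + h x ^ 2) = ∑ x, P x * g x ^ 2 + ∑ x, P x * h x ^ 2 := by
      rw [← Finset.sum_add_distrib]
      exact Finset.sum_congr rfl fun x _ => by ring
    rw [hd, Finset.card_insert_of_notMem ha, Finset.sum_powerset_insert ha, pow_succ]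
    have i1 := ih c
    have i2 := ih fun S => c (insert a S)
    have := mul_le_mul_of_nonneg_left (add_le_add i1 i2) (by linarith : 0 ≤ 2 * σ)
    refine le_trans (le_of_eq ?_) this
    ring

theorem inner_featureVec (A : Finset (Fin n)) (w : EuclideanSpace ℝ (Finset (Fin n)))
    (x : Cfg n) :
    inner ℝ w (featureVec A x)
      = ∑ S ∈ A.powerset, w S / Real.sqrt (2 ^ A.card) * monomialAt S x := by
  rw [PiLp.inner_apply, ← Finset.sum_subset (Finset.subset_univ A.powerset)]
  · refine Finset.sum_congr rfl fun S hS => ?_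
    rw [featureVec_apply, nodeFeature, if_pos (Finset.mem_powerset.1 hS)]
    simp only [RCLike.inner_apply, conj_trivial]
    ring
  · intro S _ hS
    rw [featureVec_apply, nodeFeature, if_neg (fun h => hS (Finset.mem_powerset.2 h))]
    simp

theorem norm_sq_eq_sum_powerset (A : Finset (Fin n)) (w : EuclideanSpace ℝ (Finset (Fin n)))
    (hw : ∀ S, ¬ S ⊆ A → w S = 0) : ‖w‖ ^ 2 = ∑ S ∈ A.powerset, w S ^ 2 := by
  rw [EuclideanSpace.norm_sq_eq, ← Finset.sum_subset (Finset.subset_univ A.powerset)]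
  · exact Finset.sum_congr rfl fun S _ => by rw [Real.norm_eq_abs, sq_abs]
  · intro S _ hS
    rw [hw S (fun h => hS (Finset.mem_powerset.2 h))]; simp

/-- The normalisation of the features by `2^(-|A|/2)` cancels the powers of two in
`sum_sq_coeff_le`. -/
theorem pow_card_mul_norm_sq_le (P : Cfg n → ℝ) (hP1 : ∑ x, P x = 1) (σ : ℝ) (hσ : 0 ≤ σ)
    (hPσ : ∀ i x, σ * (P x + P (flipAt i x)) ≤ P x) (A : Finset (Fin n))
    (w : EuclideanSpace ℝ (Finset (Fin n))) (hw : ∀ S, ¬ S ⊆ A → w S = 0) :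
    σ ^ A.card * ‖w‖ ^ 2 ≤ ∑ x, P x * inner ℝ w (featureVec A x) ^ 2 := by
  have h := sum_sq_coeff_le P hP1 σ hσ hPσ A fun S => w S / Real.sqrt (2 ^ A.card)
  simp only [← inner_featureVec] at h
  refine le_trans (le_of_eq ?_) h
  rw [norm_sq_eq_sum_powerset A w hw]
  simp only [div_pow, Real.sq_sqrt (show (0 : ℝ) ≤ 2 ^ A.card by positivity), ← Finset.sum_div,
    mul_pow]
  field_simp

/-- The weight vector of the logistic regression for the spin at `u` under `gibbs q`. -/
noncomputable def targetVec (q : Cfg n → ℝ) (u : Fin n) (A : Finset (Fin n)) :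
    EuclideanSpace ℝ (Finset (Fin n)) :=
  WithLp.toLp 2 fun S =>
    if S ⊆ A then Real.sqrt (2 ^ A.card) * walshCoeff q (insert u S) else 0

theorem targetVec_apply (q : Cfg n → ℝ) (u : Fin n) (A S : Finset (Fin n)) :
    targetVec q u A S
      = if S ⊆ A then Real.sqrt (2 ^ A.card) * walshCoeff q (insert u S) else 0 := rfl

theorem targetVec_apply_eq_zero (q : Cfg n → ℝ) (u : Fin n) (A S : Finset (Fin n))
    (h : ¬ S ⊆ A) : targetVec q u A S = 0 := by rw [targetVec_apply, if_neg h]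

theorem inner_targetVec (q : Cfg n → ℝ) (u : Fin n) (A : Finset (Fin n)) (huA : u ∉ A)
    (hq : ∀ S, u ∈ S → ¬ S.erase u ⊆ A → walshCoeff q S = 0) (x : Cfg n) :
    inner ℝ (targetVec q u A) (featureVec A x) = siteDeriv u q x := by
  conv_rhs => rw [← potentialValue_walshCoeff q]
  rw [siteDeriv_potentialValue_eq_sum_powerset _ u A huA hq, inner_featureVec]
  refine Finset.sum_congr rfl fun S hS => ?_
  rw [targetVec_apply, if_pos (Finset.mem_powerset.1 hS)]
  have : Real.sqrt (2 ^ A.card) ≠ 0 := by positivity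
  field_simp

/-- This is Parseval's identity in disguise: the second moment bound for the uniform measure, where
`σ = 1/2`, combined with the bound `β` on the local field. -/
theorem norm_targetVec_le (q : Cfg n → ℝ) (u : Fin n) (A : Finset (Fin n)) (huA : u ∉ A)
    (hq : ∀ S, u ∈ S → ¬ S.erase u ⊆ A → walshCoeff q S = 0) (β : ℝ)
    (hβ : ∀ x, |siteDeriv u q x| ≤ β) :
    ‖targetVec q u A‖ ≤ β * Real.sqrt (2 ^ A.card) := by
  have hβ0 : 0 ≤ β := (abs_nonneg _).trans (hβ fun _ => true)
  have h := pow_card_mul_norm_sq_le (gibbs fun _ : Cfg n => (0 : ℝ)) (sum_gibbs _) (1 / 2)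
    (by norm_num) (fun i x => by simp only [gibbs]; linarith) A (targetVec q u A)
    (targetVec_apply_eq_zero q u A)
  have h2 : ∑ x, gibbs (fun _ : Cfg n => (0 : ℝ)) x
      * inner ℝ (targetVec q u A) (featureVec A x) ^ 2 ≤ β ^ 2 := by
    refine sum_mul_le_of_le _ _ (fun x => (gibbs_pos _ x).le) (sum_gibbs _) _ fun x => ?_
    rw [inner_targetVec q u A huA hq, ← sq_abs]
    exact pow_le_pow_left₀ (abs_nonneg _) (hβ x) 2
  have h3 : ‖targetVec q u A‖ ^ 2 ≤ (β * Real.sqrt (2 ^ A.card)) ^ 2 := by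
    rw [mul_pow, Real.sq_sqrt (by positivity)]
    have h4 := h.trans h2
    rw [one_div, inv_pow] at h4
    rwa [inv_mul_le_iff₀ (by positivity), mul_comm] at h4
  exact (abs_le_of_sq_le_sq' h3 (by positivity)).2

/-- Cauchy–Schwarz over the `2^|A|` subsets. The loss equals the normalisation of the features, so
`ℓ_1` errors of polynomial coefficients cost nothing. -/
theorem sum_abs_div_sqrt_le_norm (A : Finset (Fin n)) (w : EuclideanSpace ℝ (Finset (Fin n)))
    (hw : ∀ S, ¬ S ⊆ A → w S = 0) : ∑ S, |w S| / Real.sqrt (2 ^ A.card) ≤ ‖w‖ := by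
  have h0 : ∑ S, |w S| = ∑ S ∈ A.powerset, |w S| := by
    symm
    refine Finset.sum_subset (Finset.subset_univ _) fun S _ hS => ?_
    rw [hw S (fun h => hS (Finset.mem_powerset.2 h)), abs_zero]
  rw [← Finset.sum_div, h0, div_le_iff₀ (by positivity)]
  have h1 : (∑ S ∈ A.powerset, |w S|) ^ 2 ≤ (‖w‖ * Real.sqrt (2 ^ A.card)) ^ 2 := by
    rw [mul_pow, Real.sq_sqrt (by positivity), norm_sq_eq_sum_powerset A w hw]
    have := sq_sum_le_card_mul_sum_sq (s := A.powerset) (f := fun S => |w S|)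
    simp only [Finset.card_powerset, sq_abs] at this
    push_cast at this
    linarith
  exact (abs_le_of_sq_le_sq' h1 (by positivity)).2

end walsh

/-! ### The potential of a restricted Boltzmann machine -/

section rbm

variable {n m : ℕ} (R : RBM n m)

/-- The potential of the marginal distribution of the visible nodes. -/
noncomputable def RBM.potential (x : Cfg n) : ℝ := Real.log (∑ y, R.weight x y)

theorem RBM.sum_weight_pos (x : Cfg n) : 0 < ∑ y, R.weight x y :=
  Finset.sum_pos (fun _ _ => Real.exp_pos _) Finset.univ_nonempty

theorem RBM.marginal_eq_gibbs : R.marginal = gibbs R.potential := by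
  funext x
  simp only [RBM.marginal, RBM.joint, gibbs, RBM.potential, Real.exp_log (R.sum_weight_pos _),
    ← Finset.sum_div]
  rfl

theorem sum_mul_spin_flipAt (f : Fin n → ℝ) (u : Fin n) (x : Cfg n) :
    ∑ i, f i * spin (flipAt u x i) = ∑ i, f i * spin (x i) - 2 * (f u * spin (x u)) := by
  rw [← Finset.add_sum_erase _ _ (Finset.mem_univ u), ← Finset.add_sum_erase _ _
    (Finset.mem_univ u), spin_flipAt_same]
  have : ∑ i ∈ Finset.univ.erase u, f i * spin (flipAt u x i)
      = ∑ i ∈ Finset.univ.erase u, f i * spin (x i) :=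
    Finset.sum_congr rfl fun i hi => by rw [flipAt_ne (Finset.ne_of_mem_erase hi)]
  rw [this]; ring

theorem RBM.potential_le_potential_flipAt (α β : ℝ) (hR : R.Nondegenerate α β) (u : Fin n)
    (x : Cfg n) : R.potential x ≤ R.potential (flipAt u x) + 2 * β := by
  have h1 : ∀ y, R.weight x y ≤ Real.exp (2 * β) * R.weight (flipAt u x) y := by
    intro y
    rw [RBM.weight, RBM.weight, ← Real.exp_add, Real.exp_le_exp]
    have e1 : ∀ x : Cfg n, ∑ i, ∑ j, spin (x i) * R.J i j * spin (y j)
        = ∑ i, (∑ j, R.J i j * spin (y j)) * spin (x i) := by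
      intro x
      refine Finset.sum_congr rfl fun i _ => ?_
      rw [Finset.sum_mul]
      exact Finset.sum_congr rfl fun j _ => by ring
    rw [e1, e1, sum_mul_spin_flipAt, sum_mul_spin_flipAt]
    have h2 : |(∑ j, R.J u j * spin (y j)) * spin (x u)| ≤ ∑ j, |R.J u j| := by
      rw [abs_mul, abs_spin, mul_one]
      refine (Finset.abs_sum_le_sum_abs _ _).trans (Finset.sum_le_sum fun j _ => ?_)
      rw [abs_mul, abs_spin, mul_one]
    have h3 : |R.h u * spin (x u)| ≤ |R.h u| := by rw [abs_mul, abs_spin, mul_one]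
    have h4 := hR.2.1 u
    have := le_abs_self ((∑ j, R.J u j * spin (y j)) * spin (x u))
    have := le_abs_self (R.h u * spin (x u))
    linarith
  have h2 : ∑ y, R.weight x y ≤ Real.exp (2 * β) * ∑ y, R.weight (flipAt u x) y := by
    rw [Finset.mul_sum]; exact Finset.sum_le_sum fun y _ => h1 y
  have h3 := Real.log_le_log (R.sum_weight_pos x) h2
  rw [Real.log_mul (Real.exp_pos _).ne' (R.sum_weight_pos _).ne', Real.log_exp] at h3
  rw [RBM.potential, RBM.potential]
  linarith

theorem RBM.abs_potential_sub_le (α β : ℝ) (hR : R.Nondegenerate α β) (u : Fin n) (x : Cfg n) :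
    |R.potential x - R.potential (flipAt u x)| ≤ 2 * β := by
  have h1 := R.potential_le_potential_flipAt α β hR u x
  have h2 := R.potential_le_potential_flipAt α β hR u (flipAt u x)
  rw [flipAt_flipAt] at h2
  rw [abs_le]; constructor <;> linarith

/-- Given the visible nodes, the hidden ones are independent, so their sum factorises. -/
theorem RBM.potential_eq (x : Cfg n) :
    R.potential x = ∑ i, R.h i * spin (x i)
      + ∑ j, Real.log (∑ b : Bool, Real.exp ((∑ i, R.J i j * spin (x i) + R.g j) * spin b)) := by
  have h : ∑ y, R.weight x y = Real.exp (∑ i, R.h i * spin (x i))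
      * ∏ j, ∑ b : Bool, Real.exp ((∑ i, R.J i j * spin (x i) + R.g j) * spin b) := by
    rw [Finset.prod_univ_sum, Finset.mul_sum, Fintype.piFinset_univ]
    refine Finset.sum_congr rfl fun y _ => ?_
    rw [← Real.exp_sum, ← Real.exp_add, RBM.weight]
    congr 1
    simp only [add_mul, Finset.sum_add_distrib]
    have : ∑ i, ∑ j, spin (x i) * R.J i j * spin (y j)
        = ∑ j, (∑ i, R.J i j * spin (x i)) * spin (y j) := by
      rw [Finset.sum_comm]
      refine Finset.sum_congr rfl fun j _ => ?_
      rw [Finset.sum_mul]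
      exact Finset.sum_congr rfl fun i _ => by ring
    rw [this]; ring
  have hpos : ∀ j, 0 < ∑ b : Bool, Real.exp ((∑ i, R.J i j * spin (x i) + R.g j) * spin b) :=
    fun j => Finset.sum_pos (fun _ _ => Real.exp_pos _) Finset.univ_nonempty
  rw [RBM.potential, h, Real.log_mul (Real.exp_pos _).ne'
    (Finset.prod_pos fun j _ => hpos j).ne', Real.log_exp,
    Real.log_prod fun j _ => (hpos j).ne']

/-- No hidden unit is connected to both `u` and `v`, so each summand of `RBM.potential_eq` depends
on at most one of the two spins and the mixed difference vanishes. -/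
theorem RBM.siteDeriv_potential_flipAt (u v : Fin n) (huv : v ≠ u) (hv : v ∉ R.twoHop u)
    (x : Cfg n) : siteDeriv u R.potential (flipAt v x) = siteDeriv u R.potential x := by
  have hJ : ∀ j, R.J u j = 0 ∨ R.J v j = 0 := by
    intro j
    by_contra hcon
    push Not at hcon
    exact hv (by simp only [RBM.twoHop, Finset.mem_filter]; exact ⟨Finset.mem_univ _, huv, j, hcon⟩)
  have hx : flipAt v x u = x u := flipAt_ne huv.symm x
  rw [siteDeriv, siteDeriv, hx]
  congr 2
  simp only [RBM.potential_eq, sum_mul_spin_flipAt, hx]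
  have key : ∀ j,
      Real.log (∑ b : Bool, Real.exp ((∑ i, R.J i j * spin (x i) - 2 * (R.J v j * spin (x v))
        + R.g j) * spin b))
      - Real.log (∑ b : Bool, Real.exp ((∑ i, R.J i j * spin (x i) - 2 * (R.J v j * spin (x v))
        - 2 * (R.J u j * spin (x u)) + R.g j) * spin b))
      = Real.log (∑ b : Bool, Real.exp ((∑ i, R.J i j * spin (x i) + R.g j) * spin b))
      - Real.log (∑ b : Bool, Real.exp ((∑ i, R.J i j * spin (x i)
        - 2 * (R.J u j * spin (x u)) + R.g j) * spin b)) := by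
    intro j
    rcases hJ j with h | h <;> simp [h]
  have hsum := Finset.sum_congr rfl fun j (_ : j ∈ Finset.univ) => key j
  simp only [Finset.sum_sub_distrib] at hsum
  linarith

theorem RBM.notMem_twoHop_self (u : Fin n) : u ∉ R.twoHop u := by
  simp [RBM.twoHop]

theorem RBM.mem_twoHop_comm (u v : Fin n) : v ∈ R.twoHop u ↔ u ∈ R.twoHop v := by
  simp only [RBM.twoHop, Finset.mem_filter, Finset.mem_univ, true_and]
  constructor <;> rintro ⟨h, k, h1, h2⟩ <;> exact ⟨h.symm, k, h2, h1⟩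

theorem RBM.card_twoHop_le (u : Fin n) : (R.twoHop u).card ≤ R.twoHopDegree :=
  Finset.le_sup (f := fun i => (R.twoHop i).card) (Finset.mem_univ u)

theorem RBM.walshCoeff_potential_eq_zero (u : Fin n) (S : Finset (Fin n)) (hu : u ∈ S)
    (hS : ¬ S.erase u ⊆ R.twoHop u) : walshCoeff R.potential S = 0 := by
  obtain ⟨v, hv, hv'⟩ := Finset.not_subset.1 hS
  exact walshCoeff_eq_zero _ u v (Finset.ne_of_mem_erase hv)
    (R.siteDeriv_potential_flipAt u v (Finset.ne_of_mem_erase hv) hv') S hu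
    (Finset.mem_of_mem_erase hv)

/-- A flip changes the weight by a factor of at most `exp (2β)`, so each value of a spin has
conditional probability at least `1 / (1 + exp (2β))`. -/
theorem sigmoid_mul_gibbs_add_le (q : Cfg n → ℝ) (β : ℝ)
    (hq : ∀ i x, |q x - q (flipAt i x)| ≤ 2 * β) (i : Fin n) (x : Cfg n) :
    Real.sigmoid (-2 * β) * (gibbs q x + gibbs q (flipAt i x)) ≤ gibbs q x := by
  have h1 : Real.exp (q (flipAt i x)) ≤ Real.exp (2 * β) * Real.exp (q x) := by
    rw [← Real.exp_add, Real.exp_le_exp]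
    have := (abs_le.1 (hq i x)).1
    linarith
  have hZ := sum_exp_pos q
  rw [Real.sigmoid_def, gibbs, gibbs, ← add_div, ← mul_div_assoc]
  apply div_le_div_of_nonneg_right _ hZ.le
  rw [inv_mul_le_iff₀ (by positivity)]
  have : -(-2 * β) = 2 * β := by ring
  rw [this]
  linarith

end rbm

/-! ### Perturbed distributions -/

section noise

variable {n : ℕ}

theorem nodeFeature_flipAt (A : Finset (Fin n)) (u : Fin n) (hu : u ∉ A) (x : Cfg n)
    (S : Finset (Fin n)) : nodeFeature A (flipAt u x) S = nodeFeature A x S := by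
  rw [nodeFeature, nodeFeature]
  split_ifs with h
  · rw [monomialAt_flipAt_of_notMem fun e => hu (h e)]
  · rfl

/-- The gradient of the logistic regression at the target vanishes in expectation. -/
theorem sum_gibbs_smul_gradient (q : Cfg n → ℝ) (u : Fin n) (A : Finset (Fin n)) (hu : u ∉ A) :
    ∑ x, gibbs q x • ((spin (x u) - Real.tanh (siteDeriv u q x)) • featureVec A x) = 0 := by
  ext S
  have := sum_gibbs_spin_sub_tanh q u (fun x => nodeFeature A x S)
    (fun x => nodeFeature_flipAt A u hu x S)
  simpa using this

theorem abs_spin_sub_tanh_le (b : Bool) (a : ℝ) : |spin b - Real.tanh a| ≤ 2 := by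
  refine (abs_sub _ _).trans ?_
  rw [abs_spin]
  linarith [abs_tanh_le_one a]

theorem norm_sum_smul_gradient_le_of_dist (q P : Cfg n → ℝ) (u : Fin n) (A : Finset (Fin n))
    (hu : u ∉ A) (η : ℝ) (hη : ∑ x, |P x - gibbs q x| ≤ η) :
    ‖∑ x, P x • ((spin (x u) - Real.tanh (siteDeriv u q x)) • featureVec A x)‖ ≤ 2 * η := by
  rw [← sub_zero (∑ x, _ • _), ← sum_gibbs_smul_gradient q u A hu, ← Finset.sum_sub_distrib]
  calc _ ≤ ∑ x, ‖P x • ((spin (x u) - Real.tanh (siteDeriv u q x)) • featureVec A x)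
        - gibbs q x • ((spin (x u) - Real.tanh (siteDeriv u q x)) • featureVec A x)‖ :=
        norm_sum_le _ _
    _ ≤ ∑ x, |P x - gibbs q x| * 2 := by
        refine Finset.sum_le_sum fun x _ => ?_
        rw [← sub_smul, norm_smul, norm_smul, norm_featureVec, mul_one, Real.norm_eq_abs,
          Real.norm_eq_abs]
        exact mul_le_mul_of_nonneg_left (abs_spin_sub_tanh_le _ _) (abs_nonneg _)
    _ ≤ 2 * η := by rw [← Finset.sum_mul]; linarith

theorem half_pow_mul_norm_sq_le_of_dist (p P : Cfg n → ℝ) (A : Finset (Fin n))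
    (w : EuclideanSpace ℝ (Finset (Fin n))) (lam η : ℝ)
    (h : lam * ‖w‖ ^ 2 ≤ ∑ x, p x * inner ℝ w (featureVec A x) ^ 2)
    (hη : ∑ x, |P x - p x| ≤ η) :
    (lam - η) * ‖w‖ ^ 2 ≤ ∑ x, P x * inner ℝ w (featureVec A x) ^ 2 := by
  have h1 : ∑ x, p x * inner ℝ w (featureVec A x) ^ 2
      ≤ ∑ x, P x * inner ℝ w (featureVec A x) ^ 2 + ∑ x, |P x - p x| * ‖w‖ ^ 2 := by
    rw [← Finset.sum_add_distrib]
    refine Finset.sum_le_sum fun x _ => ?_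
    have h2 : inner ℝ w (featureVec A x) ^ 2 ≤ ‖w‖ ^ 2 := by
      rw [← sq_abs]
      refine pow_le_pow_left₀ (abs_nonneg _) ?_ 2
      have := abs_real_inner_le_norm w (featureVec A x)
      rwa [norm_featureVec, mul_one] at this
    have h3 := mul_le_mul_of_nonneg_left h2 (abs_nonneg (P x - p x))
    have h4 := mul_le_mul_of_nonneg_right (neg_le_abs (P x - p x))
      (sq_nonneg (inner ℝ w (featureVec A x)))
    linarith
  rw [← Finset.sum_mul] at h1
  have h2 := mul_le_mul_of_nonneg_right hη (sq_nonneg ‖w‖)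
  linarith

/-! ### Perturbation in `L_p` -/

/-- The power mean inequality over the `2^n` configurations. -/
theorem sum_abs_le_of_magnitudeDist {m : ℕ} (R : RBM n m) (ψ : QubitSpace n) (p ε : ℝ)
    (hp : 1 ≤ p) (h : LpAssociated p ε ψ R) :
    ∑ x, |‖ψ x‖ ^ 2 - R.marginal x| ≤ (2 : ℝ) ^ ((n : ℝ) * (1 - 1 / p)) * ε := by
  have hm0 : ∀ x, 0 ≤ R.marginal x := fun x => by
    rw [R.marginal_eq_gibbs]; exact (gibbs_pos _ x).le
  have hstate : ∀ x, ‖R.state x‖ ^ 2 = R.marginal x := by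
    intro x
    simp only [RBM.state]
    rw [Complex.norm_real, Real.norm_eq_abs, sq_abs, Real.sq_sqrt (hm0 x)]
  have hp0 : 0 < p := by linarith
  have h1 := Real.rpow_sum_le_const_mul_sum_rpow (s := Finset.univ) 
    (f := fun x : Cfg n => ‖R.state x‖ ^ 2 - ‖ψ x‖ ^ 2) hp
  have hd := h.2
  rw [magnitudeDist] at hd
  have hS0 : 0 ≤ ∑ x : Cfg n, |‖R.state x‖ ^ 2 - ‖ψ x‖ ^ 2| :=
    Finset.sum_nonneg fun _ _ => abs_nonneg _
  have hT0 : 0 ≤ ∑ x : Cfg n, |‖R.state x‖ ^ 2 - ‖ψ x‖ ^ 2| ^ p :=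
    Finset.sum_nonneg fun _ _ => by positivity
  have h2 := Real.rpow_le_rpow (by positivity) h1 (by positivity : 0 ≤ 1 / p)
  rw [← Real.rpow_mul hS0, mul_one_div_cancel hp0.ne', Real.rpow_one,
    Real.mul_rpow (by positivity) hT0] at h2
  have hcard : ((Finset.univ : Finset (Cfg n)).card : ℝ) = (2 : ℝ) ^ (n : ℝ) := by
    rw [Finset.card_univ, Real.rpow_natCast]; simp
  have h3 : (((Finset.univ : Finset (Cfg n)).card : ℝ) ^ (p - 1)) ^ (1 / p)
      = (2 : ℝ) ^ ((n : ℝ) * (1 - 1 / p)) := by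
    rw [hcard, ← Real.rpow_mul (by norm_num), ← Real.rpow_mul (by norm_num)]
    congr 1
    field_simp
  rw [h3] at h2
  calc ∑ x, |‖ψ x‖ ^ 2 - R.marginal x| = ∑ x : Cfg n, |‖R.state x‖ ^ 2 - ‖ψ x‖ ^ 2| :=
        Finset.sum_congr rfl fun x _ => by rw [hstate, abs_sub_comm]
    _ ≤ _ := h2
    _ ≤ _ := mul_le_mul_of_nonneg_left hd (by positivity)

/-! ### Perturbation by coherent bit flips -/

/-- The product weight of a configuration `x` relative to `z`. -/
noncomputable def flipWeight (a : ℝ) (c : Fin n → ℝ) (z x : Cfg n) : ℝ :=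
  ∏ i, (if z i = x i then a else c i)

theorem flipWeight_nonneg {a : ℝ} {c : Fin n → ℝ} (ha : 0 ≤ a) (hc : ∀ i, 0 ≤ c i)
    (z x : Cfg n) : 0 ≤ flipWeight a c z x :=
  Finset.prod_nonneg fun i _ => by split_ifs; exacts [ha, hc i]

theorem sum_flipWeight (a : ℝ) (c : Fin n → ℝ) (z : Cfg n) :
    ∑ x, flipWeight a c z x = ∏ i, (a + c i) := by
  have h := Finset.prod_univ_sum (fun _ : Fin n => (Finset.univ : Finset Bool))
    (fun i b => if z i = b then a else c i)
  rw [Fintype.piFinset_univ] at h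
  simp only [flipWeight]
  rw [← h]
  refine Finset.prod_congr rfl fun i _ => ?_
  cases z i <;> simp [add_comm]

theorem flipWeight_flipAt (a : ℝ) (c : Fin n → ℝ) (u : Fin n) (z x : Cfg n) :
    flipWeight a c (flipAt u z) (flipAt u x) = flipWeight a c z x := by
  refine Finset.prod_congr rfl fun i _ => ?_
  by_cases h : i = u
  · subst h; simp
  · rw [flipAt_ne h, flipAt_ne h]

/-- The amplitude after coherent bit flips, relative to the amplitude before. -/
noncomputable def flipRatio (q : Cfg n → ℝ) (a b : ℝ) (z : Cfg n) : ℝ :=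
  ∑ x, Real.exp ((q x - q z) / 2) * flipWeight a (fun _ => b) z x

section ratio

variable (q : Cfg n → ℝ) (β a b : ℝ) (hq : ∀ i x, |q x - q (flipAt i x)| ≤ 2 * β)

theorem pow_le_flipRatio (ha : 0 ≤ a) (hb : 0 ≤ b) (z : Cfg n) : a ^ n ≤ flipRatio q a b z := by
  have h : Real.exp ((q z - q z) / 2) * flipWeight a (fun _ => b) z z = a ^ n := by
    simp [flipWeight]
  rw [← h, flipRatio]
  exact Finset.single_le_sum (f := fun x => Real.exp ((q x - q z) / 2)
    * flipWeight a (fun _ => b) z x)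
    (fun x _ => mul_nonneg (Real.exp_pos _).le (flipWeight_nonneg ha (fun _ => hb) z x))
    (Finset.mem_univ z)

include hq in
-- Each spin in which `x` and `z` differ changes `q / 2` by at most `β`, so the amplitude ratio is
-- absorbed by enlarging the flip amplitude from `b` to `b exp β`.
theorem exp_mul_flipWeight_le (ha : 0 ≤ a) (hb : 0 ≤ b) (z x : Cfg n) :
    Real.exp ((q x - q z) / 2) * flipWeight a (fun _ => b) z x
      ≤ flipWeight a (fun _ => b * Real.exp β) z x := by
  have h1 := abs_sub_le_sum_of_flipAt q (fun _ => 2 * β) hq z (Finset.univ.filter fun i => z i ≠ x i)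
    x (fun i hi => by simpa using (Eq.symm (by simpa using hi)))
  have h2 : Real.exp ((q x - q z) / 2) ≤ ∏ i, (if z i = x i then 1 else Real.exp β) := by
    have e : ∏ i, (if z i = x i then 1 else Real.exp β)
        = Real.exp (∑ i ∈ Finset.univ.filter fun i => z i ≠ x i, β) := by
      rw [Real.exp_sum, Finset.prod_filter]
      refine Finset.prod_congr rfl fun i _ => ?_
      by_cases h : z i = x i <;> simp [h]
    rw [e, Real.exp_le_exp]
    rw [← Finset.mul_sum] at h1
    linarith [le_abs_self (q x - q z)]
  calc _ ≤ (∏ i, (if z i = x i then 1 else Real.exp β)) * flipWeight a (fun _ => b) z x :=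
        mul_le_mul_of_nonneg_right h2 (flipWeight_nonneg ha (fun _ => hb) z x)
    _ = _ := by
        rw [flipWeight, flipWeight, ← Finset.prod_mul_distrib]
        refine Finset.prod_congr rfl fun i _ => ?_
        split_ifs <;> ring

include hq in
theorem flipRatio_le (ha : 0 ≤ a) (hb : 0 ≤ b) (z : Cfg n) :
    flipRatio q a b z ≤ (a + b * Real.exp β) ^ n := by
  calc flipRatio q a b z ≤ ∑ x, flipWeight a (fun _ => b * Real.exp β) z x :=
        Finset.sum_le_sum fun x _ => exp_mul_flipWeight_le q β a b hq ha hb z x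
    _ = _ := by rw [sum_flipWeight]; simp

include hq in
-- Flipping `u` in `z` and in the summation variable `x` simultaneously leaves every term unchanged
-- in which `x` and `z` agree on `u` and `A`, as the local field at `u` sees only `A`. What remains
-- is the total weight of flip patterns that touch `insert u A`.
theorem abs_flipRatio_sub_le (ha : 0 ≤ a) (hb : 0 ≤ b) (u : Fin n) (A : Finset (Fin n))
    (huA : u ∉ A) (hA : ∀ S, u ∈ S → ¬ S.erase u ⊆ A → walshCoeff q S = 0) (z : Cfg n) :
    |flipRatio q a b z - flipRatio q a b (flipAt u z)|
      ≤ (a + b * Real.exp β) ^ n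
        - a ^ (A.card + 1) * (a + b * Real.exp β) ^ (n - (A.card + 1)) := by
  classical
  have hbe : 0 ≤ b * Real.exp β := by positivity
  -- Flip weights that vanish on `insert u A` single out the configurations agreeing with `z` there,
  -- and still have a product formula for their sum.
  set c : Fin n → ℝ := fun i => if i ∈ insert u A then 0 else b * Real.exp β with hc
  have hlocal : ∀ x : Cfg n, (∀ i ∈ insert u A, z i = x i) →
      q x - q z = q (flipAt u x) - q (flipAt u z) := by
    intro x hx
    have h1 : siteDeriv u q x = siteDeriv u q z := by
      rw [← potentialValue_walshCoeff q, siteDeriv_potentialValue_eq_sum_powerset _ u A huA hA,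
        siteDeriv_potentialValue_eq_sum_powerset _ u A huA hA]
      refine Finset.sum_congr rfl fun S hS => ?_
      congr 1
      refine Finset.prod_congr rfl fun i hi => ?_
      rw [hx i (Finset.mem_insert_of_mem (Finset.mem_powerset.1 hS hi))]
    have h2 := sub_flipAt_eq u q x
    have h3 := sub_flipAt_eq u q z
    rw [h1, ← hx u (Finset.mem_insert_self _ _), ← h3] at h2
    linarith
  have hsub : flipRatio q a b (flipAt u z)
      = ∑ x, Real.exp ((q (flipAt u x) - q (flipAt u z)) / 2)
        * flipWeight a (fun _ => b) z x := by
    rw [flipRatio, ← sum_flipAt u]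
    exact Finset.sum_congr rfl fun x _ => by rw [flipWeight_flipAt]
  have hterm : ∀ x, |Real.exp ((q x - q z) / 2) * flipWeight a (fun _ => b) z x
      - Real.exp ((q (flipAt u x) - q (flipAt u z)) / 2) * flipWeight a (fun _ => b) z x|
      ≤ flipWeight a (fun _ => b * Real.exp β) z x - flipWeight a c z x := by
    intro x
    have hw := flipWeight_nonneg (n := n) ha (fun _ => hb) z x
    by_cases hx : ∀ i ∈ insert u A, z i = x i
    · rw [hlocal x hx, sub_self, abs_zero, sub_nonneg]
      refine Finset.prod_le_prod (fun i _ => ?_) (fun i _ => ?_)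
      · split_ifs
        · exact ha
        · simp only [hc]; split_ifs <;> positivity
      · split_ifs
        · exact le_rfl
        · simp only [hc]; split_ifs
          · exact hbe
          · exact le_rfl
    · have h0 : flipWeight a c z x = 0 := by
        push Not at hx
        obtain ⟨i, hi, hne⟩ := hx
        apply Finset.prod_eq_zero (Finset.mem_univ i)
        rw [if_neg hne]
        simp only [hc, if_pos hi]
      rw [h0, sub_zero]
      have h1 := exp_mul_flipWeight_le q β a b hq ha hb z x
      have h2 := exp_mul_flipWeight_le q β a b hq ha hb (flipAt u z) (flipAt u x)
      rw [flipWeight_flipAt, flipWeight_flipAt] at h2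
      exact abs_sub_le_of_nonneg_of_le (mul_nonneg (Real.exp_pos _).le hw) h1
        (mul_nonneg (Real.exp_pos _).le hw) h2
  rw [hsub, flipRatio, ← Finset.sum_sub_distrib]
  refine (Finset.abs_sum_le_sum_abs _ _).trans ((Finset.sum_le_sum fun x _ => hterm x).trans ?_)
  rw [Finset.sum_sub_distrib, sum_flipWeight, sum_flipWeight, Finset.prod_const, Finset.card_univ,
    Fintype.card_fin]
  apply le_of_eq
  congr 1
  rw [← Finset.prod_mul_prod_compl (insert u A)]
  have e1 : ∏ i ∈ insert u A, (a + c i) = a ^ (A.card + 1) := by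
    rw [← Finset.card_insert_of_notMem huA]
    refine Finset.prod_eq_pow_card fun i hi => ?_
    simp only [hc, if_pos hi, add_zero]
  have e2 : ∏ i ∈ (insert u A)ᶜ, (a + c i)
      = (a + b * Real.exp β) ^ (n - (A.card + 1)) := by
    rw [Finset.prod_eq_pow_card (b := a + b * Real.exp β), Finset.card_compl, Fintype.card_fin,
      Finset.card_insert_of_notMem huA]
    intro i hi
    simp only [hc, if_neg (Finset.mem_compl.1 hi)]
  rw [e1, e2]

end ratio

theorem exp_le_one_add_two_mul {y : ℝ} (h0 : 0 ≤ y) (h1 : y ≤ 1 / 2) :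
    Real.exp y ≤ 1 + 2 * y := by
  refine (Real.exp_bound_div_one_sub_of_interval h0 (by linarith)).trans ?_
  rw [div_le_iff₀ (by linarith)]
  nlinarith

theorem one_add_pow_le {θ : ℝ} (k : ℕ) (h0 : 0 ≤ θ) (h1 : k * θ ≤ 1 / 2) :
    (1 + θ) ^ k ≤ 1 + 2 * (k * θ) := by
  refine le_trans ?_ (exp_le_one_add_two_mul (by positivity) h1)
  rw [Real.exp_nat_mul]
  exact pow_le_pow_left₀ (by positivity) (by linarith [Real.add_one_le_exp θ]) k

theorem abs_log_sub_log_le {x y m : ℝ} (hm : 0 < m) (hx : m ≤ x) (hy : m ≤ y) :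
    |Real.log x - Real.log y| ≤ |x - y| / m := by
  have key : ∀ x y : ℝ, m ≤ x → m ≤ y → Real.log x - Real.log y ≤ |x - y| / m := by
    intro x y hx hy
    have hx0 := hm.trans_le hx
    have hy0 := hm.trans_le hy
    rw [← Real.log_div hx0.ne' hy0.ne']
    calc Real.log (x / y) ≤ x / y - 1 := Real.log_le_sub_one_of_pos (by positivity)
      _ = (x - y) / y := by field_simp
      _ ≤ |x - y| / y := by gcongr; exact le_abs_self _
      _ ≤ |x - y| / m := by gcongr
  rw [abs_le]
  have h1 := key x y hx hy
  have h2 := key y x hy hx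
  rw [abs_sub_comm] at h2
  constructor <;> linarith

/-- The effect of coherent bit flips on the measurement outcomes: the distribution changes by a
factor `1 + O(n θ)`, and the conditional means of the spins change by `O(d θ)`. -/
theorem flipAssociated_bounds {m : ℕ} (R : RBM n m) (α β ρ : ℝ)
    (hR : R.Nondegenerate α β) (ψ : QubitSpace n) (hψ : FlipAssociated ρ ψ R) (hρ : ρ ≤ 1 / 2)
    (θ : ℝ) (hθ : Real.sqrt (2 * ρ) * Real.exp β ≤ θ) (hnθ : n * θ ≤ 1 / 4) :
    ‖ψ‖ = 1 ∧ (∀ x, R.marginal x / 2 ≤ ‖ψ x‖ ^ 2) ∧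
    (∑ x, |‖ψ x‖ ^ 2 - R.marginal x| ≤ 4 * (n * θ)) ∧
    ∀ u, ‖∑ x, (‖ψ x‖ ^ 2) • ((spin (x u) - Real.tanh (siteDeriv u R.potential x))
      • featureVec (R.twoHop u) x)‖ ≤ 3 * ((((R.twoHop u).card : ℝ) + 1) * θ) := by
  obtain ⟨r, hr0, hr1, hrρ, hψr⟩ := hψ
  set q := R.potential with hq_def
  have hq : ∀ i x, |q x - q (flipAt i x)| ≤ 2 * β := R.abs_potential_sub_le α β hR
  set a := Real.sqrt (1 - r) with ha_def
  set b := Real.sqrt r with hb_def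
  have ha : 0 < a := Real.sqrt_pos.2 (by linarith)
  have hb : 0 ≤ b := Real.sqrt_nonneg _
  have hbe : b * Real.exp β ≤ a * θ := by
    -- As `r ≤ ρ ≤ 1/2`, the factor `1 - r` is at least `1/2`, so `r ≤ 2ρ (1 - r)`.
    have h1 : b ≤ a * Real.sqrt (2 * ρ) := by
      rw [hb_def, ha_def, ← Real.sqrt_mul (by linarith)]
      apply Real.sqrt_le_sqrt
      nlinarith
    calc b * Real.exp β ≤ a * Real.sqrt (2 * ρ) * Real.exp β := by gcongr
      _ = a * (Real.sqrt (2 * ρ) * Real.exp β) := by ring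
      _ ≤ a * θ := by gcongr
  have hθ0 : 0 ≤ θ := le_trans (by positivity) hθ
  have hab : a + b * Real.exp β ≤ a * (1 + θ) := by linarith
  have hab0 : 0 ≤ a + b * Real.exp β := by positivity
  have han : 0 < a ^ n := by positivity
  set G := flipRatio q a b with hG
  have hG1 : ∀ z, a ^ n ≤ G z := fun z => pow_le_flipRatio q a b ha.le hb z
  have hG0 : ∀ z, 0 < G z := fun z => han.trans_le (hG1 z)
  have hG2 : ∀ z, G z ≤ a ^ n * (1 + θ) ^ n := fun z => by
    rw [← mul_pow]
    exact (flipRatio_le q β a b hq ha.le hb z).trans (pow_le_pow_left₀ hab0 hab n)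
  set p := R.marginal with hp_def
  have hp : p = gibbs q := R.marginal_eq_gibbs
  have hp0 : ∀ x, 0 < p x := fun x => by rw [hp]; exact gibbs_pos q x
  have hp1 : ∑ x, p x = 1 := by rw [hp]; exact sum_gibbs q
  have hsqrt : ∀ x z, Real.sqrt (p x) = Real.sqrt (p z) * Real.exp ((q x - q z) / 2) := by
    intro x z
    have hZ := sum_exp_pos q
    have e : p x = p z * Real.exp ((q x - q z) / 2) ^ 2 := by
      rw [hp, gibbs, gibbs, ← Real.exp_nat_mul]
      have : q x = q z + ((2 : ℕ) : ℝ) * ((q x - q z) / 2) := by push_cast; ring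
      conv_lhs => rw [this, Real.exp_add]
      ring
    rw [e, Real.sqrt_mul (hp0 z).le, Real.sqrt_sq (Real.exp_pos _).le]
  have hH : ∀ z, (R.flipVector r) z = ((Real.sqrt (p z) * G z : ℝ) : ℂ) := by
    intro z
    simp only [RBM.flipVector]
    congr 1
    rw [hG, flipRatio, Finset.mul_sum]
    refine Finset.sum_congr rfl fun x _ => ?_
    rw [← hp_def, hsqrt x z, flipWeight]
    ring
  have hHsq : ∀ z, ‖(R.flipVector r) z‖ ^ 2 = p z * G z ^ 2 := by
    intro z
    rw [hH, Complex.norm_real, Real.norm_eq_abs, sq_abs, mul_pow, Real.sq_sqrt (hp0 z).le]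
  set E := ∑ z, p z * G z ^ 2 with hE
  have hN : ‖R.flipVector r‖ ^ 2 = E := by
    rw [EuclideanSpace.norm_sq_eq]
    exact Finset.sum_congr rfl fun z _ => hHsq z
  have hE1 : (a ^ n) ^ 2 ≤ E := by
    calc (a ^ n) ^ 2 = ∑ z, p z * (a ^ n) ^ 2 := by rw [← Finset.sum_mul, hp1, one_mul]
      _ ≤ E := Finset.sum_le_sum fun z _ =>
          mul_le_mul_of_nonneg_left (pow_le_pow_left₀ han.le (hG1 z) 2) (hp0 z).le
  have hE2 : E ≤ (a ^ n * (1 + θ) ^ n) ^ 2 :=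
    sum_mul_le_of_le p _ (fun x => (hp0 x).le) hp1 _ fun z =>
      pow_le_pow_left₀ (hG0 z).le (hG2 z) 2
  have hE0 : 0 < E := lt_of_lt_of_le (by positivity) hE1
  have hN0 : 0 < ‖R.flipVector r‖ := by
    have h0 : 0 ≤ ‖R.flipVector r‖ := norm_nonneg _
    rcases h0.eq_or_lt with h | h
    · rw [← h] at hN; norm_num at hN; linarith
    · exact h
  have hP : ∀ z, ‖ψ z‖ ^ 2 = p z * G z ^ 2 / E := by
    intro z
    rw [hψr, PiLp.smul_apply, norm_smul, mul_pow, hHsq, Complex.norm_real, Real.norm_eq_abs,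
      sq_abs, inv_pow, hN]
    ring
  have hψ1 : ‖ψ‖ = 1 := by
    rw [hψr, norm_smul, Complex.norm_real, norm_inv, norm_norm]
    exact inv_mul_cancel₀ hN0.ne'
  -- Both `G²` and its mean `E` lie between `(aⁿ)²` and `(aⁿ)² U`, so the density of the noisy
  -- distribution lies between `1 / U` and `U`.
  set U := ((1 + θ) ^ n) ^ 2 with hU
  have hU1 : 1 ≤ U := one_le_pow₀ (one_le_pow₀ (by linarith))
  have hU2 : U ≤ 1 + 4 * (n * θ) := by
    rw [hU, ← pow_mul]
    have := one_add_pow_le (θ := θ) (n * 2) hθ0 (by push_cast; linarith)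
    push_cast at this
    linarith
  have hratio : ∀ z, G z ^ 2 / E ≤ U ∧ 1 / U ≤ G z ^ 2 / E := by
    intro z
    have h1 : G z ^ 2 ≤ (a ^ n) ^ 2 * U := by
      rw [hU, ← mul_pow]; exact pow_le_pow_left₀ (hG0 z).le (hG2 z) 2
    have h2 : (a ^ n) ^ 2 ≤ G z ^ 2 := pow_le_pow_left₀ han.le (hG1 z) 2
    have h3 : E ≤ (a ^ n) ^ 2 * U := by rw [hU, ← mul_pow]; exact hE2
    constructor
    · rw [div_le_iff₀ hE0]
      nlinarith
    · rw [div_le_div_iff₀ (by linarith) hE0]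
      nlinarith
  have hPle : ∀ z, ‖ψ z‖ ^ 2 ≤ p z * U := fun z => by
    rw [hP, mul_div_assoc]; exact mul_le_mul_of_nonneg_left (hratio z).1 (hp0 z).le
  have hPge : ∀ z, p z * (1 / U) ≤ ‖ψ z‖ ^ 2 := fun z => by
    rw [hP, mul_div_assoc]; exact mul_le_mul_of_nonneg_left (hratio z).2 (hp0 z).le
  refine ⟨hψ1, ?_, ?_, ?_⟩
  · intro z
    refine le_trans ?_ (hPge z)
    rw [div_eq_mul_one_div]
    refine mul_le_mul_of_nonneg_left ?_ (hp0 z).le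
    exact one_div_le_one_div_of_le (by linarith) (by linarith)
  · have hinv : 1 - 1 / U ≤ U - 1 := by
      have : 1 / U * U = 1 := by field_simp
      have h0 : 0 ≤ 1 / U := by positivity
      nlinarith [sq_nonneg (U - 1)]
    calc ∑ x, |‖ψ x‖ ^ 2 - p x| ≤ ∑ x, p x * (U - 1) := by
          refine Finset.sum_le_sum fun z _ => ?_
          have h1 := hPle z
          have h2 := hPge z
          have h3 := mul_le_mul_of_nonneg_left hinv (hp0 z).le
          rw [abs_le]; constructor <;> linarith
      _ = U - 1 := by rw [← Finset.sum_mul, hp1, one_mul]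
      _ ≤ _ := by linarith
  · intro u
    set A := R.twoHop u with hA
    have huA : u ∉ A := R.notMem_twoHop_self u
    have hcard : A.card + 1 ≤ n := by
      have := Finset.card_le_univ (insert u A)
      rwa [Finset.card_insert_of_notMem huA, Fintype.card_fin] at this
    -- The noisy distribution is a Gibbs measure itself, so the gradient at its own local fields
    -- vanishes in expectation; the bias is only the change of the local fields, bounded by `hD`.
    set Q : Cfg n → ℝ := fun z => q z + 2 * Real.log (G z) with hQ
    have hgQ : ∀ z, ‖ψ z‖ ^ 2 = gibbs Q z := by
      intro z
      have hZ := sum_exp_pos q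
      have e : ∀ z, Real.exp (Q z) = Real.exp (q z) * G z ^ 2 := by
        intro z
        rw [hQ]
        simp only
        rw [Real.exp_add, two_mul, Real.exp_add, Real.exp_log (hG0 z)]
        ring
      have e2 : E = (∑ z, Real.exp (Q z)) / ∑ z, Real.exp (q z) := by
        rw [hE, Finset.sum_div]
        refine Finset.sum_congr rfl fun z _ => ?_
        rw [e, hp, gibbs]; ring
      have hZ2 := sum_exp_pos Q
      rw [hP, e2, hp, gibbs, gibbs, e]
      field_simp
    have hD : ∀ z, |siteDeriv u Q z - siteDeriv u q z| ≤ 3 * (((A.card : ℝ) + 1) * θ) := by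
      intro z
      have e : siteDeriv u Q z - siteDeriv u q z
          = spin (z u) * (Real.log (G z) - Real.log (G (flipAt u z))) := by
        simp only [siteDeriv, hQ]; ring
      rw [e, abs_mul, abs_spin, one_mul]
      refine (abs_log_sub_log_le han (hG1 z) (hG1 _)).trans ?_
      rw [div_le_iff₀ han]
      refine (abs_flipRatio_sub_le q β a b hq ha.le hb u A huA
        (fun S hu hS => R.walshCoeff_potential_eq_zero u S hu hS) z).trans ?_
      -- Of the `n = k + l` factors, only the `k` belonging to `u` and its neighbours produce a
      -- difference; the other `l` contribute a bounded factor `(1 + θ)^l ≤ 3/2`.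
      obtain ⟨k, hk⟩ : ∃ k, k = A.card + 1 := ⟨_, rfl⟩
      have hkc : ((A.card : ℝ) + 1) = (k : ℝ) := by rw [hk]; push_cast; rfl
      rw [hkc, ← hk]
      obtain ⟨l, hl⟩ : ∃ l, l = n - k := ⟨_, rfl⟩
      have hn : n = k + l := by omega
      rw [← hl]
      have hnR : (n : ℝ) = k + l := by exact_mod_cast hn
      have hkθ : (0 : ℝ) ≤ k * θ := by positivity
      have hlθ : (0 : ℝ) ≤ l * θ := by positivity
      rw [hnR] at hnθ
      have h1 := one_add_pow_le (θ := θ) k hθ0 (by linarith)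
      have h2 := one_add_pow_le (θ := θ) l hθ0 (by linarith)
      have h3 : a ^ k ≤ (a + b * Real.exp β) ^ k :=
        pow_le_pow_left₀ ha.le (by linarith [mul_nonneg hb (Real.exp_pos β).le]) k
      have h4 : (a + b * Real.exp β) ^ k ≤ a ^ k * (1 + θ) ^ k := by
        rw [← mul_pow]; exact pow_le_pow_left₀ hab0 hab k
      have h5 : (a + b * Real.exp β) ^ l ≤ a ^ l * (1 + θ) ^ l := by
        rw [← mul_pow]; exact pow_le_pow_left₀ hab0 hab l
      have hak : 0 < a ^ k := by positivity
      have hal : 0 < a ^ l := by positivity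
      have hpow : ∀ y : ℝ, y ^ n = y ^ k * y ^ l := fun y => by rw [hn, pow_add]
      rw [hpow, hpow, ← sub_mul]
      calc ((a + b * Real.exp β) ^ k - a ^ k) * (a + b * Real.exp β) ^ l
          ≤ (a ^ k * (1 + θ) ^ k - a ^ k) * (a ^ l * (1 + θ) ^ l) := by
            apply mul_le_mul (by linarith) h5 (by positivity) (by linarith)
        _ = (a ^ k * a ^ l) * (((1 + θ) ^ k - 1) * (1 + θ) ^ l) := by ring
        _ ≤ (a ^ k * a ^ l) * ((2 * (k * θ)) * (3 / 2)) := by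
            have h6 : (1 + θ) ^ k - 1 ≤ 2 * (k * θ) := by linarith
            have h7 : (1 + θ) ^ l ≤ 3 / 2 := by linarith
            gcongr
        _ = 3 * (k * θ) * (a ^ k * a ^ l) := by ring
    have hz := sum_gibbs_smul_gradient Q u A huA
    have e : ∑ x, (‖ψ x‖ ^ 2) • ((spin (x u) - Real.tanh (siteDeriv u q x)) • featureVec A x)
        = ∑ x, (‖ψ x‖ ^ 2) • ((Real.tanh (siteDeriv u Q x) - Real.tanh (siteDeriv u q x))
          • featureVec A x) := by
      refine (sub_zero _).symm.trans ?_
      rw [← hz, ← Finset.sum_sub_distrib]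
      refine Finset.sum_congr rfl fun x _ => ?_
      rw [← hgQ, ← smul_sub, ← sub_smul]
      congr 2
      ring
    rw [e]
    have hsum1 : ∑ x, ‖ψ x‖ ^ 2 = 1 := sum_norm_sq_eq_one ψ hψ1
    calc _ ≤ ∑ x, ‖(‖ψ x‖ ^ 2) • ((Real.tanh (siteDeriv u Q x) - Real.tanh (siteDeriv u q x))
          • featureVec A x)‖ := norm_sum_le _ _
      _ ≤ ∑ x, ‖ψ x‖ ^ 2 * (3 * (((A.card : ℝ) + 1) * θ)) := by
          refine Finset.sum_le_sum fun x _ => ?_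
          rw [norm_smul, norm_smul, norm_featureVec, mul_one, Real.norm_eq_abs, Real.norm_eq_abs,
            abs_of_nonneg (by positivity)]
          refine mul_le_mul_of_nonneg_left ?_ (by positivity)
          exact (abs_tanh_sub_tanh_le _ _).trans (hD x)
      _ = _ := by rw [← Finset.sum_mul, hsum1, one_mul]

end noise

/-! ### Empirical gradients and second moments -/

section empirical

variable {n : ℕ}

/-- The gradients of all nodes together with the second moments of their features. -/
noncomputable def momentVec (q : Cfg n → ℝ) (N : Fin n → Finset (Fin n)) (x : Cfg n) :
    EuclideanSpace ℝ (Fin n × Finset (Fin n) × Option (Finset (Fin n))) :=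
  WithLp.toLp 2 fun p => match p.2.2 with
    | none => (spin (x p.1) - Real.tanh (siteDeriv p.1 q x)) * nodeFeature (N p.1) x p.2.1
    | some S => nodeFeature (N p.1) x p.2.1 * nodeFeature (N p.1) x S

theorem momentVec_none (q : Cfg n → ℝ) (N : Fin n → Finset (Fin n)) (x : Cfg n) (u : Fin n)
    (S : Finset (Fin n)) : momentVec q N x (u, S, none)
      = (spin (x u) - Real.tanh (siteDeriv u q x)) * nodeFeature (N u) x S := rfl

theorem momentVec_some (q : Cfg n → ℝ) (N : Fin n → Finset (Fin n)) (x : Cfg n) (u : Fin n)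
    (S S' : Finset (Fin n)) : momentVec q N x (u, S, some S')
      = nodeFeature (N u) x S * nodeFeature (N u) x S' := rfl

theorem norm_sq_eq_sum_nodes
    (Z : EuclideanSpace ℝ (Fin n × Finset (Fin n) × Option (Finset (Fin n)))) :
    ‖Z‖ ^ 2 = ∑ u, (∑ S, Z (u, S, none) ^ 2 + ∑ S, ∑ S', Z (u, S, some S') ^ 2) := by
  rw [EuclideanSpace.norm_sq_eq, Fintype.sum_prod_type]
  refine Finset.sum_congr rfl fun u _ => ?_
  rw [Fintype.sum_prod_type, ← Finset.sum_add_distrib]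
  refine Finset.sum_congr rfl fun S _ => ?_
  rw [Fintype.sum_option]
  simp only [Real.norm_eq_abs, sq_abs]

theorem sum_nodeFeature_sq (A : Finset (Fin n)) (x : Cfg n) : ∑ S, nodeFeature A x S ^ 2 = 1 := by
  have h := norm_featureVec A x
  have h2 := EuclideanSpace.norm_sq_eq (featureVec A x)
  rw [h, one_pow] at h2
  rw [h2]
  exact Finset.sum_congr rfl fun S _ => by rw [featureVec_apply, Real.norm_eq_abs, sq_abs]

/-- Feature vectors have norm one, so each node contributes at most `2² = 4` through its gradient
and exactly `1` through its second moments, whatever the dimension of the feature space. -/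
theorem norm_momentVec_le (q : Cfg n → ℝ) (N : Fin n → Finset (Fin n)) (x : Cfg n) :
    ‖momentVec q N x‖ ≤ Real.sqrt (5 * n) := by
  apply Real.le_sqrt_of_sq_le
  rw [norm_sq_eq_sum_nodes]
  have h : ∀ u, ∑ S, momentVec q N x (u, S, none) ^ 2
      + ∑ S, ∑ S', momentVec q N x (u, S, some S') ^ 2 ≤ 5 := by
    intro u
    simp only [momentVec_none, momentVec_some, mul_pow, ← Finset.mul_sum, sum_nodeFeature_sq,
      mul_one]
    have := pow_le_pow_left₀ (abs_nonneg _)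
      (abs_spin_sub_tanh_le (x u) (siteDeriv u q x)) 2
    rw [sq_abs] at this
    linarith
  calc _ ≤ ∑ _u : Fin n, (5 : ℝ) := Finset.sum_le_sum fun u _ => h u
    _ = 5 * n := by simp [mul_comm]

/-- The deviation of the empirical moments from their expectations. -/
noncomputable def momentDeviation (q : Cfg n → ℝ) (N : Fin n → Finset (Fin n)) (P : Cfg n → ℝ)
    {k : ℕ} (s : Fin k → Cfg n) :
    EuclideanSpace ℝ (Fin n × Finset (Fin n) × Option (Finset (Fin n))) :=
  (k : ℝ)⁻¹ • ∑ i, momentVec q N (s i) - ∑ x, P x • momentVec q N x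

theorem momentDeviation_apply (q : Cfg n → ℝ) (N : Fin n → Finset (Fin n)) (P : Cfg n → ℝ)
    {k : ℕ} (s : Fin k → Cfg n) (p : Fin n × Finset (Fin n) × Option (Finset (Fin n))) :
    momentDeviation q N P s p
      = (k : ℝ)⁻¹ * ∑ i, momentVec q N (s i) p - ∑ x, P x * momentVec q N x p := by
  simp [momentDeviation]

theorem sum_norm_gradient_deviation_sq_le (q : Cfg n → ℝ) (N : Fin n → Finset (Fin n))
    (P : Cfg n → ℝ) {k : ℕ} (s : Fin k → Cfg n) :
    ∑ u, ‖(k : ℝ)⁻¹ • ∑ i, (spin (s i u) - Real.tanh (siteDeriv u q (s i)))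
          • featureVec (N u) (s i)
        - ∑ x, P x • ((spin (x u) - Real.tanh (siteDeriv u q x)) • featureVec (N u) x)‖ ^ 2
      ≤ ‖momentDeviation q N P s‖ ^ 2 := by
  rw [norm_sq_eq_sum_nodes]
  refine Finset.sum_le_sum fun u _ => ?_
  refine le_add_of_le_of_nonneg (le_of_eq ?_)
    (Finset.sum_nonneg fun _ _ => Finset.sum_nonneg fun _ _ => sq_nonneg _)
  rw [EuclideanSpace.norm_sq_eq]
  refine Finset.sum_congr rfl fun S _ => ?_
  rw [Real.norm_eq_abs, sq_abs, momentDeviation_apply]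
  simp [momentVec_none]

/-- The deviation of the quadratic form is bounded by the Hilbert–Schmidt norm of the deviation of
its matrix, which is part of `momentDeviation`. -/
theorem secondMoment_sub_le_empirical (q : Cfg n → ℝ) (N : Fin n → Finset (Fin n))
    (P : Cfg n → ℝ) {k : ℕ} (s : Fin k → Cfg n) (u : Fin n)
    (w : EuclideanSpace ℝ (Finset (Fin n))) :
    ∑ x, P x * inner ℝ w (featureVec (N u) x) ^ 2 - ‖momentDeviation q N P s‖ * ‖w‖ ^ 2
      ≤ (k : ℝ)⁻¹ * ∑ i, inner ℝ w (featureVec (N u) (s i)) ^ 2 := by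
  set Z := momentDeviation q N P s with hZ
  have hin : ∀ x, inner ℝ w (featureVec (N u) x) ^ 2
      = ∑ S, ∑ S', w S * w S' * (momentVec q N x (u, S, some S')) := by
    intro x
    rw [PiLp.inner_apply, sq, Finset.sum_mul_sum]
    refine Finset.sum_congr rfl fun S _ => Finset.sum_congr rfl fun S' _ => ?_
    simp only [RCLike.inner_apply, conj_trivial, featureVec_apply, momentVec_some]
    ring
  have e1 : (k : ℝ)⁻¹ * ∑ i, inner ℝ w (featureVec (N u) (s i)) ^ 2
      - ∑ x, P x * inner ℝ w (featureVec (N u) x) ^ 2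
      = ∑ S, ∑ S', w S * w S' * Z (u, S, some S') := by
    simp only [hin, hZ, momentDeviation_apply, mul_sub, Finset.sum_sub_distrib]
    congr 1
    · rw [Finset.sum_comm, Finset.mul_sum]
      refine Finset.sum_congr rfl fun S _ => ?_
      rw [Finset.sum_comm, Finset.mul_sum]
      refine Finset.sum_congr rfl fun S' _ => ?_
      rw [← Finset.mul_sum]; ring
    · simp only [Finset.mul_sum]
      rw [Finset.sum_comm]
      refine Finset.sum_congr rfl fun S _ => ?_
      rw [Finset.sum_comm]
      refine Finset.sum_congr rfl fun S' _ => Finset.sum_congr rfl fun x _ => ?_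
      ring
  have e2 : |∑ S, ∑ S', w S * w S' * Z (u, S, some S')| ≤ ‖Z‖ * ‖w‖ ^ 2 := by
    have h1 : (∑ p : Finset (Fin n) × Finset (Fin n), (w p.1 * w p.2) * Z (u, p.1, some p.2)) ^ 2
        ≤ (∑ p : Finset (Fin n) × Finset (Fin n), (w p.1 * w p.2) ^ 2)
          * ∑ p : Finset (Fin n) × Finset (Fin n), Z (u, p.1, some p.2) ^ 2 :=
      Finset.sum_mul_sq_le_sq_mul_sq _ _ _
    rw [Fintype.sum_prod_type, Fintype.sum_prod_type, Fintype.sum_prod_type] at h1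
    have hw : ∑ S, w S ^ 2 = ‖w‖ ^ 2 := by
      rw [EuclideanSpace.norm_sq_eq]
      exact Finset.sum_congr rfl fun S _ => by rw [Real.norm_eq_abs, sq_abs]
    have h2 : ∑ S, ∑ S', (w S * w S') ^ 2 = (‖w‖ ^ 2) ^ 2 := by
      simp only [mul_pow, ← Finset.mul_sum, hw, ← Finset.sum_mul]; ring
    have h3 : ∑ S, ∑ S', Z (u, S, some S') ^ 2 ≤ ‖Z‖ ^ 2 := by
      rw [norm_sq_eq_sum_nodes]
      have h4 := Finset.single_le_sum (f := fun u => ∑ S, Z (u, S, none) ^ 2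
        + ∑ S, ∑ S', Z (u, S, some S') ^ 2) (fun u _ => add_nonneg
          (Finset.sum_nonneg fun _ _ => sq_nonneg _)
          (Finset.sum_nonneg fun _ _ => Finset.sum_nonneg fun _ _ => sq_nonneg _))
        (Finset.mem_univ u)
      have h5 : 0 ≤ ∑ S, Z (u, S, none) ^ 2 := Finset.sum_nonneg fun _ _ => sq_nonneg _
      simp only at h4
      linarith
    refine abs_le_of_sq_le_sq ?_ (by positivity)
    rw [h2] at h1
    calc _ ≤ _ := h1
      _ ≤ (‖w‖ ^ 2) ^ 2 * ‖Z‖ ^ 2 := by gcongr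
      _ = _ := by ring
  have := (abs_le.1 e2).1
  linarith

/-- With probability at least `1 - δ`, the empirical moments of all nodes are accurate. -/
theorem sum_sampleWeight_momentDeviation_le (q : Cfg n → ℝ) (N : Fin n → Finset (Fin n))
    (P : Cfg n → ℝ) (hP : ∀ x, 0 ≤ P x) (hP1 : ∑ x, P x = 1) (hn : 0 < n) (k : ℕ) (hk : 0 < k)
    (δ : ℝ) (hδ : 0 < δ) (hδ2 : δ ≤ 1 / 2) (bad : (Fin k → Cfg n) → Prop) [DecidablePred bad]
    (hbad : ∀ s, bad s → 14 * Real.sqrt n * Real.sqrt (Real.log (1 / δ) / k)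
      < ‖momentDeviation q N P s‖) :
    ∑ s, sampleWeight P s * (if bad s then 1 else 0) ≤ δ := by
  have hnR : (0 : ℝ) < n := by exact_mod_cast hn
  refine sum_sampleWeight_deviation_le P hP hP1 (momentVec q N) (Real.sqrt (5 * n))
    (Real.sqrt_pos.2 (by positivity)) (norm_momentVec_le q N) k hk δ hδ hδ2 bad fun s hs => ?_
  refine lt_of_le_of_lt ?_ (hbad s hs)
  refine mul_le_mul_of_nonneg_right ?_ (Real.sqrt_nonneg _)
  rw [Real.sqrt_mul (by norm_num)]
  -- This makes `6 √5 ≤ 14`, the constant of the statement.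
  have h5 : Real.sqrt 5 ≤ 7 / 3 := by
    rw [Real.sqrt_le_left (by norm_num)]; norm_num
  have := mul_le_mul_of_nonneg_right h5 (Real.sqrt_nonneg (n : ℝ))
  linarith

/-- If the empirical moments are accurate, Alphatron learns the partial potentials of all nodes,
in mean square over the nodes. -/
theorem sum_norm_alphatronVec_sub_sq_le (q : Cfg n → ℝ) (N : Fin n → Finset (Fin n))
    (hN : ∀ u, u ∉ N u) (hq : ∀ u S, u ∈ S → ¬ S.erase u ⊆ N u → walshCoeff q S = 0)
    (P : Cfg n → ℝ) {k : ℕ} (x : Fin k → Cfg n) (β lam b₀ B s ν : ℝ)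
    (hβ : ∀ u x, |siteDeriv u q x| ≤ β) (hlam0 : 0 < lam) (hlam1 : lam ≤ 1)
    (hcov : ∀ u (w : EuclideanSpace ℝ (Finset (Fin n))), (∀ S, ¬ S ⊆ N u → w S = 0) →
      2 * lam * ‖w‖ ^ 2 ≤ ∑ x, P x * inner ℝ w (featureVec (N u) x) ^ 2)
    (hbias : ∀ u, ‖∑ x, P x • ((spin (x u) - Real.tanh (siteDeriv u q x))
      • featureVec (N u) x)‖ ≤ b₀)
    (hν : ‖momentDeviation q N P x‖ ≤ ν)
    (hsmall : ν + b₀ ≤ (1 - Real.tanh β ^ 2) * lam / 6 / 2)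
    (hB : ∀ u, ‖targetVec q u (N u)‖ ≤ B) (hs : 0 < s) (t₁ t₂ : ℕ)
    (ht₁ : 2 * B ≤ (1 - Real.tanh β ^ 2) * lam / 6 * t₁) (ht₂ : B / s ≤ t₂) :
    ∑ u, ‖alphatronVec (N u) u x (t₁ + t₂) - targetVec q u (N u)‖ ^ 2
      ≤ ((Real.sqrt n * (s + b₀) + ν) / ((1 - Real.tanh β ^ 2) * lam / 6)) ^ 2 := by
  rcases Nat.eq_zero_or_pos n with rfl | hn
  · simp only [Finset.univ_eq_empty, Finset.sum_empty]; positivity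
  have hκ0 : 0 < 1 - Real.tanh β ^ 2 := by linarith [Real.tanh_sq_lt_one β]
  have hκ1 : 1 - Real.tanh β ^ 2 ≤ 1 := by linarith [sq_nonneg (Real.tanh β)]
  set μ := (1 - Real.tanh β ^ 2) * lam / 6 with hμ
  have hμ0 : 0 < μ := by positivity
  have hμlam : μ ≤ lam := by
    have := mul_le_mul_of_nonneg_right hκ1 hlam0.le
    rw [hμ]; linarith
  have hν0 : 0 ≤ ν := (norm_nonneg _).trans hν
  have hb0 : 0 ≤ b₀ := (norm_nonneg _).trans (hbias ⟨0, hn⟩)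
  set ξ : Fin n → ℝ := fun u =>
    ‖(k : ℝ)⁻¹ • ∑ i, (spin (x i u) - Real.tanh (siteDeriv u q (x i))) • featureVec (N u) (x i)
      - ∑ x, P x • ((spin (x u) - Real.tanh (siteDeriv u q x)) • featureVec (N u) x)‖ with hξ
  have hξ2 : ∑ u, ξ u ^ 2 ≤ ν ^ 2 :=
    (sum_norm_gradient_deviation_sq_le q N P x).trans (pow_le_pow_left₀ (norm_nonneg _) hν 2)
  have hξν : ∀ u, ξ u ≤ ν := fun u => by
    refine (abs_le_of_sq_le_sq' (le_trans ?_ hξ2) hν0).2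
    exact Finset.single_le_sum (f := fun u => ξ u ^ 2) (fun u _ => sq_nonneg _)
      (Finset.mem_univ u)
  have hnode : ∀ u, ‖alphatronVec (N u) u x (t₁ + t₂) - targetVec q u (N u)‖
      ≤ (s + (ξ u + b₀)) / μ := by
    intro u
    refine norm_alphatronVec_sub_le (N u) u x (targetVec q u (N u))
      (targetVec_apply_eq_zero q u (N u)) β lam (ξ u + b₀) B s ?_ hlam0 hlam1 ?_ ?_ ?_ (hB u) hs
      t₁ t₂ ht₁ ht₂
    · intro i
      rw [inner_targetVec q u (N u) (hN u) (hq u)]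
      exact hβ u _
    · intro w hw
      have h1 := secondMoment_sub_le_empirical q N P x u w
      have h2 := hcov u w hw
      -- The fluctuation uses up half of the second moment bound `2 lam`; the empirical second
      -- moments keep `lam`.
      have h3 : ‖momentDeviation q N P x‖ * ‖w‖ ^ 2 ≤ lam * ‖w‖ ^ 2 := by
        refine mul_le_mul_of_nonneg_right ?_ (sq_nonneg _)
        linarith
      linarith
    · simp only [inner_targetVec q u (N u) (hN u) (hq u)]
      have h1 := norm_le_norm_sub_add
        ((k : ℝ)⁻¹ • ∑ i, (spin (x i u) - Real.tanh (siteDeriv u q (x i)))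
          • featureVec (N u) (x i))
        (∑ x, P x • ((spin (x u) - Real.tanh (siteDeriv u q x)) • featureVec (N u) x))
      exact h1.trans (add_le_add le_rfl (hbias u))
    · linarith [hξν u]
  have hsumξ : ∑ u, ξ u ≤ Real.sqrt n * ν := by
    have h1 : (∑ u, ξ u) ^ 2 ≤ n * ∑ u, ξ u ^ 2 := by
      simpa using sq_sum_le_card_mul_sum_sq (s := Finset.univ) (f := ξ)
    refine (abs_le_of_sq_le_sq' ?_ (by positivity)).2
    rw [mul_pow, Real.sq_sqrt (by positivity)]
    exact h1.trans (mul_le_mul_of_nonneg_left hξ2 (by positivity))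
  clear_value μ
  calc ∑ u, ‖alphatronVec (N u) u x (t₁ + t₂) - targetVec q u (N u)‖ ^ 2
      ≤ ∑ u, ((s + b₀) ^ 2 + 2 * (s + b₀) * ξ u + ξ u ^ 2) / μ ^ 2 := by
        refine Finset.sum_le_sum fun u _ => ?_
        refine (pow_le_pow_left₀ (norm_nonneg _) (hnode u) 2).trans (le_of_eq ?_)
        rw [div_pow]; ring
    _ = (n * (s + b₀) ^ 2 + 2 * (s + b₀) * ∑ u, ξ u + ∑ u, ξ u ^ 2) / μ ^ 2 := by
        rw [← Finset.sum_div, Finset.sum_add_distrib, Finset.sum_add_distrib, ← Finset.mul_sum]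
        simp
    _ ≤ ((Real.sqrt n * (s + b₀)) ^ 2 + 2 * (s + b₀) * (Real.sqrt n * ν) + ν ^ 2) / μ ^ 2 := by
        rw [mul_pow, Real.sq_sqrt (by positivity)]
        gcongr
    _ = _ := by rw [div_pow]; congr 1; ring

end empirical

/-! ### From the coefficients to the distribution -/

section comparison

variable {n : ℕ}

/-- The difference between the learned and the true coefficient of `x_S`. -/
noncomputable def coeffError (N : Fin n → Finset (Fin n)) (pick : Finset (Fin n) → Fin n)
    (w : Fin n → EuclideanSpace ℝ (Finset (Fin n))) (S : Finset (Fin n)) : ℝ :=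
  if S.Nonempty then w (pick S) (S.erase (pick S)) / Real.sqrt (2 ^ (N (pick S)).card) else 0

variable (N : Fin n → Finset (Fin n)) (pick : Finset (Fin n) → Fin n)
  (hpick : ∀ S, S.Nonempty → pick S ∈ S) (w : Fin n → EuclideanSpace ℝ (Finset (Fin n)))
  (hw : ∀ u S, ¬ S ⊆ N u → w u S = 0)

include hpick hw in
-- The sets are grouped by the node `u = pick S` whose regression supplies the coefficient. Within a
-- group `S ↦ S.erase u` is injective, so `sum_abs_div_sqrt_le_norm` applies.
theorem sum_abs_coeffError_le (F : Finset (Finset (Fin n))) (U : Finset (Fin n))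
    (hF : ∀ S ∈ F, coeffError N pick w S ≠ 0 → pick S ∈ U) :
    ∑ S ∈ F, |coeffError N pick w S| ≤ ∑ u ∈ U, ‖w u‖ := by
  set F' := F.filter fun S => coeffError N pick w S ≠ 0 with hF'
  have hne : ∀ S ∈ F', S.Nonempty := by
    intro S hS
    by_contra h
    exact (Finset.mem_filter.1 hS).2 (if_neg h)
  have h1 : ∑ S ∈ F, |coeffError N pick w S| = ∑ S ∈ F', |coeffError N pick w S| := by
    rw [hF', Finset.sum_filter]
    refine Finset.sum_congr rfl fun S _ => ?_
    by_cases h : coeffError N pick w S = 0 <;> simp [h]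
  have hmaps : ∀ S ∈ F', pick S ∈ U := fun S hS =>
    hF S (Finset.mem_filter.1 hS).1 (Finset.mem_filter.1 hS).2
  rw [h1, ← Finset.sum_fiberwise_of_maps_to hmaps]
  refine Finset.sum_le_sum fun u _ => ?_
  refine le_trans ?_ (sum_abs_div_sqrt_le_norm (N u) (w u) (hw u))
  have h2 : ∑ S ∈ F' with pick S = u, |coeffError N pick w S|
      = ∑ S ∈ F' with pick S = u, |w u (S.erase u)| / Real.sqrt (2 ^ (N u).card) := by
    refine Finset.sum_congr rfl fun S hS => ?_
    obtain ⟨hS1, hS2⟩ := Finset.mem_filter.1 hS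
    rw [coeffError, if_pos (hne S hS1), hS2, abs_div, abs_of_nonneg (Real.sqrt_nonneg _)]
  have hinj : Set.InjOn (fun S : Finset (Fin n) => S.erase u)
      (F'.filter fun S => pick S = u : Finset (Finset (Fin n))) := by
    intro S hS T hT h
    have hm : ∀ S ∈ (F'.filter fun S => pick S = u), u ∈ S := by
      intro S hS
      obtain ⟨hS1, hS2⟩ := Finset.mem_filter.1 hS
      rw [← hS2]; exact hpick S (hne S hS1)
    rw [← Finset.insert_erase (hm S hS), ← Finset.insert_erase (hm T hT)]
    exact congrArg (insert u) h
  rw [h2, ← Finset.sum_image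
    (f := fun S => |w u S| / Real.sqrt (2 ^ (N u).card)) hinj]
  exact Finset.sum_le_sum_of_subset_of_nonneg (Finset.subset_univ _)
    fun _ _ _ => by positivity

include hw in
theorem erase_pick_subset (S : Finset (Fin n)) (hS : coeffError N pick w S ≠ 0) :
    S.erase (pick S) ⊆ N (pick S) := by
  by_contra h
  apply hS
  rw [coeffError]
  split_ifs
  · rw [hw _ _ h, zero_div]
  · rfl

include hw in
-- Locality of the errors: a coefficient involving `u` can only come from the regression of `u` or
-- of a neighbour, so oscillations at `u` see only these errors.
theorem pick_mem_insert (hsymm : ∀ u v, v ∈ N u ↔ u ∈ N v) (S : Finset (Fin n)) (u : Fin n)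
    (hu : u ∈ S) (hS : coeffError N pick w S ≠ 0) : pick S ∈ insert u (N u) := by
  by_cases h : pick S = u
  · rw [h]; exact Finset.mem_insert_self _ _
  · refine Finset.mem_insert_of_mem ((hsymm _ _).1 ?_)
    exact erase_pick_subset N pick w hw S hS (Finset.mem_erase.2 ⟨Ne.symm h, hu⟩)

theorem sum_norm_le_sqrt_mul (U : Finset (Fin n)) (η : ℝ) (hη : 0 ≤ η)
    (h : ∑ u, ‖w u‖ ^ 2 ≤ η ^ 2) : ∑ u ∈ U, ‖w u‖ ≤ Real.sqrt U.card * η := by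
  have h1 := sq_sum_le_card_mul_sum_sq (s := U) (f := fun u => ‖w u‖)
  have h2 : ∑ u ∈ U, ‖w u‖ ^ 2 ≤ η ^ 2 := (Finset.sum_le_sum_of_subset_of_nonneg
    (Finset.subset_univ U) fun _ _ _ => sq_nonneg _).trans h
  refine (abs_le_of_sq_le_sq' ?_ (by positivity)).2
  rw [mul_pow, Real.sq_sqrt (by positivity)]
  exact h1.trans (mul_le_mul_of_nonneg_left h2 (by positivity))

theorem abs_potentialValue_sub_flipAt_le (c : Finset (Fin n) → ℝ) (u : Fin n) (x : Cfg n) :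
    |potentialValue c x - potentialValue c (flipAt u x)| ≤ 2 * ∑ S with u ∈ S, |c S| := by
  rw [potentialValue, potentialValue, ← Finset.sum_sub_distrib, Finset.mul_sum, Finset.sum_filter]
  refine (Finset.abs_sum_le_sum_abs _ _).trans (Finset.sum_le_sum fun S _ => ?_)
  split_ifs with h
  · rw [monomialAt_flipAt_of_mem h, mul_neg, sub_neg_eq_add, ← two_mul, abs_mul, abs_mul,
      abs_monomialAt, mul_one, abs_two]
  · rw [monomialAt_flipAt_of_notMem h, sub_self, abs_zero]

theorem abs_siteDeriv_potentialValue_sub_flipAt_le (c : Finset (Fin n) → ℝ) (i j : Fin n)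
    (x : Cfg n) :
    |siteDeriv i (potentialValue c) x - siteDeriv i (potentialValue c) (flipAt j x)|
      ≤ 2 * ∑ S with i ∈ S ∧ j ∈ S, |c S| := by
  rw [siteDeriv_potentialValue, siteDeriv_potentialValue, ← Finset.sum_sub_distrib,
    Finset.mul_sum, ← Finset.filter_filter, Finset.sum_filter (p := fun S => j ∈ S)]
  refine (Finset.abs_sum_le_sum_abs _ _).trans (Finset.sum_le_sum fun S _ => ?_)
  split_ifs with h
  · by_cases hj : j ∈ S.erase i
    · rw [monomialAt_flipAt_of_mem hj, mul_neg, sub_neg_eq_add, ← two_mul, abs_mul, abs_mul,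
        abs_monomialAt, mul_one, abs_two]
    · rw [monomialAt_flipAt_of_notMem hj, sub_self, abs_zero]; positivity
  · rw [monomialAt_flipAt_of_notMem (fun e => h (Finset.mem_of_mem_erase e)), sub_self, abs_zero]

include hpick hw in
-- Here the standard deviation is bounded by the supremum norm, that is by `∑ u, ‖w u‖`;
-- Cauchy–Schwarz over the nodes costs `√n`.
theorem sum_abs_gibbs_sub_le_sqrt_mul (q : Cfg n → ℝ) (η : ℝ) (hη : 0 ≤ η)
    (h : ∑ u, ‖w u‖ ^ 2 ≤ η ^ 2) :
    ∑ x, |gibbs (fun y => q y + potentialValue (coeffError N pick w) y) x - gibbs q x|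
      ≤ Real.sqrt n * η := by
  refine sum_abs_gibbs_sub_le q _ _ (by positivity) fun t _ => ?_
  refine varianceOf_le_sq_of_abs_le _ _ (fun x => (gibbs_pos _ x).le) (sum_gibbs _) _ fun x => ?_
  have h1 := sum_norm_le_sqrt_mul w Finset.univ η hη h
  rw [Finset.card_univ, Fintype.card_fin] at h1
  refine le_trans ?_ ((sum_abs_coeffError_le N pick hpick w hw Finset.univ Finset.univ
    fun S _ _ => Finset.mem_univ _).trans h1)
  refine (Finset.abs_sum_le_sum_abs _ _).trans (Finset.sum_le_sum fun S _ => ?_)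
  rw [abs_mul, abs_monomialAt, mul_one]

theorem abs_siteDeriv_sub_flipAt_le (q : Cfg n → ℝ) (β : ℝ)
    (hβ : ∀ u x, |siteDeriv u q x| ≤ β)
    (hq : ∀ u v, v ≠ u → v ∉ N u → ∀ x, siteDeriv u q (flipAt v x) = siteDeriv u q x)
    (i j : Fin n) (hij : i ≠ j) (x : Cfg n) :
    |siteDeriv i q x - siteDeriv i q (flipAt j x)| ≤ 2 * (if j ∈ N i then β else 0) := by
  split_ifs with h
  · refine (abs_sub _ _).trans ?_
    linarith [hβ i x, hβ i (flipAt j x)]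
  · rw [hq i j (Ne.symm hij) h, sub_self]; simp

include hpick hw in
-- Under weak dependence the variance is bounded by squared oscillations, each at most twice the sum
-- of the errors in a closed neighbourhood. The squares sum to at most `(2 (d + 1) η)²`, so `√n` is
-- replaced by `d + 1`.
theorem sum_abs_gibbs_sub_le_of_weak_dependence (hsymm : ∀ u v, v ∈ N u ↔ u ∈ N v)
    (q : Cfg n → ℝ) (β : ℝ) (hβ0 : 0 ≤ β) (hβ : ∀ u x, |siteDeriv u q x| ≤ β)
    (hq : ∀ u v, v ≠ u → v ∉ N u → ∀ x, siteDeriv u q (flipAt v x) = siteDeriv u q x)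
    (d : ℕ) (hd : ∀ u, (N u).card ≤ d) (η : ℝ) (hη : 0 ≤ η) (h : ∑ u, ‖w u‖ ^ 2 ≤ η ^ 2)
    (hsmall : d * β + ((d : ℝ) + 1) ^ 2 * η ≤ 1 / 4) :
    ∑ x, |gibbs (fun y => q y + potentialValue (coeffError N pick w) y) x - gibbs q x|
      ≤ 2 * (((d : ℝ) + 1) * η) := by
  classical
  set c := coeffError N pick w with hc
  set W : Fin n → ℝ := fun u => ∑ v ∈ insert u (N u), ‖w v‖ with hW
  have hcardI : ∀ u, ((insert u (N u)).card : ℝ) ≤ (d : ℝ) + 1 := fun u => by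
    have h1 := Finset.card_insert_le u (N u)
    have h2 := hd u
    have : (insert u (N u)).card ≤ d + 1 := by omega
    exact_mod_cast this
  have hsumW : ∀ u, ∑ S with u ∈ S, |c S| ≤ W u := fun u =>
    sum_abs_coeffError_le N pick hpick w hw _ _ fun S hS hS0 =>
      pick_mem_insert N pick w hw hsymm S u (Finset.mem_filter.1 hS).2 hS0
  have hWη : ∀ u, W u ≤ ((d : ℝ) + 1) * η := by
    intro u
    refine (sum_norm_le_sqrt_mul w (insert u (N u)) η hη h).trans ?_
    refine mul_le_mul_of_nonneg_right ?_ hη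
    rw [Real.sqrt_le_left (by positivity)]
    have := hcardI u
    nlinarith [Nat.cast_nonneg (α := ℝ) d]
  have hWsq : ∑ u, W u ^ 2 ≤ (((d : ℝ) + 1) * η) ^ 2 := by
    have h1 : ∀ u, W u ^ 2 ≤ ((d : ℝ) + 1) * ∑ v, if v ∈ insert u (N u) then ‖w v‖ ^ 2 else 0 := by
      intro u
      refine (sq_sum_le_card_mul_sum_sq (s := insert u (N u)) (f := fun v => ‖w v‖)).trans ?_
      rw [Finset.sum_ite_mem, Finset.univ_inter]
      exact mul_le_mul_of_nonneg_right (hcardI u) (Finset.sum_nonneg fun _ _ => sq_nonneg _)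
    calc ∑ u, W u ^ 2
        ≤ ∑ u, ((d : ℝ) + 1) * ∑ v, (if v ∈ insert u (N u) then ‖w v‖ ^ 2 else 0) :=
          Finset.sum_le_sum fun u _ => h1 u
      _ = ((d : ℝ) + 1) * ∑ v, ∑ u, (if v ∈ insert u (N u) then ‖w v‖ ^ 2 else 0) := by
          rw [← Finset.mul_sum, Finset.sum_comm]
      _ = ((d : ℝ) + 1) * ∑ v, ((insert v (N v)).card : ℝ) * ‖w v‖ ^ 2 := by
          congr 1
          refine Finset.sum_congr rfl fun v _ => ?_
          have : ∀ u, (v ∈ insert u (N u)) ↔ u ∈ insert v (N v) := by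
            intro u
            simp only [Finset.mem_insert, hsymm u v, eq_comm]
          simp only [this, Finset.sum_ite_mem, Finset.univ_inter, Finset.sum_const, nsmul_eq_mul]
      _ ≤ ((d : ℝ) + 1) * ∑ v, ((d : ℝ) + 1) * ‖w v‖ ^ 2 := by
          gcongr with v; exact hcardI v
      _ = ((d : ℝ) + 1) ^ 2 * ∑ v, ‖w v‖ ^ 2 := by rw [← Finset.mul_sum]; ring
      _ ≤ _ := by rw [mul_pow]; gcongr
  refine sum_abs_gibbs_sub_le q _ _ (by positivity) fun t ht => ?_
  -- The influences along the path are at most `β` between neighbours, plus the `ℓ_1` mass of the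
  -- error coefficients containing both sites. Since these sets have at most `d + 1` elements, the
  -- row sums are at most `d β + (d + 1)² η`.
  have hvar := varianceOf_gibbs_le_of_weak_dependence (fun y => q y + t * potentialValue c y)
    (fun i j => (if j ∈ N i then β else 0) + ∑ S with i ∈ S ∧ j ∈ S, |c S|)
    (fun i j => add_nonneg (by split_ifs <;> [exact hβ0; exact le_rfl])
      (Finset.sum_nonneg fun _ _ => abs_nonneg _))
    (fun i j => by simp only [hsymm i j, and_comm])
    (fun i => by
      rw [Finset.sum_add_distrib]
      have h1 : ∑ j, (if j ∈ N i then β else 0) ≤ d * β := by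
        rw [Finset.sum_ite_mem, Finset.univ_inter, Finset.sum_const, nsmul_eq_mul]
        have : ((N i).card : ℝ) ≤ d := by exact_mod_cast hd i
        exact mul_le_mul_of_nonneg_right this hβ0
      have h2 : ∑ j, ∑ S with i ∈ S ∧ j ∈ S, |c S| ≤ ((d : ℝ) + 1) * W i := by
        calc ∑ j, ∑ S with i ∈ S ∧ j ∈ S, |c S|
            = ∑ S with i ∈ S, ∑ j, (if j ∈ S then |c S| else 0) := by
              rw [Finset.sum_comm]
              refine Finset.sum_congr rfl fun j _ => ?_
              rw [← Finset.filter_filter, Finset.sum_filter (p := fun S => j ∈ S)]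
          _ = ∑ S with i ∈ S, (S.card : ℝ) * |c S| := by
              refine Finset.sum_congr rfl fun S _ => ?_
              rw [Finset.sum_ite_mem, Finset.univ_inter, Finset.sum_const, nsmul_eq_mul]
          _ ≤ ∑ S with i ∈ S, ((d : ℝ) + 1) * |c S| := by
              refine Finset.sum_le_sum fun S _ => ?_
              by_cases h0 : c S = 0
              · rw [h0]; simp
              · refine mul_le_mul_of_nonneg_right ?_ (abs_nonneg _)
                have h3 := Finset.card_le_card (erase_pick_subset N pick w hw S h0)
                have h4 := Finset.pred_card_le_card_erase (s := S) (a := pick S)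
                have h5 := hd (pick S)
                have : S.card ≤ d + 1 := by omega
                exact_mod_cast this
          _ ≤ _ := by
              rw [← Finset.mul_sum]
              exact mul_le_mul_of_nonneg_left (hsumW i) (by positivity)
      have h3 := mul_le_mul_of_nonneg_left (hWη i) (by positivity : (0 : ℝ) ≤ (d : ℝ) + 1)
      nlinarith)
    (fun i j hij x => by
      rw [siteDeriv_add_mul, siteDeriv_add_mul]
      have h1 := abs_siteDeriv_sub_flipAt_le N q β hβ hq i j hij x
      have h2 := abs_siteDeriv_potentialValue_sub_flipAt_le c i j x
      have e : siteDeriv i q x + t * siteDeriv i (potentialValue c) x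
          - (siteDeriv i q (flipAt j x) + t * siteDeriv i (potentialValue c) (flipAt j x))
          = (siteDeriv i q x - siteDeriv i q (flipAt j x))
            + t * (siteDeriv i (potentialValue c) x
              - siteDeriv i (potentialValue c) (flipAt j x)) := by ring
      rw [e, mul_add]
      refine (abs_add_le _ _).trans (add_le_add h1 ?_)
      rw [abs_mul, abs_of_nonneg ht.1]
      exact (mul_le_of_le_one_left (abs_nonneg _) ht.2).trans h2)
    (potentialValue c) (fun u => 2 * W u) (fun u x =>
      (abs_potentialValue_sub_flipAt_le c u x).trans
        (mul_le_mul_of_nonneg_left (hsumW u) (by norm_num)))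
  refine hvar.trans ?_
  simp only [mul_pow, ← Finset.mul_sum]
  rw [mul_pow] at hWsq
  linarith

/-- Along the path that switches the potential off, dependence stays weak, and the potential has
oscillation at most `2β` at each of the `n` sites. -/
theorem sum_abs_gibbs_sub_uniform_le (hsymm : ∀ u v, v ∈ N u ↔ u ∈ N v)
    (q : Cfg n → ℝ) (β : ℝ) (hβ0 : 0 ≤ β) (hβ : ∀ u x, |siteDeriv u q x| ≤ β)
    (hq : ∀ u v, v ≠ u → v ∉ N u → ∀ x, siteDeriv u q (flipAt v x) = siteDeriv u q x)
    (d : ℕ) (hd : ∀ u, (N u).card ≤ d) (hsmall : d * β ≤ 1 / 4) :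
    ∑ x, |gibbs (fun _ => 0) x - gibbs q x| ≤ 2 * (β * Real.sqrt n) := by
  have e : (fun y => q y + -q y) = fun _ : Cfg n => (0 : ℝ) := by funext y; ring
  rw [← e]
  refine sum_abs_gibbs_sub_le q _ _ (by positivity) fun t ht => ?_
  have hvar := varianceOf_gibbs_le_of_weak_dependence (fun y => q y + t * -q y)
    (fun i j => if j ∈ N i then β else 0)
    (fun i j => by split_ifs <;> [exact hβ0; exact le_rfl])
    (fun i j => by simp only [hsymm i j])
    (fun i => by
      rw [Finset.sum_ite_mem, Finset.univ_inter, Finset.sum_const, nsmul_eq_mul]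
      have : ((N i).card : ℝ) ≤ d := by exact_mod_cast hd i
      exact (mul_le_mul_of_nonneg_right this hβ0).trans hsmall)
    (fun i j hij x => by
      rw [siteDeriv_add_mul, siteDeriv_add_mul]
      have h1 := abs_siteDeriv_sub_flipAt_le N q β hβ hq i j hij x
      have e : ∀ x, siteDeriv i (fun y => -q y) x = -siteDeriv i q x := fun x => by
        simp only [siteDeriv]; ring
      rw [e, e]
      have e2 : siteDeriv i q x + t * -siteDeriv i q x
          - (siteDeriv i q (flipAt j x) + t * -siteDeriv i q (flipAt j x))
          = (1 - t) * (siteDeriv i q x - siteDeriv i q (flipAt j x)) := by ring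
      rw [e2, abs_mul, abs_of_nonneg (by linarith [ht.2])]
      exact (mul_le_of_le_one_left (abs_nonneg _) (by linarith [ht.1])).trans h1)
    (fun y => -q y) (fun _ => 2 * β) (fun u x => by
      have h1 := hβ u x
      rw [abs_siteDeriv] at h1
      have e : -q x - -q (flipAt u x) = -(q x - q (flipAt u x)) := by ring
      rw [e, abs_neg]
      linarith)
  refine hvar.trans (le_of_eq ?_)
  rw [Finset.sum_const, Finset.card_univ, Fintype.card_fin, nsmul_eq_mul, mul_pow, mul_pow,
    mul_pow, Real.sq_sqrt (by positivity)]
  ring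

include hpick in
/-- The learned distribution is the Gibbs measure of the true potential plus the error. -/
theorem mrf_learnedPotential_eq (q : Cfg n → ℝ)
    (hq : ∀ u S, u ∈ S → ¬ S.erase u ⊆ N u → walshCoeff q S = 0) {k : ℕ} (T : ℕ)
    (x : Fin k → Cfg n) (a : Fin 0 → Cfg n) :
    mrf (learnedPotential T N pick x a) = gibbs fun y => q y + potentialValue
      (coeffError N pick fun u => alphatronVec (N u) u x T - targetVec q u (N u)) y := by
  have hcoef : ∀ S, learnedPotential T N pick x a S
      = walshCoeff q S + coeffError N pick (fun u => alphatronVec (N u) u x T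
        - targetVec q u (N u)) S + (if S = ∅ then -walshCoeff q ∅ else 0) := by
    intro S
    rw [learnedPotential, coeffError]
    rcases S.eq_empty_or_nonempty with rfl | hS
    · simp
    · have hSp := hpick S hS
      rw [if_pos hS, if_pos hS, if_neg hS.ne_empty, nodePotential_eq, PiLp.sub_apply, sub_div,
        targetVec_apply, Finset.insert_erase hSp, add_zero]
      have h2 : Real.sqrt (2 ^ (N (pick S)).card) ≠ 0 := by positivity
      split_ifs with h
      · field_simp; ring
      · rw [hq _ S hSp h]; simp
  -- The missing constant coefficient only shifts the potential, which the normalisation ignores.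
  have hval : potentialValue (learnedPotential T N pick x a) = fun y => (q y + potentialValue
      (coeffError N pick fun u => alphatronVec (N u) u x T - targetVec q u (N u)) y)
        + -walshCoeff q ∅ := by
    funext y
    have hqy : ∑ S, walshCoeff q S * monomialAt S y = q y :=
      congrFun (potentialValue_walshCoeff q) y
    have h0 : monomialAt ∅ y = 1 := Finset.prod_empty
    simp only [potentialValue, hcoef, add_mul, Finset.sum_add_distrib, ite_mul, zero_mul,
      Finset.sum_ite_eq', Finset.mem_univ, if_true, hqy, h0, mul_one]
  have : mrf (learnedPotential T N pick x a)
      = gibbs (potentialValue (learnedPotential T N pick x a)) := rfl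
  rw [this, hval, gibbs_add_const]

theorem mrf_learnedPotential_zero {k : ℕ} (x : Fin k → Cfg n) (a : Fin 0 → Cfg n) :
    mrf (learnedPotential 0 N pick x a) = gibbs fun _ => 0 := by
  have h : potentialValue (learnedPotential 0 N pick x a) = fun _ => 0 := by
    funext y
    refine Finset.sum_eq_zero fun S _ => ?_
    rw [learnedPotential]
    split_ifs
    · rw [nodePotential_eq, alphatronVec_zero]; simp
    · simp
  have : mrf (learnedPotential 0 N pick x a)
      = gibbs (potentialValue (learnedPotential 0 N pick x a)) := rfl
  rw [this, h]

end comparison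

/-! ### Numerical bounds for the parameters -/

section parameters

/-- Polynomial losses in the degree are paid for by `2^d`. From `d = 9` on, the induction works
because `(10 / 9)^6 < 2`. -/
theorem add_one_pow_six_le (d : ℕ) : (d + 1) ^ 6 ≤ 4096 * 2 ^ d := by
  rcases le_or_gt d 8 with h | h
  · interval_cases d <;> norm_num
  · induction d, h using Nat.le_induction with
    | base => norm_num
    | succ d hd ih =>
      have h9 : 9 ≤ d := hd
      have h1 : 9 * (d + 1 + 1) ≤ 10 * (d + 1) := by omega
      have h2 := Nat.pow_le_pow_left h1 6
      rw [mul_pow, mul_pow] at h2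
      rw [pow_succ 2]
      omega

theorem add_one_pow_three_le (d : ℕ) : ((d : ℝ) + 1) ^ 3 ≤ 64 * Real.sqrt (2 ^ d) := by
  refine (abs_le_of_sq_le_sq' ?_ (by positivity)).2
  rw [mul_pow, Real.sq_sqrt (by positivity)]
  have h : ((d : ℝ) + 1) ^ 6 ≤ 4096 * 2 ^ d := by exact_mod_cast add_one_pow_six_le d
  calc (((d : ℝ) + 1) ^ 3) ^ 2 = ((d : ℝ) + 1) ^ 6 := by ring
    _ ≤ _ := by linarith

theorem add_one_pow_le_of_le_three (d k : ℕ) (hk : k ≤ 3) :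
    ((d : ℝ) + 1) ^ k ≤ 64 * Real.sqrt (2 ^ d) :=
  (pow_le_pow_right₀ (by linarith [Nat.cast_nonneg (α := ℝ) d]) hk).trans
    (add_one_pow_three_le d)

/-- The contraction rate of Alphatron. -/
noncomputable def learnRate (d : ℕ) (β : ℝ) : ℝ :=
  (1 - Real.tanh β ^ 2) * (Real.sigmoid (-2 * β) ^ d / 4) / 6

theorem learnRate_eq (d : ℕ) (β : ℝ) :
    24 * learnRate d β = (1 - Real.tanh β ^ 2) * Real.sigmoid (-2 * β) ^ d := by
  rw [learnRate]; ring

theorem one_sub_tanh_sq_pos (β : ℝ) : 0 < 1 - Real.tanh β ^ 2 := by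
  linarith [Real.tanh_sq_lt_one β]

theorem one_sub_tanh_sq_le_one (β : ℝ) : 1 - Real.tanh β ^ 2 ≤ 1 := by
  linarith [sq_nonneg (Real.tanh β)]

theorem learnRate_pos (d : ℕ) (β : ℝ) : 0 < learnRate d β := by
  have := one_sub_tanh_sq_pos β
  have := Real.sigmoid_pos (-2 * β)
  rw [learnRate]; positivity

theorem sigmoid_pow_le_one (d : ℕ) (β : ℝ) : Real.sigmoid (-2 * β) ^ d ≤ 1 :=
  pow_le_one₀ (Real.sigmoid_pos _).le (Real.sigmoid_le_one _)

theorem learnRate_le (d : ℕ) (β : ℝ) : 24 * learnRate d β ≤ 1 := by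
  rw [learnRate_eq]
  exact mul_le_one₀ (one_sub_tanh_sq_le_one β) (pow_nonneg (Real.sigmoid_pos _).le _)
    (sigmoid_pow_le_one d β)

theorem learnTheta_eq (d : ℕ) (β : ℝ) :
    learnTheta d β = (24 * learnRate d β) ^ 2 * (1 - Real.tanh β ^ 2) := by
  rw [learnTheta, learnRate_eq]; ring

theorem learnTheta_pos (d : ℕ) (β : ℝ) : 0 < learnTheta d β := by
  have := one_sub_tanh_sq_pos β
  have := learnRate_pos d β
  rw [learnTheta_eq]; positivity

theorem learnTheta_le_sq (d : ℕ) (β : ℝ) : learnTheta d β ≤ (24 * learnRate d β) ^ 2 := by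
  rw [learnTheta_eq]
  exact mul_le_of_le_one_right (sq_nonneg _) (one_sub_tanh_sq_le_one β)

theorem learnTheta_le_learnRate (d : ℕ) (β : ℝ) : learnTheta d β ≤ 24 * learnRate d β := by
  have h1 := learnTheta_le_sq d β
  have h2 := learnRate_le d β
  have h3 := learnRate_pos d β
  nlinarith

theorem learnTheta_le_sigmoid_pow (d : ℕ) (β : ℝ) :
    learnTheta d β ≤ Real.sigmoid (-2 * β) ^ d := by
  refine (learnTheta_le_learnRate d β).trans ?_
  rw [learnRate_eq]
  exact mul_le_of_le_one_left (pow_nonneg (Real.sigmoid_pos _).le _) (one_sub_tanh_sq_le_one β)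

/-- The factor of `learnTheta` left over after `(24 learnRate)²` compensates the amplification `exp
(2β)` of flip probabilities. -/
theorem exp_sq_mul_one_sub_tanh_sq_le (β : ℝ) :
    Real.exp β ^ 2 * (1 - Real.tanh β ^ 2) ≤ 4 := by
  have h1 : Real.exp β ≤ 2 * Real.cosh β := by
    rw [Real.cosh_eq]; linarith [Real.exp_pos (-β)]
  have h2 := Real.cosh_pos β
  rw [one_sub_tanh_sq, mul_one_div, div_le_iff₀ (by positivity)]
  nlinarith [Real.exp_pos β]

/-- The denominator of the tolerated noise dominates the factors that the analysis loses. -/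
theorem noise_factor_bounds (n d : ℕ) (hn : 0 < n) :
    1 ≤ Real.sqrt (n * 2 ^ d) + n ∧
    (n : ℝ) + ((d : ℝ) + 1) ^ 2 * Real.sqrt n ≤ 64 * (Real.sqrt (n * 2 ^ d) + n) ∧
    ((d : ℝ) + 1) * (n + ((d : ℝ) + 1) ^ 2 * Real.sqrt n)
      ≤ 128 * (Real.sqrt n * (Real.sqrt (n * 2 ^ d) + n)) := by
  have hn1 : (1 : ℝ) ≤ n := by exact_mod_cast hn
  have hs1 : 1 ≤ Real.sqrt n := Real.one_le_sqrt.2 hn1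
  have hss : Real.sqrt n * Real.sqrt n = n := Real.mul_self_sqrt (by positivity)
  have hD := Real.sqrt_nonneg ((2 : ℝ) ^ d)
  have h1 := add_one_pow_le_of_le_three d 1 (by norm_num)
  have h2 := add_one_pow_le_of_le_three d 2 (by norm_num)
  have h3 := add_one_pow_le_of_le_three d 3 le_rfl
  rw [pow_one] at h1
  rw [Real.sqrt_mul (by positivity)]
  set r := Real.sqrt n
  set D := Real.sqrt ((2 : ℝ) ^ d)
  refine ⟨by nlinarith [mul_nonneg (zero_le_one.trans hs1) hD], ?_, ?_⟩
  · nlinarith [mul_le_mul_of_nonneg_right h2 (zero_le_one.trans hs1)]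
  · have e1 : ((d : ℝ) + 1) * n ≤ 64 * D * n := mul_le_mul_of_nonneg_right h1 (by positivity)
    have e2 : ((d : ℝ) + 1) ^ 3 * r ≤ 64 * D * r :=
      mul_le_mul_of_nonneg_right h3 (zero_le_one.trans hs1)
    have e3 : D * r ≤ D * n := by
      refine mul_le_mul_of_nonneg_left ?_ hD
      nlinarith
    have e4 : r * (r * D + n) = D * n + r * n := by rw [← hss]; ring
    have e5 : 0 ≤ r * n := by positivity
    rw [e4]
    nlinarith

end parameters

/-! ### States close to the state of a restricted Boltzmann machine -/

section noise

variable {n m : ℕ}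

theorem norm_flipVector_pos (R : RBM n m) (r : ℝ) (h0 : 0 ≤ r) (h1 : r ≤ 1) :
    0 < ‖R.flipVector r‖ := by
  rw [norm_pos_iff]
  intro h
  have hp : ∀ x, 0 < R.marginal x := fun x => by rw [R.marginal_eq_gibbs]; exact gibbs_pos _ x
  set z : Cfg n := fun _ => true
  have hz := congrArg (fun v : QubitSpace n => v z) h
  simp only [RBM.flipVector, PiLp.zero_apply, Complex.ofReal_eq_zero] at hz
  have hnn : ∀ x ∈ Finset.univ, 0 ≤ Real.sqrt (R.marginal x) *
      ∏ i, (if z i = x i then Real.sqrt (1 - r) else Real.sqrt r) := fun x _ =>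
    mul_nonneg (Real.sqrt_nonneg _) (Finset.prod_nonneg fun i _ => by split_ifs <;> positivity)
  rw [Finset.sum_eq_zero_iff_of_nonneg hnn] at hz
  -- All terms are nonnegative, so a single positive one suffices: the unflipped configuration, or
  -- for `r = 1` the completely flipped one.
  rcases lt_or_eq_of_le h1 with h2 | rfl
  · have := hz z (Finset.mem_univ _)
    have h3 : 0 < Real.sqrt (1 - r) := Real.sqrt_pos.2 (by linarith)
    simp [(Real.sqrt_pos.2 (hp z)).ne', h3.ne'] at this
  · have := hz (fun _ => false) (Finset.mem_univ _)
    simp [z, (Real.sqrt_pos.2 (hp fun _ => false)).ne'] at this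

theorem norm_eq_one_of_flipAssociated (ρ : ℝ) (ψ : QubitSpace n) (R : RBM n m)
    (h : FlipAssociated ρ ψ R) : ‖ψ‖ = 1 := by
  obtain ⟨r, h0, h1, -, rfl⟩ := h
  have := norm_flipVector_pos R r h0 h1
  rw [norm_smul, Complex.norm_real, norm_inv, norm_norm, inv_mul_cancel₀ this.ne']

/-- What the analysis of the learner needs to know about the distribution `P` of the samples, if
they come from an approximation of the state of `R`: a lower bound for the second moments of the
features, an upper bound `b₀` for the expected gradient at the true partial potentials, and the
distance to the distribution of `R`. -/
structure SamplesFrom (R : RBM n m) (P : Cfg n → ℝ) (d : ℕ) (β b₀ τ : ℝ) : Prop where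
  secondMoment : ∀ u (w : EuclideanSpace ℝ (Finset (Fin n))), (∀ S, ¬ S ⊆ R.twoHop u → w S = 0) →
    2 * (Real.sigmoid (-2 * β) ^ d / 4) * ‖w‖ ^ 2
      ≤ ∑ x, P x * inner ℝ w (featureVec (R.twoHop u) x) ^ 2
  gradient : ∀ u, ‖∑ x, P x • ((spin (x u) - Real.tanh (siteDeriv u R.potential x))
    • featureVec (R.twoHop u) x)‖ ≤ b₀
  dist : ∑ x, |P x - R.marginal x| ≤ τ

theorem RBM.sigmoid_pow_mul_norm_sq_le (R : RBM n m) (α β : ℝ) (hR : R.Nondegenerate α β) (d : ℕ)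
    (hd : R.twoHopDegree = d) (u : Fin n) (w : EuclideanSpace ℝ (Finset (Fin n)))
    (hw : ∀ S, ¬ S ⊆ R.twoHop u → w S = 0) :
    Real.sigmoid (-2 * β) ^ d * ‖w‖ ^ 2
      ≤ ∑ x, R.marginal x * inner ℝ w (featureVec (R.twoHop u) x) ^ 2 := by
  have h := pow_card_mul_norm_sq_le R.marginal (by rw [R.marginal_eq_gibbs]; exact sum_gibbs _)
    (Real.sigmoid (-2 * β)) (Real.sigmoid_pos _).le
    (fun i x => by
      rw [R.marginal_eq_gibbs]
      exact sigmoid_mul_gibbs_add_le R.potential β (R.abs_potential_sub_le α β hR) i x)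
    (R.twoHop u) w hw
  refine le_trans ?_ h
  exact mul_le_mul_of_nonneg_right (pow_le_pow_of_le_one (Real.sigmoid_pos _).le
    (Real.sigmoid_le_one _) (hd ▸ R.card_twoHop_le u)) (sq_nonneg _)

theorem samplesFrom_of_lpAssociated (R : RBM n m) (α β c ε p ε_p : ℝ) (d : ℕ) (hn : 0 < n)
    (hR : R.Nondegenerate α β) (hd : R.twoHopDegree = d) (hc : 0 < c) (hε : 0 < ε) (hε1 : ε ≤ 1)
    (hcε : c * ε ≤ 1 / 4) (ψ : QubitSpace n) (hp : 1 ≤ p) (hψ : LpAssociated p ε_p ψ R)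
    (hεp : ε_p ≤ c * (learnTheta d β * ε ^ 2 / ((Real.sqrt ((n : ℝ) * 2 ^ d) + n) ^ 2
      * (2 : ℝ) ^ (((n : ℝ) - 1) * (1 - 1 / p))))) :
    ∃ b₀, b₀ * ((n : ℝ) + ((d : ℝ) + 1) ^ 2 * Real.sqrt n) ≤ 6144 * c * ε * learnRate d β ∧
      SamplesFrom R (fun x => ‖ψ x‖ ^ 2) d β b₀ (2 * c * ε) := by
  obtain ⟨hX1, hX2, -⟩ := noise_factor_bounds n d hn
  set X := Real.sqrt ((n : ℝ) * 2 ^ d) + n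
  have hϑ := learnTheta_pos d β
  have hX0 : 0 < X := zero_lt_one.trans_le hX1
  set E := 2 * c * learnTheta d β * ε ^ 2 / X ^ 2 with hE
  have hdist : ∑ x, |‖ψ x‖ ^ 2 - R.marginal x| ≤ E := by
    refine (sum_abs_le_of_magnitudeDist R ψ p ε_p hp hψ).trans ?_
    -- Hölder's inequality gives the exponent `n` instead of `n - 1`, at the price of a factor of at
    -- most `2`.
    have h2 : (2 : ℝ) ^ ((n : ℝ) * (1 - 1 / p))
        ≤ 2 * (2 : ℝ) ^ (((n : ℝ) - 1) * (1 - 1 / p)) := by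
      rw [mul_comm 2 (_ ^ _ : ℝ), ← Real.rpow_add_one (by norm_num)]
      refine Real.rpow_le_rpow_of_exponent_le (by norm_num) ?_
      have : 0 ≤ 1 / p := by positivity
      linarith
    have hY : (0 : ℝ) < 2 ^ (((n : ℝ) - 1) * (1 - 1 / p)) := by positivity
    set Y := (2 : ℝ) ^ (((n : ℝ) - 1) * (1 - 1 / p))
    calc (2 : ℝ) ^ ((n : ℝ) * (1 - 1 / p)) * ε_p
        ≤ (2 : ℝ) ^ ((n : ℝ) * (1 - 1 / p)) * (c * (learnTheta d β * ε ^ 2 / (X ^ 2 * Y))) := by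
          gcongr
      _ ≤ 2 * Y * (c * (learnTheta d β * ε ^ 2 / (X ^ 2 * Y))) := by gcongr
      _ = E := by rw [hE]; field_simp
  have hcε2 : 2 * c * ε ^ 2 ≤ 1 / 2 := by nlinarith
  have hEϑ : E ≤ learnTheta d β * (2 * c * ε ^ 2) := by
    rw [hE, div_le_iff₀ (by positivity)]
    have : 1 ≤ X ^ 2 := one_le_pow₀ hX1
    have h3 : 0 ≤ learnTheta d β * (2 * c * ε ^ 2) := by positivity
    nlinarith
  refine ⟨2 * E, ?_, fun u w hw => ?_, fun u => ?_, hdist.trans ?_⟩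
  · calc 2 * E * ((n : ℝ) + ((d : ℝ) + 1) ^ 2 * Real.sqrt n) ≤ 2 * E * (64 * X) := by
          gcongr
      _ = 256 * c * learnTheta d β * ε ^ 2 / X := by rw [hE]; field_simp; norm_num
      _ ≤ 256 * c * learnTheta d β * ε ^ 2 := div_le_self (by positivity) hX1
      _ ≤ 256 * c * (24 * learnRate d β) * ε := by
          have h4 := learnTheta_le_learnRate d β
          have h5 : ε ^ 2 ≤ ε := by nlinarith
          have h6 := learnRate_pos d β
          gcongr
      _ = _ := by ring
  · refine le_trans ?_ (half_pow_mul_norm_sq_le_of_dist R.marginal _ (R.twoHop u) w _ E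
      (R.sigmoid_pow_mul_norm_sq_le α β hR d hd u w hw) hdist)
    refine mul_le_mul_of_nonneg_right ?_ (sq_nonneg _)
    have h1 := learnTheta_le_sigmoid_pow d β
    nlinarith
  · exact norm_sum_smul_gradient_le_of_dist R.potential _ u _ (R.notMem_twoHop_self u) E
      (by rw [← R.marginal_eq_gibbs]; exact hdist)
  · refine hEϑ.trans ?_
    have h1 := (learnTheta_le_sigmoid_pow d β).trans (sigmoid_pow_le_one d β)
    have h5 : ε ^ 2 ≤ ε := by nlinarith
    calc learnTheta d β * (2 * c * ε ^ 2) ≤ 1 * (2 * c * ε) := by gcongr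
      _ = _ := one_mul _

theorem samplesFrom_of_flipAssociated (R : RBM n m) (α β c ε ρ : ℝ) (d : ℕ) (hn : 0 < n)
    (hR : R.Nondegenerate α β) (hd : R.twoHopDegree = d) (hc : 0 < c) (hε : 0 < ε) (hε1 : ε ≤ 1)
    (hcε : c * ε ≤ 1 / 4) (hcε' : 8 * Real.sqrt (2 * c) * ε ≤ 1) (ψ : QubitSpace n)
    (hψ : FlipAssociated ρ ψ R)
    (hρ : ρ ≤ c * (learnTheta d β * ε ^ 2
      / ((n : ℝ) * (Real.sqrt ((n : ℝ) * 2 ^ d) + n) ^ 2))) :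
    ∃ b₀, b₀ * ((n : ℝ) + ((d : ℝ) + 1) ^ 2 * Real.sqrt n)
        ≤ 18432 * Real.sqrt (2 * c) * ε * learnRate d β ∧
      SamplesFrom R (fun x => ‖ψ x‖ ^ 2) d β b₀ (8 * Real.sqrt (2 * c) * ε) := by
  obtain ⟨hX1, -, hX3⟩ := noise_factor_bounds n d hn
  have hXn : Real.sqrt n * Real.sqrt n ≤ Real.sqrt ((n : ℝ) * 2 ^ d) + n := by
    rw [Real.mul_self_sqrt (by positivity)]; linarith [Real.sqrt_nonneg ((n : ℝ) * 2 ^ d)]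
  set X := Real.sqrt ((n : ℝ) * 2 ^ d) + n
  have hϑ := learnTheta_pos d β
  have hX0 : 0 < X := zero_lt_one.trans_le hX1
  have hn1 : (1 : ℝ) ≤ n := by exact_mod_cast hn
  have hr0 : 0 < Real.sqrt n := Real.sqrt_pos.2 (by linarith)
  have hμ0 := learnRate_pos d β
  have hμ1 := learnRate_le d β
  set μ := learnRate d β
  have hrn : Real.sqrt n ^ 2 = n := Real.sq_sqrt (by positivity)
  have hq0 : 0 < Real.sqrt (2 * c) := Real.sqrt_pos.2 (by positivity)
  -- Chosen so that `2ρ exp (2β) ≤ θ²`: `learnTheta` is `(24 μ)²` times a factor that turns `exp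
  -- (2β)` into at most `4`, whence `48 = 2 · 24`.
  set θ := 48 * Real.sqrt (2 * c) * μ * ε / (Real.sqrt n * X) with hθ
  have hθ0 : 0 ≤ θ := by positivity
  have hρ2 : ρ ≤ 1 / 2 := by
    refine hρ.trans ?_
    have h1 := (learnTheta_le_sigmoid_pow d β).trans (sigmoid_pow_le_one d β)
    have h2 : learnTheta d β * ε ^ 2 / ((n : ℝ) * X ^ 2) ≤ 1 * ε ^ 2 / (1 * 1 ^ 2) := by gcongr
    calc c * (learnTheta d β * ε ^ 2 / ((n : ℝ) * X ^ 2)) ≤ c * (1 * ε ^ 2 / (1 * 1 ^ 2)) := by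
          gcongr
      _ ≤ 1 / 2 := by nlinarith
  have hθρ : Real.sqrt (2 * ρ) * Real.exp β ≤ θ := by
    obtain ⟨r, hr, -, hrρ, -⟩ := id hψ
    refine (abs_le_of_sq_le_sq' ?_ hθ0).2
    rw [mul_pow, Real.sq_sqrt (by linarith)]
    have h1 := exp_sq_mul_one_sub_tanh_sq_le β
    calc 2 * ρ * Real.exp β ^ 2
        ≤ 2 * (c * (learnTheta d β * ε ^ 2 / ((n : ℝ) * X ^ 2))) * Real.exp β ^ 2 := by gcongr
      _ = 2 * c * (24 * μ) ^ 2 * ε ^ 2 / ((n : ℝ) * X ^ 2)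
            * (Real.exp β ^ 2 * (1 - Real.tanh β ^ 2)) := by rw [learnTheta_eq]; ring
      _ ≤ 2 * c * (24 * μ) ^ 2 * ε ^ 2 / ((n : ℝ) * X ^ 2) * 4 := by gcongr
      _ = θ ^ 2 := by
          have h2 : Real.sqrt (2 * c) ^ 2 = 2 * c := Real.sq_sqrt (by positivity)
          simp only [hθ, div_pow, mul_pow, hrn, h2]
          ring
  have hnθ : n * θ ≤ 2 * Real.sqrt (2 * c) * ε := by
    rw [hθ, mul_div_assoc', div_le_iff₀ (by positivity)]
    calc (n : ℝ) * (48 * Real.sqrt (2 * c) * μ * ε)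
        = 2 * Real.sqrt (2 * c) * ε * (24 * μ) * (Real.sqrt n * Real.sqrt n) := by
          rw [Real.mul_self_sqrt (by positivity)]; ring
      _ ≤ 2 * Real.sqrt (2 * c) * ε * 1 * (Real.sqrt n * X) := by
          gcongr
          nlinarith [Real.one_le_sqrt.2 hn1]
      _ = _ := by ring
  obtain ⟨-, h1, h2, h3⟩ := flipAssociated_bounds R α β ρ hR ψ hψ hρ2 θ hθρ (by linarith)
  refine ⟨3 * (((d : ℝ) + 1) * θ), ?_, fun u w hw => ?_, fun u => (h3 u).trans ?_, h2.trans ?_⟩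
  · calc 3 * (((d : ℝ) + 1) * θ) * ((n : ℝ) + ((d : ℝ) + 1) ^ 2 * Real.sqrt n)
        = 3 * θ * (((d : ℝ) + 1) * ((n : ℝ) + ((d : ℝ) + 1) ^ 2 * Real.sqrt n)) := by ring
      _ ≤ 3 * θ * (128 * (Real.sqrt n * X)) := by gcongr
      _ = _ := by rw [hθ]; field_simp; norm_num
  · have h4 := R.sigmoid_pow_mul_norm_sq_le α β hR d hd u w hw
    have h5 : ∑ x, R.marginal x / 2 * inner ℝ w (featureVec (R.twoHop u) x) ^ 2
        ≤ ∑ x, ‖ψ x‖ ^ 2 * inner ℝ w (featureVec (R.twoHop u) x) ^ 2 :=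
      Finset.sum_le_sum fun x _ => mul_le_mul_of_nonneg_right (h1 x) (sq_nonneg _)
    simp only [div_mul_eq_mul_div, ← Finset.sum_div] at h5
    linarith
  · have : ((R.twoHop u).card : ℝ) ≤ d := by exact_mod_cast hd ▸ R.card_twoHop_le u
    gcongr
  · linarith

end noise

/-! ### The learner -/

section learner

variable {n m : ℕ}

theorem sum_abs_sub_le_two {ι : Type*} [Fintype ι] (f g : ι → ℝ) (hf : ∀ x, 0 ≤ f x)
    (hg : ∀ x, 0 ≤ g x) (hf1 : ∑ x, f x = 1) (hg1 : ∑ x, g x = 1) :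
    ∑ x, |f x - g x| ≤ 2 := by
  calc ∑ x, |f x - g x| ≤ ∑ x, (f x + g x) := Finset.sum_le_sum fun x _ =>
        abs_le.2 ⟨by linarith [hf x, hg x], by linarith [hf x, hg x]⟩
    _ = 2 := by rw [Finset.sum_add_distrib, hf1, hg1]; norm_num

theorem sum_abs_sub_mrf_le_two (ψ : QubitSpace n) (hψ : ‖ψ‖ = 1) (q : Finset (Fin n) → ℝ) :
    ∑ x, |‖ψ x‖ ^ 2 - mrf q x| ≤ 2 :=
  sum_abs_sub_le_two _ _ (fun _ => sq_nonneg _) (fun x => (gibbs_pos (potentialValue q) x).le)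
    (sum_norm_sq_eq_one ψ hψ) (sum_gibbs (potentialValue q))

theorem ofReal_one_sub_le_of_forall (ψ : QubitSpace n) (hψ : ‖ψ‖ = 1) (k : ℕ) (δ : ℝ)
    (hδ : 0 < δ) (A : Set (Fin k → Cfg n)) (hA : ∀ s, s ∈ A) :
    ENNReal.ofReal (1 - δ) ≤ Measure.pi (fun _ : Fin k => bornMeasure ψ) A :=
  ofReal_le_pi_bornMeasure ψ hψ k A δ (fun _ => False) (fun s _ => hA s) (by simp [hδ.le])

variable (R : RBM n m) (α β : ℝ) (d : ℕ)

/-- Without any iteration, the learner returns the uniform distribution, which suffices if all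
interactions are weak. -/
theorem sum_abs_sub_mrf_zero_le (hR : R.Nondegenerate α β) (hd : R.twoHopDegree = d)
    (hβ : 0 ≤ β) (P : Cfg n → ℝ) (b₀ τ : ℝ) (hP : SamplesFrom R P d β b₀ τ)
    (hdβ : d * β ≤ 1 / 4) (pick : Finset (Fin n) → Fin n) {k : ℕ} (x : Fin k → Cfg n)
    (a : Fin 0 → Cfg n) :
    ∑ z, |P z - mrf (learnedPotential 0 R.twoHop pick x a) z| ≤ τ + 2 * (β * Real.sqrt n) := by
  have h := sum_abs_gibbs_sub_uniform_le R.twoHop R.mem_twoHop_comm R.potential β hβ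
    (fun u x => by rw [abs_siteDeriv]; linarith [R.abs_potential_sub_le α β hR u x])
    (fun u v huv hv x => R.siteDeriv_potential_flipAt u v huv hv x) d
    (fun u => hd ▸ R.card_twoHop_le u) hdβ
  rw [mrf_learnedPotential_zero]
  calc ∑ z, |P z - gibbs (fun _ => 0) z|
      ≤ ∑ z, (|P z - R.marginal z| + |gibbs (fun _ => 0) z - gibbs R.potential z|) := by
        refine Finset.sum_le_sum fun z _ => ?_
        rw [R.marginal_eq_gibbs, abs_sub_comm (gibbs (fun _ => 0) z)]
        exact abs_sub_le _ _ _
    _ ≤ _ := by rw [Finset.sum_add_distrib]; exact add_le_add hP.dist h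

/-- If the empirical moments are accurate, the learned distribution is close to the distribution
of the samples, either because the coefficients are accurate, or because they are moderately
accurate and all interactions are weak. -/
theorem sum_abs_sub_mrf_le (hR : R.Nondegenerate α β) (hd : R.twoHopDegree = d) (hn : 0 < n)
    (hβ : 0 ≤ β) (P : Cfg n → ℝ) (b₀ τ : ℝ) (hP : SamplesFrom R P d β b₀ τ)
    (pick : Finset (Fin n) → Fin n) (hpick : ∀ S, S.Nonempty → pick S ∈ S) {k : ℕ}
    (x : Fin k → Cfg n) (a : Fin 0 → Cfg n) (s : ℝ) (hs : 0 < s)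
    (hx : ‖momentDeviation R.potential R.twoHop P x‖ ≤ 14 * Real.sqrt n * s)
    (hsmall : 14 * Real.sqrt n * s + b₀ ≤ learnRate d β / 2) (t₁ t₂ : ℕ)
    (ht₁ : 2 * (β * Real.sqrt (2 ^ d)) ≤ learnRate d β * t₁)
    (ht₂ : β * Real.sqrt (2 ^ d) / s ≤ t₂) (W : ℝ)
    (hW : n * (15 * s + b₀) ≤ W * learnRate d β ∨
      (d * β + ((d : ℝ) + 1) ^ 2 * (Real.sqrt n * (15 * s + b₀) / learnRate d β) ≤ 1 / 4 ∧
        ((d : ℝ) + 1) ^ 2 * (Real.sqrt n * (15 * s + b₀) / learnRate d β) ≤ W)) :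
    ∑ z, |P z - mrf (learnedPotential (t₁ + t₂) R.twoHop pick x a) z| ≤ τ + 2 * W := by
  have hμ0 := learnRate_pos d β
  have hb0 : 0 ≤ b₀ := (norm_nonneg _).trans (hP.gradient ⟨0, hn⟩)
  have hβq : ∀ u x, |siteDeriv u R.potential x| ≤ β := fun u x => by
    rw [abs_siteDeriv]; linarith [R.abs_potential_sub_le α β hR u x]
  have hcard : ∀ u, (R.twoHop u).card ≤ d := fun u => hd ▸ R.card_twoHop_le u
  set w : Fin n → EuclideanSpace ℝ (Finset (Fin n)) := fun u =>
    alphatronVec (R.twoHop u) u x (t₁ + t₂) - targetVec R.potential u (R.twoHop u) with hw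
  -- The optimisation error of each node is taken equal to the unit `s` of the statistical error, so
  -- that the two add up to `√n s + 14 √n s`.
  set η := Real.sqrt n * (15 * s + b₀) / learnRate d β with hη
  have hη0 : 0 ≤ η := by positivity
  have hwη : ∑ u, ‖w u‖ ^ 2 ≤ η ^ 2 := by
    have h := sum_norm_alphatronVec_sub_sq_le R.potential R.twoHop R.notMem_twoHop_self
      R.walshCoeff_potential_eq_zero P x β (Real.sigmoid (-2 * β) ^ d / 4) b₀
      (β * Real.sqrt (2 ^ d)) s (14 * Real.sqrt n * s) hβq
      (by have := Real.sigmoid_pos (-2 * β); positivity)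
      (by linarith [sigmoid_pow_le_one d β]) hP.secondMoment hP.gradient hx hsmall
      (fun u => (norm_targetVec_le R.potential u _ (R.notMem_twoHop_self u)
        (R.walshCoeff_potential_eq_zero u) β (hβq u)).trans (by
          gcongr
          · norm_num
          · exact hcard u)) hs t₁ t₂ ht₁ ht₂
    refine h.trans (le_of_eq ?_)
    rw [hη, learnRate]
    congr 2
    ring
  have hwN : ∀ u S, ¬ S ⊆ R.twoHop u → w u S = 0 := fun u S hS => by
    rw [hw, PiLp.sub_apply, targetVec_apply_eq_zero _ _ _ _ hS, sub_zero]
    exact alphatronVec_apply_eq_zero _ _ _ _ _ hS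
  have key : ∑ z, |gibbs (fun y => R.potential y + potentialValue (coeffError R.twoHop pick w) y) z
      - gibbs R.potential z| ≤ 2 * W := by
    rcases hW with h | ⟨h1, h2⟩
    · refine (sum_abs_gibbs_sub_le_sqrt_mul R.twoHop pick hpick w hwN R.potential η hη0 hwη).trans ?_
      have e : Real.sqrt n * η = n * (15 * s + b₀) / learnRate d β := by
        rw [hη, mul_div_assoc', ← mul_assoc, Real.mul_self_sqrt (by positivity)]
      have h3 : n * (15 * s + b₀) / learnRate d β ≤ W := (div_le_iff₀ hμ0).2 h
      have h4 : 0 ≤ n * (15 * s + b₀) / learnRate d β := by positivity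
      linarith
    · refine (sum_abs_gibbs_sub_le_of_weak_dependence R.twoHop pick hpick w hwN
        R.mem_twoHop_comm R.potential β hβ hβq
        (fun u v huv hv x => R.siteDeriv_potential_flipAt u v huv hv x) d hcard η hη0 hwη
        h1).trans ?_
      have h3 : ((d : ℝ) + 1) * η ≤ ((d : ℝ) + 1) ^ 2 * η := by
        refine mul_le_mul_of_nonneg_right ?_ hη0
        nlinarith [Nat.cast_nonneg (α := ℝ) d]
      linarith
  rw [mrf_learnedPotential_eq R.twoHop pick hpick R.potential R.walshCoeff_potential_eq_zero]
  calc ∑ z, |P z - gibbs (fun y => R.potential y + potentialValue (coeffError R.twoHop pick w) y) z|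
      ≤ ∑ z, (|P z - R.marginal z|
        + |gibbs (fun y => R.potential y + potentialValue (coeffError R.twoHop pick w) y) z
          - gibbs R.potential z|) := by
        refine Finset.sum_le_sum fun z _ => ?_
        rw [R.marginal_eq_gibbs, abs_sub_comm (gibbs (fun y => _) z)]
        exact abs_sub_le _ _ _
    _ ≤ _ := by rw [Finset.sum_add_distrib]; exact add_le_add hP.dist key

end learner

/-! ### Balancing the errors and the main theorem -/

/-- The number of copies bounds the statistical error. -/
theorem sqrt_log_div_mul_le (C β ε ℓ : ℝ) (n d : ℕ) (M : ℝ) (hC : 0 < C)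
    (hε : 0 < ε) (hM0 : 0 < M) (hℓ : 0 < ℓ)
    (hM : C * (β ^ 2 * 2 ^ d * (n : ℝ) ^ 2 * ℓ
      / (learnTheta d β * (1 - Real.tanh β ^ 2) * ε ^ 4)) ≤ M) :
    Real.sqrt (ℓ / M) * (β * Real.sqrt (2 ^ d)) * n
      ≤ 24 * (Real.sqrt C)⁻¹ * learnRate d β * ε ^ 2 := by
  have hμ0 := learnRate_pos d β
  have hκ0 := one_sub_tanh_sq_pos β
  have hκ1 := one_sub_tanh_sq_le_one β
  have hϑ := learnTheta_pos d β
  refine (abs_le_of_sq_le_sq' ?_ (by positivity)).2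
  have h1 : (Real.sqrt (ℓ / M) * (β * Real.sqrt (2 ^ d)) * n) ^ 2
      = β ^ 2 * 2 ^ d * (n : ℝ) ^ 2 * ℓ / M := by
    rw [mul_pow, mul_pow, mul_pow, Real.sq_sqrt (by positivity), Real.sq_sqrt (by positivity)]
    ring
  have h2 : (24 * (Real.sqrt C)⁻¹ * learnRate d β * ε ^ 2) ^ 2
      = (24 * learnRate d β) ^ 2 * ε ^ 4 / C := by
    rw [mul_pow, mul_pow, mul_pow, inv_pow, Real.sq_sqrt hC.le]
    ring
  rw [h1, h2, div_le_div_iff₀ hM0 hC]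
  rw [mul_div_assoc', div_le_iff₀ (by positivity)] at hM
  have h3 : learnTheta d β * (1 - Real.tanh β ^ 2) ≤ (24 * learnRate d β) ^ 2 :=
    (mul_le_of_le_one_right hϑ.le hκ1).trans (learnTheta_le_sq d β)
  calc β ^ 2 * 2 ^ d * (n : ℝ) ^ 2 * ℓ * C = C * (β ^ 2 * 2 ^ d * (n : ℝ) ^ 2 * ℓ) := by ring
    _ ≤ M * (learnTheta d β * (1 - Real.tanh β ^ 2) * ε ^ 4) := hM
    _ ≤ M * ((24 * learnRate d β) ^ 2 * ε ^ 4) := by gcongr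
    _ = _ := by ring

theorem norm_eq_one_of_associated {n m : ℕ} (R : RBM n m) (ψ : QubitSpace n)
    {p : ℝ → ℝ → Prop} {q : ℝ → Prop}
    (hψ : (∃ a b : ℝ, 1 ≤ a ∧ LpAssociated a b ψ R ∧ p a b) ∨
      (∃ ρ : ℝ, FlipAssociated ρ ψ R ∧ q ρ)) : ‖ψ‖ = 1 := by
  rcases hψ with ⟨a, b, -, h, -⟩ | ⟨ρ, h, -⟩
  · exact h.1
  · exact norm_eq_one_of_flipAssociated ρ ψ R h

/-- The tolerated noise leaves a sampling distribution from which the learner can learn. -/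
theorem exists_samplesFrom {n m : ℕ} (R : RBM n m) (α β c ε : ℝ) (d : ℕ) (hn : 0 < n)
    (hR : R.Nondegenerate α β) (hd : R.twoHopDegree = d) (hc : 0 < c) (hε : 0 < ε)
    (hsmall : (6144 * c + 18432 * Real.sqrt (2 * c) + 64) * ε ≤ 1 / 4) (ψ : QubitSpace n)
    (hψ : (∃ p ε_p : ℝ, 1 ≤ p ∧ LpAssociated p ε_p ψ R ∧
              ε_p ≤ c * (learnTheta d β * ε ^ 2
                / ((Real.sqrt ((n : ℝ) * 2 ^ d) + n) ^ 2
                    * (2 : ℝ) ^ (((n : ℝ) - 1) * (1 - 1 / p))))) ∨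
            (∃ ρ : ℝ, FlipAssociated ρ ψ R ∧
              ρ ≤ c * (learnTheta d β * ε ^ 2
                / ((n : ℝ) * (Real.sqrt ((n : ℝ) * 2 ^ d) + n) ^ 2)))) :
    ∃ b₀, b₀ * ((n : ℝ) + ((d : ℝ) + 1) ^ 2 * Real.sqrt n)
        ≤ (6144 * c + 18432 * Real.sqrt (2 * c) + 64) * ε * learnRate d β ∧
      SamplesFrom R (fun x => ‖ψ x‖ ^ 2) d β b₀
        ((6144 * c + 18432 * Real.sqrt (2 * c) + 64) * ε) := by
  have hq : 0 < Real.sqrt (2 * c) := Real.sqrt_pos.2 (by positivity)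
  have hμ := learnRate_pos d β
  have h1 : 0 < c * ε := by positivity
  have h2 : 0 < Real.sqrt (2 * c) * ε := by positivity
  have e : (6144 * c + 18432 * Real.sqrt (2 * c) + 64) * ε
      = 6144 * (c * ε) + 18432 * (Real.sqrt (2 * c) * ε) + 64 * ε := by ring
  rw [e] at hsmall ⊢
  rcases hψ with ⟨p, ε_p, hp, hψ, hεp⟩ | ⟨ρ, hψ, hρ⟩
  · obtain ⟨b₀, hb, h⟩ := samplesFrom_of_lpAssociated R α β c ε p ε_p d hn hR hd hc hε
      (by linarith) (by linarith) ψ hp hψ hεp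
    exact ⟨b₀, hb.trans (mul_le_mul_of_nonneg_right (by linarith) hμ.le), h.secondMoment,
      h.gradient, h.dist.trans (by linarith)⟩
  · obtain ⟨b₀, hb, h⟩ := samplesFrom_of_flipAssociated R α β c ε ρ d hn hR hd hc hε
      (by linarith) (by linarith) (by linarith) ψ hψ hρ
    exact ⟨b₀, hb.trans (mul_le_mul_of_nonneg_right (by linarith) hμ.le), h.secondMoment,
      h.gradient, h.dist.trans (by linarith)⟩

/-- The statistical error of the coefficients, in the two regimes in which the learner iterates:
either the target vectors are large, or the interactions are weak. -/
theorem statistical_error_bounds (n d : ℕ) (hn : 0 < n) (β ε g μ s : ℝ) (hβ : 0 ≤ β)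
    (hε : 0 < ε) (hs : 0 < s) (hg : 0 < g) (hμ1 : 24 * μ ≤ 1)
    (h : s * (β * Real.sqrt (2 ^ d)) * n ≤ 24 * g * μ * ε ^ 2)
    (hreg : ε ≤ β * Real.sqrt (2 ^ d) ∨ ε ≤ β * Real.sqrt n) :
    Real.sqrt n * s ≤ 24 * g * ε * μ ∧ s ≤ g * (β * Real.sqrt (2 ^ d)) ∧
    (n * s ≤ 24 * g * ε * μ ∨ (β * Real.sqrt (2 ^ d) < ε ∧
      ((d : ℝ) + 1) ^ 2 * (Real.sqrt n * s) ≤ 64 * (24 * g * ε * μ))) := by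
  have hn1 : (1 : ℝ) ≤ n := by exact_mod_cast hn
  have hr1 : 1 ≤ Real.sqrt n := Real.one_le_sqrt.2 hn1
  have hrr : (n : ℝ) = Real.sqrt n * Real.sqrt n := (Real.mul_self_sqrt (by positivity)).symm
  have hD1 : 1 ≤ Real.sqrt ((2 : ℝ) ^ d) := Real.one_le_sqrt.2 (one_le_pow₀ (by norm_num))
  have h2 := add_one_pow_le_of_le_three d 2 (by norm_num)
  set r := Real.sqrt n
  set D := Real.sqrt ((2 : ℝ) ^ d)
  have hDr : ε ≤ β * D * r := by
    rcases hreg with h | h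
    · exact h.trans (le_mul_of_one_le_right (by positivity) hr1)
    · exact h.trans (mul_le_mul_of_nonneg_right (le_mul_of_one_le_right hβ hD1) (by positivity))
  have hfirst : r * s ≤ 24 * g * ε * μ := by
    refine le_of_mul_le_mul_right ?_ hε
    calc r * s * ε ≤ r * s * (β * D * r) := by gcongr
      _ = s * (β * D) * n := by rw [hrr]; ring
      _ ≤ _ := by linarith
  refine ⟨hfirst, ?_, ?_⟩
  · have hB : 0 < β * D * r := hε.trans_le hDr
    refine le_of_mul_le_mul_right ?_ (mul_pos hB (zero_lt_one.trans_le hr1))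
    have h3 : ε ^ 2 ≤ (β * D * r) ^ 2 := pow_le_pow_left₀ hε.le hDr 2
    calc s * (β * D * r * r) = s * (β * D) * n := by rw [hrr]; ring
      _ ≤ 24 * g * μ * ε ^ 2 := h
      _ = g * (24 * μ) * ε ^ 2 := by ring
      _ ≤ g * 1 * (β * D * r) ^ 2 := by gcongr
      _ = _ := by ring
  · rcases le_or_gt ε (β * D) with h3 | h3
    · left
      refine le_of_mul_le_mul_right ?_ hε
      calc n * s * ε ≤ n * s * (β * D) := by gcongr
        _ = s * (β * D) * n := by ring
        _ ≤ _ := by linarith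
    · right
      refine ⟨h3, ?_⟩
      have h5 := hreg.resolve_left h3.not_ge
      have h4 : D * (r * s) ≤ 24 * g * ε * μ := by
        refine le_of_mul_le_mul_right ?_ hε
        calc D * (r * s) * ε ≤ D * (r * s) * (β * r) := by gcongr
          _ = s * (β * D) * n := by rw [hrr]; ring
          _ ≤ _ := by linarith
      calc ((d : ℝ) + 1) ^ 2 * (r * s) ≤ 64 * D * (r * s) := by gcongr
        _ ≤ _ := by linarith

/-- The number of iterations after which Alphatron has converged up to an error `s`. -/
theorem ceil_add_ceil_le (B μ s g : ℝ) (hB : 0 ≤ B) (hμ : 0 < μ) (hs : 0 < s)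
    (hsμ : 2 * s ≤ μ) (hsB : s ≤ g * B) :
    ((⌈2 * B / μ⌉₊ + ⌈B / s⌉₊ : ℕ) : ℝ) ≤ (2 + 2 * g) * (B / s) := by
  have h1 : 2 * B / μ ≤ B / s := by
    rw [div_le_div_iff₀ hμ hs]; nlinarith
  -- Rounding up adds less than `2`; this lower bound on `B / s` lets the multiplicative constant
  -- absorb it.
  have h2 : 1 ≤ g * (B / s) := by
    rw [mul_div_assoc', le_div_iff₀ hs]; linarith
  have h3 := Nat.ceil_lt_add_one (div_nonneg (mul_nonneg zero_le_two hB) hμ.le)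
  have h4 := Nat.ceil_lt_add_one (div_nonneg hB hs.le)
  push_cast
  linarith

theorem mainTheorem3 (c C : ℝ) (hc : 0 < c) (hC : 0 < C) :
    ∃ K L : ℝ, 0 < K ∧ 0 < L ∧
      ∀ (n d₂ : ℕ) (β ε_t δ : ℝ), 0 ≤ β → 0 < ε_t → 0 < δ → δ ≤ 1 / 2 →
      ∀ M : ℕ,
        C * (β ^ 2 * 2 ^ d₂ * (n : ℝ) ^ 2 * Real.log (1 / δ)
          / (learnTheta d₂ β * (1 - Real.tanh β ^ 2) * ε_t ^ 4)) ≤ (M : ℝ) →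
      ∃ T k N : ℕ, k + N = M ∧
        (T : ℝ) ≤ L * (β * Real.sqrt (2 ^ d₂) * Real.sqrt ((M : ℝ) / Real.log (1 / δ))) ∧
        ∀ (α : ℝ) (m : ℕ) (R : RBM n m), R.IsAdmissible d₂ α β →
        ∀ ψ : QubitSpace n,
          ((∃ p ε_p : ℝ, 1 ≤ p ∧ LpAssociated p ε_p ψ R ∧
              ε_p ≤ c * (learnTheta d₂ β * ε_t ^ 2
                / ((Real.sqrt ((n : ℝ) * 2 ^ d₂) + n) ^ 2
                    * (2 : ℝ) ^ (((n : ℝ) - 1) * (1 - 1 / p))))) ∨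
            (∃ ρ : ℝ, FlipAssociated ρ ψ R ∧
              ρ ≤ c * (learnTheta d₂ β * ε_t ^ 2
                / ((n : ℝ) * (Real.sqrt ((n : ℝ) * 2 ^ d₂) + n) ^ 2)))) →
        ∀ pick : Finset (Fin n) → Fin n, (∀ S, S.Nonempty → pick S ∈ S) →
          ENNReal.ofReal (1 - δ) ≤
            Measure.pi (fun _ : Fin (k + N) => bornMeasure ψ)
              {s | ∑ x, |‖ψ x‖ ^ 2 - mrf (learnedPotential T R.twoHop pick
                      (fun i => s (Fin.castAdd N i)) (fun l => s (Fin.natAdd k l))) x|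
                    ≤ K * ε_t} := by
  set g := (Real.sqrt C)⁻¹ with hg
  have hg0 : 0 < g := inv_pos.2 (Real.sqrt_pos.2 hC)
  set K₂ := 6144 * c + 18432 * Real.sqrt (2 * c) + 64 with hK₂
  have hK₂64 : 64 ≤ K₂ := by
    have := Real.sqrt_nonneg (2 * c)
    rw [hK₂]; linarith
  -- The first term pays for `d β ≤ 64 β 2^(d/2)` in the weak dependence condition, the second for
  -- the statistical error (`23040 = 15 · 64 · 24`), the third for the noise.
  set W := 64 + 23040 * g + K₂ with hW
  have hW0 : 0 < W := by positivity
  refine ⟨8 * W, 2 + 2 * g, by positivity, by positivity, ?_⟩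
  intro n d β ε δ hβ hε hδ hδ2 M hM
  have hT0 : ((0 : ℕ) : ℝ)
      ≤ (2 + 2 * g) * (β * Real.sqrt (2 ^ d) * Real.sqrt ((M : ℝ) / Real.log (1 / δ))) := by
    rw [Nat.cast_zero]; positivity
  -- Large errors are always achieved, and so are all errors without nodes.
  by_cases htriv : 1 / 4 < W * ε ∨ n = 0
  · refine ⟨0, M, 0, rfl, hT0, fun α m R hR ψ hψ pick hpick => ?_⟩
    have hψ1 := norm_eq_one_of_associated R ψ hψ
    refine ofReal_one_sub_le_of_forall ψ hψ1 _ δ hδ _ fun s => ?_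
    rcases htriv with h | rfl
    · exact (sum_abs_sub_mrf_le_two ψ hψ1 _).trans (by linarith)
    · have h1 := sum_norm_sq_eq_one ψ hψ1
      have h2 := sum_gibbs (potentialValue (learnedPotential 0 R.twoHop pick
        (fun i => s (Fin.castAdd 0 i)) fun l => s (Fin.natAdd M l)))
      rw [Fintype.sum_unique] at h1 h2
      have h3 : ∀ q : Finset (Fin 0) → ℝ, mrf q = gibbs (potentialValue q) := fun _ => rfl
      rw [Set.mem_ofPred_eq, Fintype.sum_unique, h1, h3, h2, sub_self, abs_zero]
      positivity
  obtain ⟨hWε, hn⟩ := not_or.1 htriv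
  rw [not_lt] at hWε
  have hn : 0 < n := Nat.pos_of_ne_zero hn
  have hn1 : (1 : ℝ) ≤ n := by exact_mod_cast hn
  have hgε : 0 < g * ε := by positivity
  have hWe : W * ε = 64 * ε + 23040 * (g * ε) + K₂ * ε := by rw [hW]; ring
  have hK₂ε : 0 < K₂ * ε := by positivity
  have hμ0 := learnRate_pos d β
  have hμ1 := learnRate_le d β
  set μ := learnRate d β with hμ
  have hdD : (d : ℝ) * β ≤ 64 * (β * Real.sqrt (2 ^ d)) := by
    have := add_one_pow_le_of_le_three d 1 (by norm_num)
    nlinarith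
  have hnoise : ∀ (α : ℝ) (m : ℕ) (R : RBM n m), R.IsAdmissible d α β →
      ∀ ψ : QubitSpace n, _ → _ := fun α m R hR ψ hψ =>
    exists_samplesFrom R α β c ε d hn hR.2.1 hR.2.2 hc hε (by linarith) ψ hψ
  -- For tiny `β` the hypothesis on `M` is nearly void and the allowed number of iterations tends to
  -- zero, so the learner must not iterate; the uniform distribution suffices.
  by_cases hweak : β * Real.sqrt (2 ^ d) < ε ∧ β * Real.sqrt n < ε
  · refine ⟨0, M, 0, rfl, hT0, fun α m R hR ψ hψ pick hpick => ?_⟩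
    obtain ⟨b₀, -, hP⟩ := hnoise α m R hR ψ hψ
    have hψ1 := norm_eq_one_of_associated R ψ hψ
    refine ofReal_one_sub_le_of_forall ψ hψ1 _ δ hδ _ fun s => ?_
    refine (sum_abs_sub_mrf_zero_le R α β d hR.2.1 hR.2.2 hβ _ b₀ _ hP (by linarith) pick _
      _).trans ?_
    linarith [hweak.2]
  have hreg : ε ≤ β * Real.sqrt (2 ^ d) ∨ ε ≤ β * Real.sqrt n := by
    by_contra h
    rw [not_or, not_le, not_le] at h
    exact hweak h
  have hβ0 : 0 < β := by
    rcases hβ.lt_or_eq with h | rfl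
    · exact h
    · rw [zero_mul, zero_mul, or_self] at hreg; linarith
  have hℓ : 0 < Real.log (1 / δ) := Real.log_pos (by rw [lt_div_iff₀ hδ]; linarith)
  have hM0 : (0 : ℝ) < M := by
    have h1 := learnTheta_pos d β
    have h2 := one_sub_tanh_sq_pos β
    have h3 : (0 : ℝ) < n := by linarith
    exact lt_of_lt_of_le (by positivity) hM
  have hS := sqrt_log_div_mul_le C β ε _ n d M hC hε hM0 hℓ hM
  set s := Real.sqrt (Real.log (1 / δ) / M) with hs
  have hs0 : 0 < s := Real.sqrt_pos.2 (by positivity)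
  obtain ⟨hs1, hs2, hs3⟩ := statistical_error_bounds n d hn β ε g μ s hβ hε hs0 hg0 hμ1
    hS hreg
  have hr1 : 1 ≤ Real.sqrt n := Real.one_le_sqrt.2 hn1
  have hgεμ : 23040 * (g * ε) * μ ≤ 1 / 4 * μ :=
    mul_le_mul_of_nonneg_right (by linarith) hμ0.le
  have hsμ : 2 * s ≤ μ := by linarith [le_mul_of_one_le_left hs0.le hr1]
  set B := β * Real.sqrt (2 ^ d) with hB
  have hB0 : 0 ≤ B := by positivity
  -- All copies are used for training. The first summand brings the error below `1`, the second
  -- makes the optimisation error comparable to the statistical one.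
  refine ⟨⌈2 * B / μ⌉₊ + ⌈B / s⌉₊, M, 0, rfl, ?_, fun α m R hR ψ hψ pick hpick => ?_⟩
  · have e : Real.sqrt (M / Real.log (1 / δ)) = s⁻¹ := by
      rw [hs, ← Real.sqrt_inv, inv_div]
    rw [e, ← div_eq_mul_inv]
    exact ceil_add_ceil_le B μ s g hB0 hμ0 hs0 hsμ hs2
  obtain ⟨b₀, hb, hP⟩ := hnoise α m R hR ψ hψ
  have hψ1 := norm_eq_one_of_associated R ψ hψ
  have hb0 : 0 ≤ b₀ := (norm_nonneg _).trans (hP.gradient ⟨0, hn⟩)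
  rw [mul_add] at hb
  have hd0 : 0 ≤ b₀ * (((d : ℝ) + 1) ^ 2 * Real.sqrt n) := by positivity
  have hb1 : b₀ ≤ b₀ * n := le_mul_of_one_le_right hb0 hn1
  have hWμ : W * ε * μ ≤ 1 / 4 * μ := mul_le_mul_of_nonneg_right hWε hμ0.le
  have hWμe : W * ε * μ = 64 * ε * μ + 23040 * (g * ε * μ) + K₂ * ε * μ := by rw [hWe]; ring
  have hεμ : 0 < ε * μ := by positivity
  have hgεμ0 : 0 < g * ε * μ := by positivity
  classical
  refine ofReal_le_pi_bornMeasure ψ hψ1 _ _ δ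
    (fun x => 14 * Real.sqrt n * s < ‖momentDeviation R.potential R.twoHop (fun x => ‖ψ x‖ ^ 2) x‖)
    (fun x hx => ?_)
    (sum_sampleWeight_momentDeviation_le R.potential R.twoHop _ (fun _ => sq_nonneg _)
      (sum_norm_sq_eq_one ψ hψ1) hn M (by exact_mod_cast hM0) δ hδ hδ2 _ fun x hx => hx)
  refine (sum_abs_sub_mrf_le R α β d hR.2.1 hR.2.2 hn hβ _ b₀ _ hP pick hpick _ _ s hs0
    (not_lt.1 hx) (by linarith) ⌈2 * B / μ⌉₊ ⌈B / s⌉₊ ?_ (Nat.le_ceil _) (W * ε) ?_).trans ?_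
  · have := (div_le_iff₀ hμ0).1 (Nat.le_ceil (2 * B / μ))
    linarith
  -- The supremum norm bound serves the first regime. In the second, `d β` and the coefficient
  -- errors together stay below `W ε ≤ 1/4`, as weak dependence requires.
  · rcases hs3 with h | ⟨h1, h2⟩
    · left
      linarith
    · right
      have h3 : ((d : ℝ) + 1) ^ 2 * (Real.sqrt n * (15 * s + b₀) / μ)
          ≤ 23040 * (g * ε) + K₂ * ε := by
        rw [mul_div_assoc', div_le_iff₀ hμ0]
        linarith
      exact ⟨by linarith, by linarith⟩
  · linarith
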